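/- **Theorem A.** **(1) Regular martingales.** Let $R>0$. There is a constant $C=C(R)$ with the following property. Let $(\Omega,\mathcal F,\mu)$ be a probability space with a filtration $(\mathcal F_k)_{k\ge 0}$ that is regular with constant $R$, that is, $\mathsf E_{k}g\le R\,\mathsf E_{k-1}g$ a.e. for all $k\ge1$ and all integrable $g\ge0$, where $\mathsf E_k=\mathsf E[\,\cdot\,|\mathcal F_k]$. Let $f\in L^\infty(\Omega)$, $df_0=\mathsf E_0f$, $df_k=\mathsf E_kf-\mathsf E_{k-1}f$ for $k\ge1$, and $r=\frac1{2(R+3)}$. For a stopping time $\nu$ with values in $\{0,1,2,\dots\}\cup\{\infty\}$ put $\mathcal M_{(\nu)}f(x)=\sup_{k\ge\nu(x)}|\mathsf E_kf(x)|$ and $\mathsf P^r_\nu g=\sum_{k\ge0}\mathbf 1_{\{\nu=k\}}\mathsf P^r_kg$, where $\mathsf P_k^rg(x)=\inf\{t\in\mathbb Q:\mathsf E_k[\mathbf 1_{\{g>t\}}](x)\le r\}$ is the conditional percentile. A sequence of stopping times $\nu_0\le\nu_1\le\cdots$ is called sparse if $\mu(A\cap\{\nu_{j+1}<\infty\})\le\frac12\mu(A)$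 for all $j$ and all $A\in\mathcal F_{\nu_j}$ with $A\subseteq\{\nu_j<\infty\}$. (a) For every sequence $(\sigma_k)_{k\ge0}$ such that $\sigma_k$ is $\mathcal F_{k-1}$-measurable ($\mathcal F_{-1}:=\mathcal F_0$) and $\|\sigma_k\|_\infty\le1$, the maximal truncation $T^*f=\sup_{\ell\ge0}\big|\sum_{k=0}^{\ell}\sigma_k\,df_k\big|$ of the martingale transform satisfies, for some sparse sequence of stopping times $(\nu_j)_{j\ge0}$, $$T^*f\le C\sum_{j\ge0}\mathsf P^r_{\nu_j}(\mathcal M_{(\nu_j)}f)\,\mathbf 1_{\{\nu_j<\infty\}}\quad\text{a.e.}$$ (b) The square function $Sf=\big(\sum_{m\ge0}|df_m|^2\big)^{1/2}$ satisfies, for some sparse sequence of stopping times $(\nu_j)_{j\ge0}$, $$Sf\le C\Big(\sum_{j\ge0}\big[\mathsf P^r_{\nu_j}(\mathcal M_{(\nu_j)}f)\big]^2\,\mathbf 1_{\{\nu_j<\infty\}}\Big)^{1/2}\quad\text{a.e.}$$ **(2) Dyadic operators.** Let $d\ge1$ and let $\mathscr D=\bigcup_{k\in\mathbb Z}\mathscr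 D_k$ be the standard dyadic cubes in $\mathbb R^d$, those in $\mathscr D_k$ having side length $2^{-k}$; let $\mathscr D_t(Q)$ be the family of dyadic subcubes of $Q$ of side length $2^{-t}\ell(Q)$. For $Q\in\mathscr D$ put $\langle f\rangle_Q=\frac1{|Q|}\int_Qf$, $\mathcal M_Qf(x)=\sup\{|\langle f\rangle_{Q'}|:x\in Q'\in\mathscr D,\ Q'\subseteq Q\}$, and $\mathsf P_Q^r(g)=\inf\{\lambda\in\mathbb R:|\{x\in Q:g(x)>\lambda\}|\le r|Q|\}$. A family $\mathcal S\subseteq\mathscr D$ is called sparse if there are pairwise disjoint measurable sets $E_Q\subseteq Q$, $Q\in\mathcal S$, with $|E_Q|\ge\frac12|Q|$. (a) Let $t,s\ge0$ be integers. There are $r\in(0,1)$ and $C$, depending only on $d,t,s$, such that the following holds. Let $\{h_Q^i:Q\in\mathscr D,\ 1\le i\le2^d-1\}$ be a Haar basis of $L^2(\mathbb R^d)$ (for each $Q$, the functions $h_Q^i$ are an orthonormal basis of the space of functions that vanish outside $Q$, are constant on the dyadic children of $Q$, and have integral $0$), and let $\alpha^{Q}_{T,i,S,j}$ be real coefficients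 with $|\alpha^{Q}_{T,i,S,j}|\le A$. Then for every locally integrable $f:\mathbb R^d\to\mathbb R$ (in particular for every $f\in L^1$ and every bounded measurable $f$) there is a sparse family $\mathcal S\subseteq\mathscr D$ such that, for all $x\in\mathbb R^d$, the maximal truncation of the Haar shift satisfies $$\sup_{\ell<m}\Big|\sum_{k=\ell}^m\ \sum_{x\in Q\in\mathscr D_k}\ \sum_{T\in\mathscr D_t(Q)}\ \sum_{S\in\mathscr D_s(Q)}\ \sum_{i,j}\alpha^{Q}_{T,i,S,j}\,\langle f,h^i_T\rangle\,h^j_S(x)\Big|\le C\,A\sum_{Q\in\mathcal S}\mathsf P_Q^r(\mathcal M_Qf)\,\mathbf 1_Q(x).$$ (b) There are $r\in(0,1)$ and $C$, depending only on $d$, such that for every locally integrable $f:\mathbb R^d\to\mathbb R$ there is a sparse family $\mathcal S\subseteq\mathscr D$ with $$\mathcal M_{\mathscr D}f(x)=\sup_{x\in Q\in\mathscr D}|\langle f\rangle_Q|\le C\sum_{Q\in\mathcal S}\mathsf P_Q^r(\mathcal M_Qf)\,\mathbf 1_Q(x)\qquad\text{for all }x\in\mathbb R^d.$$ -/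

import Mathlib

open MeasureTheory Filter Set
open scoped ENNReal NNReal

universe u

noncomputable section

namespace CancellativeSparse

/-! ### Filtered probability spaces -/

section Martingale

variable {Ω : Type u} {mΩ : MeasurableSpace Ω}

/-- The filtration is regular with constant `R`: `E_{k+1} g ≤ R E_k g` almost everywhere, for every
non-negative integrable `g` and every `k ≥ 0`. -/
def IsRegularFiltration (μ : Measure Ω) (ℱ : Filtration ℕ mΩ) (R : ℝ) : Prop :=
  ∀ g : Ω → ℝ, (∀ x, 0 ≤ g x) → Integrable g μ →
    ∀ k : ℕ, ∀ᵐ x ∂μ, (μ[g | ℱ (k + 1)]) x ≤ R * (μ[g | ℱ k]) x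

/-- Martingale differences: `df_0 = E_0 f` and `df_k = E_k f - E_{k-1} f` for `k ≥ 1`. -/
def martDiff (μ : Measure Ω) (ℱ : Filtration ℕ mΩ) (f : Ω → ℝ) : ℕ → Ω → ℝ
  | 0 => μ[f | ℱ 0]
  | k + 1 => μ[f | ℱ (k + 1)] - μ[f | ℱ k]

/-- An admissible multiplier sequence of a martingale transform: `σ_k` is `ℱ_{k-1}`-measurable
(with `ℱ_{-1} = ℱ_0`, which is what truncated subtraction gives) and `‖σ_k‖_∞ ≤ 1`. -/
def IsTransformMultiplier (μ : Measure Ω) (ℱ : Filtration ℕ mΩ) (σ : ℕ → Ω → ℝ) : Prop :=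
  ∀ k : ℕ, Measurable[ℱ (k - 1)] (σ k) ∧ ∀ᵐ x ∂μ, |σ k x| ≤ 1

/-- The maximal truncation `T^* f = sup_ℓ |∑_{0 ≤ k ≤ ℓ} σ_k df_k|` of the martingale transform. -/
def maxTransform (μ : Measure Ω) (ℱ : Filtration ℕ mΩ) (σ : ℕ → Ω → ℝ) (f : Ω → ℝ) (x : Ω) :
    ℝ≥0∞ :=
  ⨆ l : ℕ, ‖∑ k ∈ Finset.range (l + 1), σ k x * martDiff μ ℱ f k x‖ₑ

/-- The martingale square function `S f = (∑_m |df_m|²)^{1/2}`. -/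
def squareFunction (μ : Measure Ω) (ℱ : Filtration ℕ mΩ) (f : Ω → ℝ) (x : Ω) : ℝ≥0∞ :=
  (∑' m : ℕ, ‖martDiff μ ℱ f m x‖ₑ ^ 2) ^ (1 / 2 : ℝ)

/-- Doob's maximal function localized at `ν`: `sup_{k ≥ ν(x)} |E_k f(x)|`. -/
def doobMaxFrom (μ : Measure Ω) (ℱ : Filtration ℕ mΩ) (ν : Ω → WithTop ℕ) (f : Ω → ℝ) (x : Ω) :
    ℝ≥0∞ :=
  ⨆ k : ℕ, ⨆ _ : ν x ≤ (k : WithTop ℕ), ‖(μ[f | ℱ k]) x‖ₑ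

/-- The conditional percentile `inf {t ∈ ℚ : E[1_{g > t} | m](x) ≤ r}` of a non-negative function
`g`. Negative `t` never qualify when `r < 1`, so only non-negative rationals are listed. -/
def condPercentile (μ : Measure Ω) (m : MeasurableSpace Ω) (r : ℝ) (g : Ω → ℝ≥0∞) (x : Ω) :
    ℝ≥0∞ :=
  ⨅ t : ℚ≥0, ⨅ _ : (μ[Set.indicator {y | ((t : ℝ≥0) : ℝ≥0∞) < g y} (fun _ => (1 : ℝ)) | m]) x ≤ r,
    ((t : ℝ≥0) : ℝ≥0∞)

/-- The conditional percentile at a stopping time: `∑_k 1_{ν = k} P_k^r g`. -/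
def stoppedPercentile (μ : Measure Ω) (ℱ : Filtration ℕ mΩ) (ν : Ω → WithTop ℕ) (r : ℝ)
    (g : Ω → ℝ≥0∞) (x : Ω) : ℝ≥0∞ :=
  ∑' k : ℕ, Set.indicator {y | ν y = (k : WithTop ℕ)} (condPercentile μ (ℱ k) r g) x

/-- A sparse sequence of stopping times: an increasing sequence `ν_0 ≤ ν_1 ≤ …` such that
`μ(A ∩ {ν_{j+1} < ∞}) ≤ μ(A) / 2` for all `A ⊆ {ν_j < ∞}` in the stopped σ-algebra of `ν_j`. -/
structure IsSparseStoppingSeq (μ : Measure Ω) (ℱ : Filtration ℕ mΩ) (ν : ℕ → Ω → WithTop ℕ) :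
    Prop where
  isStoppingTime : ∀ j, IsStoppingTime ℱ (ν j)
  increasing : ∀ j x, ν j x ≤ ν (j + 1) x
  sparse : ∀ j, ∀ A : Set Ω, MeasurableSet[(isStoppingTime j).measurableSpace] A →
    A ⊆ {x | ν j x < ⊤} → μ (A ∩ {x | ν (j + 1) x < ⊤}) ≤ 2⁻¹ * μ A

end Martingale

/-! ### The dyadic setting in `ℝ^d` -/

/-- The index `(k, m)` of the dyadic cube `∏_i [m_i 2^{-k}, (m_i + 1) 2^{-k})`. -/
structure DyadicCube (d : ℕ) where
  scale : ℤ
  corner : Fin d → ℤ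

namespace DyadicCube

variable {d : ℕ}

/-- The dyadic cube as a subset of `ℝ^d`; it has side length `2^{-scale}`. -/
def toSet (Q : DyadicCube d) : Set (Fin d → ℝ) :=
  Set.univ.pi fun i =>
    Set.Ico ((Q.corner i : ℝ) * (2 : ℝ) ^ (-Q.scale)) (((Q.corner i : ℝ) + 1) * (2 : ℝ) ^ (-Q.scale))

/-- The unique dyadic cube of side length `2^{-k}` that contains `x`. -/
def containing (k : ℤ) (x : Fin d → ℝ) : DyadicCube d :=
  ⟨k, fun i => ⌊(2 : ℝ) ^ k * x i⌋⟩

open Classical in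
/-- The dyadic subcubes of `Q` with side length `2^{-t}` times that of `Q`. -/
def descendants (Q : DyadicCube d) (t : ℕ) : Finset (DyadicCube d) :=
  Finset.univ.image fun a : Fin d → Fin (2 ^ t) =>
    ⟨Q.scale + t, fun i => 2 ^ t * Q.corner i + ((a i : ℕ) : ℤ)⟩

end DyadicCube

section Dyadic

variable {d : ℕ}

/-- `M_𝒟 f(x) = sup_{x ∈ R} |⟨f⟩_R|`, the supremum over all dyadic cubes. -/
def dyadicMax (f : (Fin d → ℝ) → ℝ) (x : Fin d → ℝ) : ℝ≥0∞ :=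
  ⨆ R : DyadicCube d, ⨆ _ : x ∈ R.toSet, ‖⨍ y in R.toSet, f y‖ₑ

/-- `M_Q f(x) = sup_{x ∈ R} |⟨f⟩_R|`, the supremum over the dyadic cubes contained in `Q`. -/
def dyadicMaxLocal (Q : DyadicCube d) (f : (Fin d → ℝ) → ℝ) (x : Fin d → ℝ) : ℝ≥0∞ :=
  ⨆ R : DyadicCube d, ⨆ _ : R.toSet ⊆ Q.toSet, ⨆ _ : x ∈ R.toSet, ‖⨍ y in R.toSet, f y‖ₑ

/-- The percentile `inf {t : |{x ∈ A : g(x) > t}| ≤ r |A|}` of a non-negative function `g`. -/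
def percentile (r : ℝ) (A : Set (Fin d → ℝ)) (g : (Fin d → ℝ) → ℝ≥0∞) : ℝ≥0∞ :=
  sInf {t : ℝ≥0∞ | volume {x ∈ A | t < g x} ≤ ENNReal.ofReal r * volume A}

/-- A family of dyadic cubes is `η`-sparse. -/
def IsSparseFamily (η : ℝ) (S : Set (DyadicCube d)) : Prop :=
  ∃ E : DyadicCube d → Set (Fin d → ℝ),
    (∀ Q ∈ S, MeasurableSet (E Q) ∧ E Q ⊆ Q.toSet ∧
      ENNReal.ofReal η * volume Q.toSet ≤ volume (E Q)) ∧
    S.PairwiseDisjoint E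

/-- The cancellative sparse operator `∑_{Q ∈ S} P_Q^r(M_Q f) 1_Q(x)`. -/
def sparseSum (r : ℝ) (S : Set (DyadicCube d)) (f : (Fin d → ℝ) → ℝ) (x : Fin d → ℝ) : ℝ≥0∞ :=
  ∑' Q : S, Set.indicator (Q : DyadicCube d).toSet
    (fun _ => percentile r (Q : DyadicCube d).toSet (dyadicMaxLocal (Q : DyadicCube d) f)) x

/-- A Haar basis of `L²(ℝ^d)`: to each dyadic cube `Q` are attached `2^d - 1` orthonormal functions
that vanish outside `Q`, are constant on each dyadic child of `Q` and have integral zero, that is,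
an orthonormal basis of the space of such functions. (Orthogonality between different cubes and
completeness are consequences.) -/
structure IsHaarBasis (h : DyadicCube d → Fin (2 ^ d - 1) → (Fin d → ℝ) → ℝ) : Prop where
  support : ∀ Q i x, x ∉ Q.toSet → h Q i x = 0
  const_on_children : ∀ Q i, ∀ R ∈ Q.descendants 1, ∀ x ∈ R.toSet, ∀ y ∈ R.toSet,
    h Q i x = h Q i y
  integral_eq_zero : ∀ Q i, ∫ x, h Q i x = 0
  orthonormal : ∀ Q i j, ∫ x, h Q i x * h Q j x = if i = j then 1 else 0

/-- The coefficients `α^Q_{TS}` of a Haar shift; `T` and `S` stand for the input and the output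
cube, and the two further indices pick one of the Haar functions of `T` and of `S`. -/
abbrev ShiftCoeff (d : ℕ) : Type :=
  DyadicCube d → DyadicCube d → DyadicCube d → Fin (2 ^ d - 1) → Fin (2 ^ d - 1) → ℝ

/-- The part of the Haar shift of complexity `(t, s)` that comes from the cubes `Q` of side length
`2^{-k}`, evaluated at `x` (only the cube `Q ∋ x` contributes). -/
def haarShiftLayer (h : DyadicCube d → Fin (2 ^ d - 1) → (Fin d → ℝ) → ℝ) (t s : ℕ)
    (α : ShiftCoeff d) (f : (Fin d → ℝ) → ℝ) (k : ℤ) (x : Fin d → ℝ) : ℝ :=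
  ∑ T ∈ (DyadicCube.containing k x).descendants t,
    ∑ S ∈ (DyadicCube.containing k x).descendants s, ∑ i, ∑ j,
      α (DyadicCube.containing k x) T S i j * (∫ y, f y * h T i y) * h S j x

/-- The maximal truncation of a Haar shift, over all ranges `l ≤ k ≤ m` of scales with `l < m`. -/
def maxHaarShift (h : DyadicCube d → Fin (2 ^ d - 1) → (Fin d → ℝ) → ℝ) (t s : ℕ)
    (α : ShiftCoeff d) (f : (Fin d → ℝ) → ℝ) (x : Fin d → ℝ) : ℝ≥0∞ :=
  ⨆ l : ℤ, ⨆ m : ℤ, ⨆ _ : l < m, ‖∑ k ∈ Finset.Icc l m, haarShiftLayer h t s α f k x‖ₑ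

end Dyadic

end CancellativeSparse

end

/-!
# Cancellative sparse domination

All parts rest on one stopping step. Start from a stopping time `ν` (or a dyadic cube `Q`), let `λ`
be the percentile of the maximal function that starts there, and let `E` be the set where this
maximal function exceeds `λ`. By the choice of the percentile, `E` occupies only a small fraction of
each conditioning event. Stop when the conditional probability of `E` becomes large. The maximal
inequality for this conditional probability shows that stopping is rare. As long as there is no
stopping, the martingale of `f` is bounded by `λ` even one step later (`t + 1` generations later in
the dyadic case): the event that the next value exceeds `λ` lies in `E` and is known by then, so by
regularity it already makes the conditional probability of `E` large. Thus `f` behaves like a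
bounded martingale up to and including the stopping time, although averages of `|f|` do not enter,
and its energy (the sum of the squared `L²` norms of the martingale differences) telescopes to at
most `λ²` per unit of mass. By orthogonality the same bound holds for the truncated operator, so
that a second stopping rule, `|truncated operator| > C λ`, is rarely used either, by Chebyshev's
inequality. Up to the stopping time the operator is at most a multiple of `λ`; iterating yields the
sparse sum.

For regular filtrations, `IsControlled` lists what the energy argument needs from the process; the
squared increments of a martingale transform (`isControlled_transformIncrement_sq`) and the partial
sums of the square function (`isControlled_squareIncrement`) are the two examples. One step is
`exists_next_stoppingTime`, and `le_two_mul_tsum_of_steps` adds the steps up. The percentiles are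
rounded up to powers of two in order to work on countably many pieces on which they are constant.

In the dyadic setting, `IsLayer` is the corresponding list of properties. A layer of a Haar shift of
complexity `(t, s)` consists of differences of generation `k + s` and is controlled by those of `f`
of generation `k + t`; these delays only affect the constants (`exists_exceptional_set`). A sequence
of stopping times becomes a tree of cubes. There is no largest cube, so the trees are started at all
cubes of side length `4ⁿ`, `n ≥ 0`, with a vertex at the origin. The previous such cube of the same
orthant is made a stopping child of the next one, which makes the trees compatible with each other
(`isSparseFamily_stoppingFamily`, `exists_le_tsum_stoppingFamily`). A sum over an interval of scales
is a difference of two sums that start at a large cube. The dyadic maximal function is the case of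
vanishing layers, where only the bound for the averages is of interest.
-/

namespace CancellativeSparse

/-! ### Dyadic cubes -/

namespace DyadicCube

variable {d : ℕ}

/-- The volume of a dyadic cube of `ℝ^d` of side length `2^{-k}`. -/
noncomputable def vol (d : ℕ) (k : ℤ) : ℝ := ((2 : ℝ) ^ (-k)) ^ d

theorem vol_pos (d : ℕ) (k : ℤ) : 0 < vol d k := by unfold vol; positivity

theorem vol_add (d : ℕ) (k : ℤ) (n : ℕ) : (2 : ℝ) ^ (d * n) * vol d (k + n) = vol d k := by
  unfold vol
  rw [pow_mul', ← mul_pow]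
  congr 1
  rw [← zpow_natCast, ← zpow_add₀ (by norm_num)]
  congr 1
  ring

theorem vol_lt_vol (hd : 0 < d) {k n : ℤ} (h : k < n) : vol d n < vol d k := by
  unfold vol
  apply pow_lt_pow_left₀ _ (by positivity) hd.ne'
  exact zpow_lt_zpow_right₀ (by norm_num) (by omega)

@[simp] theorem containing_scale (k : ℤ) (x : Fin d → ℝ) : (containing k x).scale = k := rfl

theorem mem_toSet_iff {Q : DyadicCube d} {x : Fin d → ℝ} :
    x ∈ Q.toSet ↔ containing Q.scale x = Q := by
  obtain ⟨k, m⟩ := Q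
  have hk : (0 : ℝ) < 2 ^ k := by positivity
  simp only [toSet, containing, mem_univ_pi, mem_Ico, DyadicCube.mk.injEq, true_and, funext_iff,
    Int.floor_eq_iff, zpow_neg, ← div_eq_mul_inv, div_le_iff₀ hk, lt_div_iff₀ hk, mul_comm]

theorem mem_containing (k : ℤ) (x : Fin d → ℝ) : x ∈ (containing k x).toSet :=
  mem_toSet_iff.2 rfl

theorem containing_congr {k n : ℤ} (hkn : k ≤ n) {x y : Fin d → ℝ}
    (h : containing n x = containing n y) : containing k x = containing k y := by
  obtain ⟨a, rfl⟩ := Int.le.dest hkn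
  have key : ∀ z : ℝ, ⌊(2 : ℝ) ^ k * z⌋ = ⌊(2 : ℝ) ^ (k + a) * z⌋ / ((2 ^ a : ℕ) : ℤ) := by
    intro z
    rw [← Int.floor_div_natCast]
    congr 1
    rw [zpow_add₀ (by norm_num)]
    push_cast
    rw [zpow_natCast]
    field_simp
  simp only [containing, DyadicCube.mk.injEq, true_and, funext_iff] at h ⊢
  intro i
  rw [key, key, h i]

theorem measurableSet_toSet (Q : DyadicCube d) : MeasurableSet Q.toSet :=
  MeasurableSet.univ_pi fun _ => measurableSet_Ico

theorem volume_toSet (Q : DyadicCube d) : volume Q.toSet = ENNReal.ofReal (vol d Q.scale) := by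
  rw [toSet, Real.volume_pi_Ico]
  have : ∀ i, ((Q.corner i : ℝ) + 1) * (2 : ℝ) ^ (-Q.scale) - Q.corner i * (2 : ℝ) ^ (-Q.scale)
      = (2 : ℝ) ^ (-Q.scale) := fun i => by ring
  simp only [this, Finset.prod_const, Finset.card_univ, Fintype.card_fin, vol]
  rw [ENNReal.ofReal_pow (by positivity)]

theorem volume_real_toSet (Q : DyadicCube d) : volume.real Q.toSet = vol d Q.scale := by
  rw [Measure.real, volume_toSet, ENNReal.toReal_ofReal (vol_pos _ _).le]

theorem volume_toSet_ne_top (Q : DyadicCube d) : volume Q.toSet ≠ ∞ := by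
  rw [volume_toSet]; exact ENNReal.ofReal_ne_top

theorem volume_toSet_ne_zero (Q : DyadicCube d) : volume Q.toSet ≠ 0 := by
  rw [volume_toSet]; simpa using vol_pos _ _

theorem toSet_nonempty (Q : DyadicCube d) : Q.toSet.Nonempty :=
  nonempty_of_measure_ne_zero Q.volume_toSet_ne_zero

theorem containing_eq {Q : DyadicCube d} {x : Fin d → ℝ} (h : x ∈ Q.toSet) :
    containing Q.scale x = Q := mem_toSet_iff.1 h

theorem subset_of_mem {Q R : DyadicCube d} {x : Fin d → ℝ} (hQ : x ∈ Q.toSet) (hR : x ∈ R.toSet)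
    (h : Q.scale ≤ R.scale) : R.toSet ⊆ Q.toSet := by
  intro y hy
  rw [mem_toSet_iff] at *
  rw [← hQ]
  exact containing_congr h (by rw [hy, hR])

theorem eq_of_mem {Q R : DyadicCube d} {x : Fin d → ℝ} (hQ : x ∈ Q.toSet) (hR : x ∈ R.toSet)
    (h : Q.scale = R.scale) : Q = R := by
  rw [mem_toSet_iff] at hQ hR
  rw [← hQ, ← hR, h]

theorem scale_le_of_subset (hd : 0 < d) {Q R : DyadicCube d} (h : R.toSet ⊆ Q.toSet) :
    Q.scale ≤ R.scale := by
  by_contra! hlt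
  have h1 := vol_lt_vol hd hlt
  have h2 := measureReal_mono h Q.volume_toSet_ne_top
  rw [volume_real_toSet, volume_real_toSet] at h2
  linarith

theorem eq_of_subset_of_scale {Q R : DyadicCube d} (h : R.toSet ⊆ Q.toSet)
    (hs : Q.scale = R.scale) : Q = R := by
  obtain ⟨x, hx⟩ := R.toSet_nonempty
  exact eq_of_mem (h hx) hx hs

theorem toSet_injective (hd : 0 < d) {Q R : DyadicCube d} (h : Q.toSet = R.toSet) : Q = R :=
  eq_of_subset_of_scale h.superset
    (le_antisymm (scale_le_of_subset hd h.superset) (scale_le_of_subset hd h.subset))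

theorem containing_subset {k n : ℤ} (hkn : k ≤ n) (x : Fin d → ℝ) :
    (containing n x).toSet ⊆ (containing k x).toSet :=
  subset_of_mem (mem_containing k x) (mem_containing n x) hkn

theorem containing_subset_of_mem {Q : DyadicCube d} {n : ℤ} (hn : Q.scale ≤ n) {x : Fin d → ℝ}
    (hx : x ∈ Q.toSet) : (containing n x).toSet ⊆ Q.toSet :=
  subset_of_mem hx (mem_containing n x) hn

/-- Two dyadic cubes are disjoint unless the one of smaller side lies in the other. -/
theorem disjoint_or_subset (Q R : DyadicCube d) (h : Q.scale ≤ R.scale) :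
    Disjoint Q.toSet R.toSet ∨ R.toSet ⊆ Q.toSet := by
  by_cases hd : Disjoint Q.toSet R.toSet
  · exact Or.inl hd
  · obtain ⟨x, hx, hx'⟩ := not_disjoint_iff.1 hd
    exact Or.inr (subset_of_mem hx hx' h)

instance : Countable (DyadicCube d) := by
  have : Function.Injective (fun Q : DyadicCube d => (Q.scale, Q.corner)) := by
    rintro ⟨a, b⟩ ⟨a', b'⟩ h
    simpa using h
  exact this.countable

theorem mem_descendants_iff {Q R : DyadicCube d} {t : ℕ} :
    R ∈ Q.descendants t ↔ R.scale = Q.scale + t ∧ R.toSet ⊆ Q.toSet := by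
  classical
  have key : ∀ z : ℝ, ⌊(2 : ℝ) ^ Q.scale * z⌋ = ⌊(2 : ℝ) ^ (Q.scale + t) * z⌋ / (2 ^ t : ℤ) := by
    intro z
    rw [show (2 ^ t : ℤ) = ((2 ^ t : ℕ) : ℤ) by push_cast; rfl, ← Int.floor_div_natCast]
    congr 1
    rw [zpow_add₀ (by norm_num)]
    push_cast
    rw [zpow_natCast]
    field_simp
  constructor
  · intro h
    simp only [descendants, Finset.mem_image, Finset.mem_univ, true_and] at h
    obtain ⟨a, rfl⟩ := h
    refine ⟨rfl, fun x hx => ?_⟩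
    have hx' := containing_eq hx
    rw [mem_toSet_iff]
    simp only [containing, DyadicCube.mk.injEq, true_and, funext_iff] at hx'
    simp only [containing]
    congr 1
    ext i
    rw [key, hx' i]
    have h1 := (a i).2
    rw [add_comm, Int.add_mul_ediv_left _ _ (by positivity),
      Int.ediv_eq_zero_of_lt (by positivity) (by exact_mod_cast h1), zero_add]
  · rintro ⟨h1, h2⟩
    obtain ⟨x, hx⟩ := R.toSet_nonempty
    have hQ := containing_eq (h2 hx)
    have hR := containing_eq hx
    rw [h1] at hR
    have h2t : (0 : ℤ) < 2 ^ t := by positivity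
    simp only [descendants, Finset.mem_image, Finset.mem_univ, true_and]
    refine ⟨fun i => ⟨(⌊(2 : ℝ) ^ (Q.scale + t) * x i⌋ % 2 ^ t).toNat, ?_⟩, ?_⟩
    · have := Int.emod_lt_of_pos ⌊(2 : ℝ) ^ (Q.scale + t) * x i⌋ h2t
      have := Int.emod_nonneg ⌊(2 : ℝ) ^ (Q.scale + t) * x i⌋ h2t.ne'
      zify
      rw [Int.toNat_of_nonneg this]
      assumption
    · rw [← hR]
      simp only [containing]
      congr 1
      ext i
      have : Q.corner i = ⌊(2 : ℝ) ^ Q.scale * x i⌋ := by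
        conv_lhs => rw [← hQ]
        rfl
      rw [this, key, Int.toNat_of_nonneg (Int.emod_nonneg _ h2t.ne')]
      exact Int.mul_ediv_add_emod _ _

theorem containing_mem_descendants {Q : DyadicCube d} {x : Fin d → ℝ} (hx : x ∈ Q.toSet) (t : ℕ) :
    containing (Q.scale + t) x ∈ Q.descendants t :=
  mem_descendants_iff.2 ⟨rfl, containing_subset_of_mem (by simp) hx⟩

theorem biUnion_descendants (Q : DyadicCube d) (t : ℕ) :
    ⋃ R ∈ Q.descendants t, R.toSet = Q.toSet := by
  apply Subset.antisymm
  · exact iUnion₂_subset fun R hR => (mem_descendants_iff.1 hR).2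
  · intro x hx
    exact mem_biUnion (containing_mem_descendants hx t) (mem_containing _ _)

theorem pairwiseDisjoint_descendants (Q : DyadicCube d) (t : ℕ) :
    (↑(Q.descendants t) : Set (DyadicCube d)).Pairwise (Function.onFun Disjoint toSet) := by
  intro R hR S hS hne
  rw [Finset.mem_coe, mem_descendants_iff] at hR hS
  by_contra hd
  obtain ⟨x, hx, hx'⟩ := not_disjoint_iff.1 hd
  exact hne (eq_of_mem hx hx' (hR.1.trans hS.1.symm))

theorem card_descendants_le (Q : DyadicCube d) (t : ℕ) : (Q.descendants t).card ≤ (2 ^ t) ^ d := by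
  classical
  refine Finset.card_image_le.trans ?_
  simp

theorem setIntegral_eq_sum_descendants (Q : DyadicCube d) (t : ℕ) {g : (Fin d → ℝ) → ℝ}
    (hg : IntegrableOn g Q.toSet) :
    ∫ x in Q.toSet, g x = ∑ R ∈ Q.descendants t, ∫ x in R.toSet, g x := by
  rw [← biUnion_descendants Q t, integral_biUnion_finset _ (fun R _ => R.measurableSet_toSet)
    (pairwiseDisjoint_descendants Q t)]
  intro R hR
  exact hg.mono_set (mem_descendants_iff.1 hR).2

end DyadicCube

end CancellativeSparse

namespace CancellativeSparse

/-! ### Functions that are constant on the dyadic cubes of a generation -/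

open DyadicCube

variable {d : ℕ}

/-- The function `g` is constant on each dyadic cube of side length `2^{-n}`. -/
def ConstOnScale (n : ℤ) (g : (Fin d → ℝ) → ℝ) : Prop :=
  ∀ x y, containing n x = containing n y → g x = g y

namespace ConstOnScale

variable {n m : ℤ} {g g' : (Fin d → ℝ) → ℝ}

theorem mono (hg : ConstOnScale n g) (h : n ≤ m) : ConstOnScale m g :=
  fun x y hxy => hg x y (containing_congr h hxy)

theorem eq_of_mem (hg : ConstOnScale n g) {Q : DyadicCube d} (hQ : n ≤ Q.scale) {x y : Fin d → ℝ}
    (hx : x ∈ Q.toSet) (hy : y ∈ Q.toSet) : g x = g y :=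
  hg x y (containing_congr hQ (by rw [containing_eq hx, containing_eq hy]))

theorem const (c : ℝ) : ConstOnScale n (fun _ : Fin d → ℝ => c) := fun _ _ _ => rfl

theorem sub (hg : ConstOnScale n g) (hg' : ConstOnScale n g') :
    ConstOnScale n (fun x => g x - g' x) := fun x y h => by simp only [hg x y h, hg' x y h]

theorem mul (hg : ConstOnScale n g) (hg' : ConstOnScale n g') :
    ConstOnScale n (fun x => g x * g' x) := fun x y h => by simp only [hg x y h, hg' x y h]

theorem pow (hg : ConstOnScale n g) (k : ℕ) :
    ConstOnScale n (fun x => g x ^ k) := fun x y h => by simp only [hg x y h]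

theorem integrableOn (hg : ConstOnScale n g) (Q : DyadicCube d) : IntegrableOn g Q.toSet := by
  rw [← biUnion_descendants Q (n - Q.scale).toNat, integrableOn_finset_iUnion]
  intro R hR
  obtain ⟨x, hx⟩ := R.toSet_nonempty
  have hn : n ≤ R.scale := by
    rw [(mem_descendants_iff.1 hR).1]
    have := Int.self_le_toNat (n - Q.scale)
    omega
  refine (integrableOn_const R.volume_toSet_ne_top (C := g x)).congr_fun (fun y hy => ?_)
    R.measurableSet_toSet
  exact hg.eq_of_mem hn hx hy

/-- A function with integral zero on the cubes of a generation is orthogonal to the functions that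
are constant on these cubes. -/
theorem setIntegral_mul_eq_zero (hg : ConstOnScale n g) (hg' : ConstOnScale m g')
    {Q : DyadicCube d} (hQ : Q.scale ≤ n)
    (h0 : ∀ P : DyadicCube d, P.scale = n → ∫ x in P.toSet, g' x = 0) :
    ∫ x in Q.toSet, g x * g' x = 0 := by
  have hint := ((hg.mono (le_max_left n m)).mul (hg'.mono (le_max_right n m))).integrableOn Q
  obtain ⟨a, ha⟩ := Int.le.dest hQ
  rw [setIntegral_eq_sum_descendants Q a hint]
  refine Finset.sum_eq_zero fun R hR => ?_
  have hR1 := (mem_descendants_iff.1 hR).1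
  obtain ⟨x, hx⟩ := R.toSet_nonempty
  rw [setIntegral_congr_fun R.measurableSet_toSet
    (g := fun y => g x * g' y) (fun y hy => by
      simp only [hg.eq_of_mem (by omega) hy hx]), integral_const_mul, h0 R (by omega), mul_zero]

end ConstOnScale

theorem setIntegral_of_const {Q : DyadicCube d} {g : (Fin d → ℝ) → ℝ} {c : ℝ}
    (h : ∀ x ∈ Q.toSet, g x = c) : ∫ x in Q.toSet, g x = vol d Q.scale * c := by
  rw [setIntegral_congr_fun Q.measurableSet_toSet (g := fun _ => c) h]
  simp [volume_real_toSet]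

/-! ### Averages over dyadic cubes -/

/-- The average of `f` over the dyadic cube of side length `2^{-n}` that contains `x`. -/
noncomputable def dyadicAvg (f : (Fin d → ℝ) → ℝ) (n : ℤ) (x : Fin d → ℝ) : ℝ :=
  ⨍ y in (containing n x).toSet, f y

theorem constOnScale_dyadicAvg (f : (Fin d → ℝ) → ℝ) (n : ℤ) : ConstOnScale n (dyadicAvg f n) :=
  fun x y h => by simp only [dyadicAvg, h]

theorem integrableOn_toSet {f : (Fin d → ℝ) → ℝ} (hf : LocallyIntegrable f) (Q : DyadicCube d) :
    IntegrableOn f Q.toSet := by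
  have hK : IsCompact (Set.univ.pi fun i => Set.Icc ((Q.corner i : ℝ) * (2 : ℝ) ^ (-Q.scale))
      (((Q.corner i : ℝ) + 1) * (2 : ℝ) ^ (-Q.scale))) :=
    isCompact_univ_pi fun i => isCompact_Icc
  exact (hf.integrableOn_isCompact hK).mono_set (Set.pi_mono fun i _ => Ico_subset_Icc_self)

theorem setIntegral_dyadicAvg {f : (Fin d → ℝ) → ℝ} (hf : LocallyIntegrable f)
    {Q : DyadicCube d} {n : ℤ} (hn : Q.scale ≤ n) :
    ∫ x in Q.toSet, dyadicAvg f n x = ∫ x in Q.toSet, f x := by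
  obtain ⟨a, rfl⟩ := Int.le.dest hn
  rw [setIntegral_eq_sum_descendants Q a (integrableOn_toSet hf Q),
    setIntegral_eq_sum_descendants Q a ((constOnScale_dyadicAvg f _).integrableOn Q)]
  refine Finset.sum_congr rfl fun R hR => ?_
  have hR1 := (mem_descendants_iff.1 hR).1
  rw [setIntegral_of_const (c := ⨍ y in R.toSet, f y)]
  · rw [setAverage_eq, volume_real_toSet, smul_eq_mul, ← mul_assoc,
      mul_inv_cancel₀ (vol_pos _ _).ne', one_mul]
  · intro x hx
    rw [dyadicAvg, ← hR1, containing_eq hx]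

theorem setIntegral_dyadicAvg_sub {f : (Fin d → ℝ) → ℝ} (hf : LocallyIntegrable f)
    {Q : DyadicCube d} {n m : ℤ} (hn : Q.scale ≤ n) (hm : Q.scale ≤ m) :
    ∫ x in Q.toSet, (dyadicAvg f m x - dyadicAvg f n x) = 0 := by
  rw [integral_sub ((constOnScale_dyadicAvg f _).integrableOn Q)
    ((constOnScale_dyadicAvg f _).integrableOn Q), setIntegral_dyadicAvg hf hn,
    setIntegral_dyadicAvg hf hm, sub_self]

/-- Orthogonality of the martingale differences, with a weight that is known at the earlier
generation. -/
theorem setIntegral_mul_sq_sub {f : (Fin d → ℝ) → ℝ} (hf : LocallyIntegrable f)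
    {Q : DyadicCube d} {n : ℤ} (hn : Q.scale ≤ n) {Y : (Fin d → ℝ) → ℝ} (hY : ConstOnScale n Y) :
    ∫ x in Q.toSet, Y x * (dyadicAvg f (n + 1) x - dyadicAvg f n x) ^ 2
      = ∫ x in Q.toSet, Y x * (dyadicAvg f (n + 1) x ^ 2 - dyadicAvg f n x ^ 2) := by
  have he := constOnScale_dyadicAvg f n
  have he' := constOnScale_dyadicAvg f (n + 1)
  have hle : n ≤ n + 1 := by omega
  have hD := he'.sub (he.mono hle)
  have h0 : ∫ x in Q.toSet, (Y x * dyadicAvg f n x) *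
      (dyadicAvg f (n + 1) x - dyadicAvg f n x) = 0 :=
    (hY.mul he).setIntegral_mul_eq_zero hD hn
      fun P hP => setIntegral_dyadicAvg_sub hf hP.le (by omega)
  have h1 := (((hY.mul he).mono hle).mul hD).integrableOn Q
  have h2 := ((hY.mono hle).mul ((he'.pow 2).sub ((he.pow 2).mono hle))).integrableOn Q
  have : ∀ x, Y x * (dyadicAvg f (n + 1) x - dyadicAvg f n x) ^ 2
      = Y x * (dyadicAvg f (n + 1) x ^ 2 - dyadicAvg f n x ^ 2)
        - 2 * ((Y x * dyadicAvg f n x) * (dyadicAvg f (n + 1) x - dyadicAvg f n x)) :=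
    fun x => by ring
  simp only [this]
  rw [integral_sub h2 (h1.const_mul 2), integral_const_mul, h0, mul_zero, sub_zero]

/-! ### Maximal cubes -/

/-- The members of a family of cubes that lie in no other member. -/
def maximalCubes (F : Set (DyadicCube d)) : Set (DyadicCube d) :=
  {R | R ∈ F ∧ ∀ W ∈ F, R.toSet ⊆ W.toSet → W = R}

theorem exists_maximalCubes (hd : 0 < d) {F : Set (DyadicCube d)} {Q : DyadicCube d}
    (hF : ∀ R ∈ F, R.toSet ⊆ Q.toSet) {R : DyadicCube d} (hR : R ∈ F) :
    ∃ W ∈ maximalCubes F, R.toSet ⊆ W.toSet := by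
  obtain ⟨k, ⟨W, hW, hRW, rfl⟩, hmin⟩ := Int.exists_least_of_bdd
    (P := fun k => ∃ W ∈ F, R.toSet ⊆ W.toSet ∧ W.scale = k)
    ⟨Q.scale, by
      rintro _ ⟨W, hW, -, rfl⟩
      exact scale_le_of_subset hd (hF W hW)⟩ ⟨R.scale, R, hR, Subset.rfl, rfl⟩
  refine ⟨W, ⟨hW, fun W' hW' hsub => ?_⟩, hRW⟩
  exact eq_of_subset_of_scale hsub
    (le_antisymm (scale_le_of_subset hd hsub) (hmin _ ⟨W', hW', hRW.trans hsub, rfl⟩))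

theorem pairwiseDisjoint_maximalCubes (F : Set (DyadicCube d)) :
    (maximalCubes F).PairwiseDisjoint toSet := by
  intro R hR W hW hne
  rcases le_total R.scale W.scale with h | h
  · exact (disjoint_or_subset R W h).resolve_right fun hs => hne (hW.2 R hR.1 hs)
  · exact ((disjoint_or_subset W R h).resolve_right fun hs => hne (hR.2 W hW.1 hs).symm).symm

theorem biUnion_maximalCubes (hd : 0 < d) {F : Set (DyadicCube d)} {Q : DyadicCube d}
    (hF : ∀ R ∈ F, R.toSet ⊆ Q.toSet) :
    ⋃ R ∈ maximalCubes F, R.toSet = ⋃ R ∈ F, R.toSet := by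
  apply Subset.antisymm
  · exact biUnion_subset_biUnion_left fun R hR => hR.1
  · refine iUnion₂_subset fun R hR => ?_
    obtain ⟨W, hW, hRW⟩ := exists_maximalCubes hd hF hR
    exact hRW.trans (subset_biUnion_of_mem (u := toSet) hW)

/-- The weak type inequality for the dyadic maximal function of the set `E`. -/
theorem volume_biUnion_dense_le (hd : 0 < d) (Q : DyadicCube d) (E : Set (Fin d → ℝ)) (M : ℝ≥0∞) :
    volume (⋃ R ∈ {R : DyadicCube d | R.toSet ⊆ Q.toSet ∧
      volume R.toSet ≤ M * volume (R.toSet ∩ E)}, R.toSet) ≤ M * volume E := by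
  set F := {R : DyadicCube d | R.toSet ⊆ Q.toSet ∧ volume R.toSet ≤ M * volume (R.toSet ∩ E)}
  rw [← biUnion_maximalCubes hd (Q := Q) (F := F) (fun R hR => hR.1)]
  have hc : (maximalCubes F).Countable := to_countable _
  calc volume (⋃ R ∈ maximalCubes F, R.toSet)
      ≤ ∑' R : maximalCubes F, volume (R : DyadicCube d).toSet := measure_biUnion_le _ hc _
    _ ≤ ∑' R : maximalCubes F, M * volume ((R : DyadicCube d).toSet ∩ E) :=
        ENNReal.tsum_le_tsum fun R => R.2.1.2
    _ = M * ∑' R : maximalCubes F, volume.restrict E (R : DyadicCube d).toSet := by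
        rw [ENNReal.tsum_mul_left]
        congr 1
        exact tsum_congr fun R => (Measure.restrict_apply R.1.measurableSet_toSet).symm
    _ = M * volume.restrict E (⋃ R ∈ maximalCubes F, R.toSet) := by
        rw [measure_biUnion hc (pairwiseDisjoint_maximalCubes F)
          (fun R _ => R.measurableSet_toSet)]
    _ ≤ M * volume E := by
        refine mul_le_mul_right ?_ M
        exact (measure_mono (subset_univ _)).trans (Measure.restrict_apply_univ E).le

end CancellativeSparse

namespace CancellativeSparse

/-! ### Layers and their stopped sums -/

open DyadicCube

variable {d : ℕ}

/-- The properties of the layers of a Haar shift of complexity `(t, s)` on which the sparse bound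
rests: the layer `L k` consists of martingale differences of generation `k + s`, and on a cube of
generation `k` its size is controlled by the martingale differences of `f` of generation `k + t`. -/
structure IsLayer (f : (Fin d → ℝ) → ℝ) (t s : ℕ) (K : ℝ) (L : ℤ → (Fin d → ℝ) → ℝ) : Prop where
  const : ∀ k, ConstOnScale (k + s + 1) (L k)
  integral_eq_zero : ∀ k (P : DyadicCube d), P.scale = k + s → ∫ x in P.toSet, L k x = 0
  sq_le : ∀ k x, vol d k * L k x ^ 2 ≤ K ^ 2 *
    ∫ y in (containing k x).toSet, (dyadicAvg f (k + t + 1) y - dyadicAvg f (k + t) y) ^ 2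

section StoppedSums

open Classical in
/-- The sum of the layers of generations `q, …, q + n - 1`, frozen at the first time when it
exceeds `θ` or leaves the set `V`. -/
noncomputable def stoppedSum (L : ℤ → (Fin d → ℝ) → ℝ) (q : ℤ) (V : ℕ → Set (Fin d → ℝ)) (θ : ℝ) :
    ℕ → (Fin d → ℝ) → ℝ
  | 0, _ => 0
  | n + 1, x => stoppedSum L q V θ n x +
      (if x ∈ V n ∧ |stoppedSum L q V θ n x| ≤ θ then 1 else 0) * L (q + n) x

variable {f : (Fin d → ℝ) → ℝ} {t s : ℕ} {K : ℝ} {L : ℤ → (Fin d → ℝ) → ℝ}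
  {q : ℤ} {V : ℕ → Set (Fin d → ℝ)} {θ : ℝ}

theorem constOnScale_stoppedSum (hL : IsLayer f t s K L)
    (hV : ∀ (n : ℕ) x y, containing (q + n) x = containing (q + n) y → (x ∈ V n ↔ y ∈ V n)) (n : ℕ) :
    ConstOnScale (q + n + s) (stoppedSum L q V θ n) := by
  induction n with
  | zero => intro x y _; rfl
  | succ n ih =>
    intro x y h
    have h1 := ih x y (containing_congr (by push_cast; omega) h)
    have h2 := hV n x y (containing_congr (by push_cast; omega) h)
    have h3 := hL.const (q + n) x y (containing_congr (by push_cast; omega) h)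
    have h4 : (x ∈ V n ∧ |stoppedSum L q V θ n y| ≤ θ) ↔
        (y ∈ V n ∧ |stoppedSum L q V θ n y| ≤ θ) := by rw [h2]
    rw [stoppedSum, stoppedSum, h1, h3]
    by_cases hy : y ∈ V n ∧ |stoppedSum L q V θ n y| ≤ θ
    · rw [if_pos (h4.2 hy), if_pos hy]
    · rw [if_neg (mt h4.1 hy), if_neg hy]

theorem abs_stoppedSum_mono {n m : ℕ} (hnm : n ≤ m) {x : Fin d → ℝ}
    (h : θ < |stoppedSum L q V θ n x|) : θ < |stoppedSum L q V θ m x| := by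
  induction m, hnm using Nat.le_induction with
  | base => exact h
  | succ m _ ih =>
    rw [stoppedSum, if_neg (fun hh => absurd hh.2 (not_le.2 ih)), zero_mul, add_zero]
    exact ih

theorem stoppedSum_eq {n : ℕ} {x : Fin d → ℝ} (hV : ∀ m < n, x ∈ V m)
    (hθ : ∀ m < n, |stoppedSum L q V θ m x| ≤ θ) :
    stoppedSum L q V θ n x = ∑ m ∈ Finset.range n, L (q + m) x := by
  induction n with
  | zero => rfl
  | succ n ih =>
    rw [stoppedSum, if_pos ⟨hV n n.lt_succ_self, hθ n n.lt_succ_self⟩, one_mul,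
      Finset.sum_range_succ, ih (fun m hm => hV m (by omega)) (fun m hm => hθ m (by omega))]

open Classical in
/-- The layer added in one step is orthogonal to the stopped sum, and it is added only inside `V n`.
The cutoff `|X| ≤ θ` does not spoil orthogonality, because it is known before the layer is. -/
theorem setIntegral_stoppedSum_sq_succ (hL : IsLayer f t s K L)
    (hV : ∀ (n : ℕ) x y, containing (q + n) x = containing (q + n) y → (x ∈ V n ↔ y ∈ V n))
    {Q : DyadicCube d} (hQ : Q.scale = q) (n : ℕ) :
    ∫ x in Q.toSet, stoppedSum L q V θ (n + 1) x ^ 2 ≤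
      (∫ x in Q.toSet, stoppedSum L q V θ n x ^ 2) +
        ∫ x in Q.toSet, (if x ∈ V n then 1 else 0) * L (q + n) x ^ 2 := by
  have hX := constOnScale_stoppedSum (θ := θ) hL hV n
  have hLc := hL.const (q + n)
  have hle : q + n + s ≤ q + n + s + 1 := by omega
  have hv : ConstOnScale (q + n) (fun x => if x ∈ V n then (1 : ℝ) else 0) :=
    fun x y h => by simp only [hV n x y h]
  have hu : ConstOnScale (q + n + s)
      (fun x => if x ∈ V n ∧ |stoppedSum L q V θ n x| ≤ θ then (1 : ℝ) else 0) :=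
    fun x y h => by simp only [hX x y h, hV n x y (containing_congr (by omega) h)]
  have h0 : ∫ x in Q.toSet, (stoppedSum L q V θ n x *
      (if x ∈ V n ∧ |stoppedSum L q V θ n x| ≤ θ then (1 : ℝ) else 0)) * L (q + n) x = 0 :=
    (hX.mul hu).setIntegral_mul_eq_zero hLc (by omega) (hL.integral_eq_zero _)
  have i1 := (hX.pow 2).integrableOn Q
  have i2 := (((hX.mul hu).mono hle).mul hLc).integrableOn Q
  have i3 := (((hv.mono (by omega : q + n ≤ q + n + s + 1))).mul (hLc.pow 2)).integrableOn Q
  have i4 := ((constOnScale_stoppedSum (θ := θ) hL hV (n + 1)).pow 2).integrableOn Q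
  have i12 : IntegrableOn (fun x => stoppedSum L q V θ n x ^ 2 + 2 * ((stoppedSum L q V θ n x *
      (if x ∈ V n ∧ |stoppedSum L q V θ n x| ≤ θ then (1 : ℝ) else 0)) * L (q + n) x)) Q.toSet :=
    i1.add (i2.const_mul 2)
  calc ∫ x in Q.toSet, stoppedSum L q V θ (n + 1) x ^ 2
      ≤ ∫ x in Q.toSet, ((stoppedSum L q V θ n x ^ 2 + 2 * ((stoppedSum L q V θ n x *
          (if x ∈ V n ∧ |stoppedSum L q V θ n x| ≤ θ then (1 : ℝ) else 0)) * L (q + n) x)) +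
          (if x ∈ V n then 1 else 0) * L (q + n) x ^ 2) := by
        refine integral_mono i4 (i12.add i3) fun x => ?_
        simp only [stoppedSum]
        by_cases h1 : x ∈ V n <;> by_cases h2 : |stoppedSum L q V θ n x| ≤ θ <;>
          simp only [h1, h2, and_self, and_true, and_false, if_true, if_false] <;>
          nlinarith [sq_nonneg (L (q + n) x)]
    _ = _ := by
        rw [integral_add i12 i3, integral_add i1 (i2.const_mul 2),
          integral_const_mul, h0, mul_zero, add_zero]

open Classical in
/-- The energy of a layer inside `V n` is at most the energy that the averages of `f` gain there. -/
theorem setIntegral_layer_sq_le (hL : IsLayer f t s K L) (hf : LocallyIntegrable f)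
    (hV : ∀ (n : ℕ) x y, containing (q + n) x = containing (q + n) y → (x ∈ V n ↔ y ∈ V n))
    {Q : DyadicCube d} (hQ : Q.scale = q) (n : ℕ) :
    ∫ x in Q.toSet, (if x ∈ V n then 1 else 0) * L (q + n) x ^ 2 ≤
      K ^ 2 * ∫ x in Q.toSet, (if x ∈ V n then 1 else 0) *
        (dyadicAvg f (q + n + t + 1) x ^ 2 - dyadicAvg f (q + n + t) x ^ 2) := by
  have hLc := hL.const (q + n)
  have hv : ConstOnScale (q + n) (fun x => if x ∈ V n then (1 : ℝ) else 0) :=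
    fun x y h => by simp only [hV n x y h]
  have hD : ConstOnScale (q + n + t + 1)
      (fun x => (dyadicAvg f (q + n + t + 1) x - dyadicAvg f (q + n + t) x) ^ 2) :=
    ((constOnScale_dyadicAvg f _).sub ((constOnScale_dyadicAvg f _).mono (by omega))).pow 2
  rw [← setIntegral_mul_sq_sub hf (by omega) (hv.mono (by omega)),
    setIntegral_eq_sum_descendants Q n
      ((hv.mono (by omega : q + n ≤ q + n + s + 1)).mul (hLc.pow 2) |>.integrableOn Q),
    setIntegral_eq_sum_descendants Q n
      ((hv.mono (by omega : q + n ≤ q + n + t + 1)).mul hD |>.integrableOn Q), Finset.mul_sum]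
  refine Finset.sum_le_sum fun R hR => ?_
  have hR1 : R.scale = q + n := by rw [(mem_descendants_iff.1 hR).1, hQ]
  obtain ⟨z, hz⟩ := R.toSet_nonempty
  have hvz : ∀ x ∈ R.toSet, (x ∈ V n ↔ z ∈ V n) := fun x hx =>
    hV n x z (by rw [← hR1, containing_eq hx, containing_eq hz])
  by_cases hzV : z ∈ V n
  · have e1 : ∀ g : (Fin d → ℝ) → ℝ, ∫ x in R.toSet, (if x ∈ V n then (1 : ℝ) else 0) * g x =
        ∫ x in R.toSet, g x := fun g =>
      setIntegral_congr_fun R.measurableSet_toSet fun x hx => by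
        simp only [if_pos ((hvz x hx).2 hzV), one_mul]
    rw [e1 (fun x => L (q + n) x ^ 2), e1 (fun x => (dyadicAvg f (q + n + t + 1) x -
      dyadicAvg f (q + n + t) x) ^ 2)]
    have hpos := vol_pos d (q + n)
    have hb : ∀ x ∈ R.toSet, L (q + n) x ^ 2 ≤ (vol d (q + n))⁻¹ * (K ^ 2 * ∫ x in R.toSet,
        (dyadicAvg f (q + n + t + 1) x - dyadicAvg f (q + n + t) x) ^ 2) := by
      intro x hx
      have := hL.sq_le (q + n) x
      rw [← hR1, containing_eq hx, hR1] at this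
      rw [inv_mul_eq_div, le_div_iff₀ hpos, mul_comm]
      exact this
    calc ∫ x in R.toSet, L (q + n) x ^ 2
        ≤ ∫ x in R.toSet, (vol d (q + n))⁻¹ * (K ^ 2 * ∫ x in R.toSet,
          (dyadicAvg f (q + n + t + 1) x - dyadicAvg f (q + n + t) x) ^ 2) :=
          setIntegral_mono_on ((hLc.pow 2).integrableOn R)
            (integrableOn_const R.volume_toSet_ne_top) R.measurableSet_toSet hb
      _ = _ := by
          rw [setIntegral_of_const (fun _ _ => rfl), hR1, ← mul_assoc,
            mul_inv_cancel₀ hpos.ne', one_mul]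
  · have e0 : ∀ g : (Fin d → ℝ) → ℝ, ∫ x in R.toSet, (if x ∈ V n then (1 : ℝ) else 0) * g x = 0 :=
      fun g => by
        rw [setIntegral_of_const (c := 0) fun x hx => by
          simp only [if_neg (fun h => hzV ((hvz x hx).1 h)), zero_mul], mul_zero]
    rw [e0 (fun x => L (q + n) x ^ 2), e0 (fun x => (dyadicAvg f (q + n + t + 1) x -
      dyadicAvg f (q + n + t) x) ^ 2), mul_zero]

open Classical in
/-- A telescoping sum that is switched off for good at some time. -/
theorem sum_ite_sub_le {p : ℕ → Prop} (hp : ∀ n, p (n + 1) → p n) {a : ℕ → ℝ} (ha : 0 ≤ a 0)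
    {c : ℝ} (hc : 0 ≤ c) (h : ∀ n, p n → a (n + 1) ≤ c) (N : ℕ) :
    ∑ n ∈ Finset.range N, (if p n then 1 else 0) * (a (n + 1) - a n) ≤ c := by
  suffices H : (∑ n ∈ Finset.range N, (if p n then 1 else 0) * (a (n + 1) - a n) ≤ c) ∧
      (p N → ∑ n ∈ Finset.range N, (if p n then 1 else 0) * (a (n + 1) - a n) = a N - a 0) from H.1
  induction N with
  | zero => simpa using hc
  | succ N ih =>
    rw [Finset.sum_range_succ]
    by_cases hN : p N
    · rw [if_pos hN, one_mul, ih.2 hN]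
      exact ⟨by linarith [h N hN], fun _ => by ring⟩
    · rw [if_neg hN, zero_mul, add_zero]
      exact ⟨ih.1, fun h' => absurd (hp N h') hN⟩

/-- The energy of the stopped sum is controlled by the size of the averages of `f` before the
stopping time: both are sums of orthogonal differences, and the one of `f` telescopes. -/
theorem setIntegral_stoppedSum_sq_le (hL : IsLayer f t s K L) (hf : LocallyIntegrable f)
    (hV : ∀ (n : ℕ) x y, containing (q + n) x = containing (q + n) y → (x ∈ V n ↔ y ∈ V n))
    (hVanti : ∀ n, V (n + 1) ⊆ V n) {Q : DyadicCube d} (hQ : Q.scale = q) {b : ℝ}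
    (hb : ∀ n, ∀ x ∈ Q.toSet, x ∈ V n → |dyadicAvg f (q + n + t + 1) x| ≤ b) (N : ℕ) :
    ∫ x in Q.toSet, stoppedSum L q V θ N x ^ 2 ≤ K ^ 2 * b ^ 2 * vol d q := by
  classical
  have hv : ∀ n : ℕ, ConstOnScale (q + n) (fun x => if x ∈ V n then (1 : ℝ) else 0) :=
    fun n x y h => by simp only [hV n x y h]
  have hi : ∀ n : ℕ, IntegrableOn (fun x => (if x ∈ V n then (1 : ℝ) else 0) *
      (dyadicAvg f (q + n + t + 1) x ^ 2 - dyadicAvg f (q + n + t) x ^ 2)) Q.toSet := fun n =>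
    (((hv n).mono (by omega : q + n ≤ q + n + t + 1)).mul
      (((constOnScale_dyadicAvg f _).pow 2).sub
        (((constOnScale_dyadicAvg f _).pow 2).mono (by omega)))).integrableOn Q
  have h1 : ∀ N : ℕ, ∫ x in Q.toSet, stoppedSum L q V θ N x ^ 2 ≤ ∑ n ∈ Finset.range N,
      K ^ 2 * ∫ x in Q.toSet, (if x ∈ V n then 1 else 0) *
        (dyadicAvg f (q + n + t + 1) x ^ 2 - dyadicAvg f (q + n + t) x ^ 2) := by
    intro N
    induction N with
    | zero => simp [stoppedSum]
    | succ N ih =>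
      rw [Finset.sum_range_succ]
      exact (setIntegral_stoppedSum_sq_succ hL hV hQ N).trans
        (add_le_add ih (setIntegral_layer_sq_le hL hf hV hQ N))
  have hcast : ∀ n : ℕ, q + ((n + 1 : ℕ) : ℤ) + t = q + n + t + 1 := fun n => by push_cast; ring
  refine (h1 N).trans ?_
  rw [← Finset.mul_sum, mul_assoc, ← integral_finsetSum _ fun n _ => hi n]
  refine mul_le_mul_of_nonneg_left ?_ (sq_nonneg K)
  calc ∫ x in Q.toSet, ∑ n ∈ Finset.range N, (if x ∈ V n then (1 : ℝ) else 0) *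
        (dyadicAvg f (q + n + t + 1) x ^ 2 - dyadicAvg f (q + n + t) x ^ 2)
      ≤ ∫ x in Q.toSet, b ^ 2 := by
        refine setIntegral_mono_on (integrable_finsetSum _ fun n _ => hi n)
          (integrableOn_const Q.volume_toSet_ne_top) Q.measurableSet_toSet fun x hx => ?_
        have := sum_ite_sub_le (p := fun n => x ∈ V n) (fun n h => hVanti n h)
          (a := fun n => dyadicAvg f (q + n + t) x ^ 2) (sq_nonneg _) (sq_nonneg b)
          (fun n hn => ?_) N
        · simp only [hcast] at this
          exact this
        · have := hb n x hx hn
          simp only [hcast]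
          exact sq_le_sq' (by linarith [neg_abs_le (dyadicAvg f (q + n + t + 1) x)])
            ((le_abs_self _).trans this)
    _ = b ^ 2 * vol d q := by
        rw [setIntegral_of_const (fun _ _ => rfl), hQ, mul_comm]

end StoppedSums

end CancellativeSparse

namespace CancellativeSparse

/-! ### The exceptional set of a cube -/

open DyadicCube

variable {d : ℕ}

/-- The infimum in the definition of the percentile is attained. -/
theorem volume_gt_percentile_le {r : ℝ} {A : Set (Fin d → ℝ)} {g : (Fin d → ℝ) → ℝ≥0∞}
    (h : percentile r A g ≠ ∞) :
    volume {x ∈ A | percentile r A g < g x} ≤ ENNReal.ofReal r * volume A := by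
  set T := {t : ℝ≥0∞ | volume {x ∈ A | t < g x} ≤ ENNReal.ofReal r * volume A} with hT
  have hne : T.Nonempty := by
    by_contra hT0
    rw [not_nonempty_iff_eq_empty] at hT0
    exact h (by rw [percentile, ← hT, hT0, sInf_empty])
  obtain ⟨u, hanti, hlim, hu⟩ := exists_seq_tendsto_sInf hne (OrderBot.bddBelow T)
  have hU : {x ∈ A | percentile r A g < g x} = ⋃ n, {x ∈ A | u n < g x} := by
    ext x
    simp only [mem_ofPred_eq, mem_iUnion]
    constructor
    · rintro ⟨hx, hlt⟩
      obtain ⟨n, hn⟩ := (hlim.eventually_lt_const hlt).exists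
      exact ⟨n, hx, hn⟩
    · rintro ⟨n, hx, hn⟩
      exact ⟨hx, (sInf_le (hu n)).trans_lt hn⟩
  have hm : Monotone fun n => {x ∈ A | u n < g x} :=
    fun n m hnm x hx => ⟨hx.1, (hanti hnm).trans_lt hx.2⟩
  rw [hU, hm.measure_iUnion]
  exact iSup_le hu

/-- Chebyshev's inequality on a cube. It includes the case of level `a = 0`, where the integral
vanishes. -/
theorem mul_volume_lt_le_of_setIntegral_le {Q : DyadicCube d} {g : (Fin d → ℝ) → ℝ}
    (hg : IntegrableOn g Q.toSet) (h0 : ∀ x, 0 ≤ g x) {a M : ℝ} (ha : 0 ≤ a) (hM : 0 < M)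
    (h : M * ∫ x in Q.toSet, g x ≤ a * vol d Q.scale) :
    ENNReal.ofReal M * volume {x ∈ Q.toSet | a < g x} ≤ volume Q.toSet := by
  rcases ha.eq_or_lt with rfl | ha
  · have hI : ∫ x in Q.toSet, g x = 0 := by
      have := setIntegral_nonneg (μ := volume) Q.measurableSet_toSet (fun x _ => h0 x)
      rw [zero_mul] at h
      nlinarith
    rw [setIntegral_eq_zero_iff_of_nonneg_ae (ae_of_all _ h0) hg] at hI
    have : volume {x ∈ Q.toSet | 0 < g x} = 0 := by
      rw [EventuallyEq, ae_restrict_iff' Q.measurableSet_toSet] at hI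
      refine measure_mono_null (fun x hx => ?_) hI
      exact fun hh => hx.2.ne' (hh hx.1)
    rw [this, mul_zero]
    exact zero_le
  · have h1 := mul_meas_ge_le_integral_of_nonneg (ae_of_all _ h0) hg a
    have h2 : volume {x ∈ Q.toSet | a < g x} ≤ volume.restrict Q.toSet {x | a ≤ g x} := by
      rw [Measure.restrict_apply' Q.measurableSet_toSet]
      exact measure_mono fun x hx => ⟨hx.2.le, hx.1⟩
    have hfin : volume.restrict Q.toSet {x | a ≤ g x} ≠ ∞ := by
      rw [Measure.restrict_apply' Q.measurableSet_toSet]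
      exact ne_top_of_le_ne_top Q.volume_toSet_ne_top (measure_mono inter_subset_right)
    refine (mul_le_mul_right h2 _).trans ?_
    rw [volume_toSet, ← ofReal_measureReal hfin, ← ENNReal.ofReal_mul hM.le]
    apply ENNReal.ofReal_le_ofReal
    have : a * (M * (volume.restrict Q.toSet).real {x | a ≤ g x}) ≤ a * vol d Q.scale := by
      nlinarith
    exact le_of_mul_le_mul_left this ha

variable {f : (Fin d → ℝ) → ℝ} {t s : ℕ} {K : ℝ} {L : ℤ → (Fin d → ℝ) → ℝ}

/-- Bounded averages of `f` in the generations `k + t` and `k + t + 1` bound the layer `k`. -/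
theorem IsLayer.abs_le (hL : IsLayer f t s K L) (hK : 0 ≤ K) {k : ℤ} {x : Fin d → ℝ} {b : ℝ}
    (hb0 : 0 ≤ b) (hb : ∀ y ∈ (containing k x).toSet,
      |dyadicAvg f (k + t + 1) y| ≤ b ∧ |dyadicAvg f (k + t) y| ≤ b) :
    |L k x| ≤ 2 * K * b := by
  have hpos := vol_pos d k
  have h1 := hL.sq_le k x
  have h2 : ∫ y in (containing k x).toSet,
      (dyadicAvg f (k + t + 1) y - dyadicAvg f (k + t) y) ^ 2 ≤ vol d k * (2 * b) ^ 2 := by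
    rw [← containing_scale k x, ← setIntegral_of_const (Q := containing k x)
      (g := fun _ => (2 * b) ^ 2) (fun _ _ => rfl)]
    refine setIntegral_mono_on ?_ (integrableOn_const (volume_toSet_ne_top _))
      (measurableSet_toSet _) fun y hy => ?_
    · exact (((constOnScale_dyadicAvg f _).sub
        ((constOnScale_dyadicAvg f _).mono (by simp))).pow 2).integrableOn _
    · obtain ⟨h3, h4⟩ := hb y hy
      rw [containing_scale, sq_le_sq, abs_of_nonneg (by linarith : (0 : ℝ) ≤ 2 * b)]
      calc _ ≤ |dyadicAvg f (k + t + 1) y| + |dyadicAvg f (k + t) y| := abs_sub _ _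
        _ ≤ 2 * b := by linarith
  have h3 : vol d k * L k x ^ 2 ≤ vol d k * (2 * K * b) ^ 2 := by
    refine h1.trans ((mul_le_mul_of_nonneg_left h2 (sq_nonneg K)).trans (le_of_eq (by ring)))
  exact abs_le_of_sq_le_sq (le_of_mul_le_mul_left h3 hpos) (by positivity)

/-- The percentile used in the dyadic setting. -/
noncomputable def dyadicLevel (d t : ℕ) : ℝ := ((2 : ℝ) ^ (d * (t + 1) + (2 * d + 2)))⁻¹

theorem dyadicLevel_mem_Ioo (d t : ℕ) : dyadicLevel d t ∈ Ioo (0 : ℝ) 1 :=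
  ⟨by unfold dyadicLevel; positivity, inv_lt_one_of_one_lt₀ (one_lt_pow₀ one_lt_two (by omega))⟩

/-- The constant in the pointwise bound of one step of the dyadic stopping procedure. -/
noncomputable def stepConst (d s : ℕ) (K : ℝ) : ℝ := (2 ^ (d + 1) + 2 * (s + 1)) * K

/-- One step of the stopping procedure. Outside of a set `E` that fills only a small part of the
cube `Q`, all averages and all truncated sums of layers that start at `Q` are controlled by the
percentile of `Q`. -/
theorem exists_exceptional_set (hd : 0 < d) (hL : IsLayer f t s K L) (hK : 0 < K)
    (hf : LocallyIntegrable f) (Q : DyadicCube d) :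
    ∃ E : Set (Fin d → ℝ), 2 ^ (2 * d + 1) * volume E ≤ volume Q.toSet ∧
      ∀ x ∈ Q.toSet, ∀ m, Q.scale ≤ m → ¬ (containing m x).toSet ⊆ E →
        ‖dyadicAvg f m x‖ₑ ≤ percentile (dyadicLevel d t) Q.toSet (dyadicMaxLocal Q f) ∧
        ‖∑ k ∈ Finset.Icc Q.scale m, L k x‖ₑ ≤ ENNReal.ofReal (stepConst d s K) *
          percentile (dyadicLevel d t) Q.toSet (dyadicMaxLocal Q f) := by
  have hC : 0 < stepConst d s K := by unfold stepConst; positivity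
  rcases eq_or_ne (percentile (dyadicLevel d t) Q.toSet (dyadicMaxLocal Q f)) ∞ with htop | htop
  · refine ⟨∅, by simp, fun x _ m _ _ => ?_⟩
    rw [htop, ENNReal.mul_top (by simpa using hC)]
    exact ⟨le_top, le_top⟩
  have hE1 := volume_gt_percentile_le htop
  set lam := percentile (dyadicLevel d t) Q.toSet (dyadicMaxLocal Q f) with hlam
  set b := lam.toReal with hbdef
  have hb0 : 0 ≤ b := ENNReal.toReal_nonneg
  have hlb : lam = ENNReal.ofReal b := (ENNReal.ofReal_toReal htop).symm
  set q := Q.scale with hq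
  set E1 := {x ∈ Q.toSet | lam < dyadicMaxLocal Q f x} with hE1def
  set F := {R : DyadicCube d | R.toSet ⊆ Q.toSet ∧
      volume R.toSet ≤ 2 ^ (d * (t + 1)) * volume (R.toSet ∩ E1)} with hF
  set E1' := ⋃ R ∈ F, R.toSet with hE1'
  have hvE1' : 2 ^ (2 * d + 2) * volume E1' ≤ volume Q.toSet := by
    calc 2 ^ (2 * d + 2) * volume E1'
        ≤ 2 ^ (2 * d + 2) * (2 ^ (d * (t + 1)) *
          (ENNReal.ofReal (dyadicLevel d t) * volume Q.toSet)) := by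
          gcongr
          exact (volume_biUnion_dense_le hd Q E1 _).trans (mul_le_mul_right hE1 _)
      _ = volume Q.toSet := by
          have : ENNReal.ofReal (dyadicLevel d t) = (2 ^ (d * (t + 1) + (2 * d + 2)))⁻¹ := by
            rw [dyadicLevel, ENNReal.ofReal_inv_of_pos (by positivity),
              ENNReal.ofReal_pow (by norm_num)]
            norm_num
          rw [this, ← mul_assoc, ← mul_assoc, ← pow_add, add_comm (2 * d + 2),
            ENNReal.mul_inv_cancel (by simp) (by finiteness), one_mul]
  set V : ℕ → Set (Fin d → ℝ) := fun n => {x | ¬ (containing (q + n) x).toSet ⊆ E1'} with hVdef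
  have hV : ∀ (n : ℕ) x y, containing (q + n) x = containing (q + n) y → (x ∈ V n ↔ y ∈ V n) := by
    intro n x y h
    simp only [hVdef, mem_ofPred_eq, h]
  have hVanti : ∀ n, V (n + 1) ⊆ V n := fun n x hx hsub =>
    hx ((containing_subset (by push_cast; omega) x).trans hsub)
  -- A cube with a large average lies in `E1`, and then its ancestors of the last `t + 1`
  -- generations meet `E1` in a large proportion.
  have hbd : ∀ (n : ℕ) (x : Fin d → ℝ) (k : ℤ), x ∈ Q.toSet → x ∈ V n → q + n ≤ k →
      k ≤ q + n + t + 1 → |dyadicAvg f k x| ≤ b := by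
    intro n x k hxQ hxV hk1 hk2
    by_contra! hlt
    apply hxV
    have hWR : (containing k x).toSet ⊆ (containing (q + n) x).toSet := containing_subset hk1 x
    have hWQ : (containing k x).toSet ⊆ Q.toSet := containing_subset_of_mem (by omega) hxQ
    have hWE : (containing k x).toSet ⊆ E1 := by
      intro y hy
      refine ⟨hWQ hy, lt_of_lt_of_le ?_ (le_iSup_of_le (containing k x)
        (le_iSup_of_le hWQ (le_iSup_of_le hy le_rfl)))⟩
      rw [hlb, ← ofReal_norm]
      exact (ENNReal.ofReal_lt_ofReal_iff (hb0.trans_lt hlt)).2 hlt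
    refine subset_biUnion_of_mem (u := toSet) (show containing (q + n) x ∈ F from
      ⟨containing_subset_of_mem (by omega) hxQ, ?_⟩)
    calc volume (containing (q + n) x).toSet
        ≤ 2 ^ (d * (t + 1)) * volume (containing k x).toSet := by
          obtain ⟨a, ha⟩ := Int.le.dest hk1
          rw [volume_toSet, volume_toSet, containing_scale, containing_scale, ← vol_add d (q + n) a,
            ha, ENNReal.ofReal_mul (by positivity), ENNReal.ofReal_pow (by norm_num)]
          norm_num
          gcongr
          · norm_num
          · omega
      _ ≤ _ := by
          gcongr
          exact subset_inter hWR hWE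
  set θ := 2 ^ (d + 1) * K * b with hθ
  have hθ0 : 0 ≤ θ := by positivity
  set E2 := ⋃ N : ℕ, {x ∈ Q.toSet | θ < |stoppedSum L q V θ N x|} with hE2
  have hvE2 : 2 ^ (2 * d + 2) * volume E2 ≤ volume Q.toSet := by
    have hmono : Monotone fun N : ℕ => {x ∈ Q.toSet | θ < |stoppedSum L q V θ N x|} :=
      fun n m hnm x hx => ⟨hx.1, abs_stoppedSum_mono hnm hx.2⟩
    rw [hE2, hmono.measure_iUnion, ENNReal.mul_iSup]
    refine iSup_le fun N => ?_
    have h1 := setIntegral_stoppedSum_sq_le (θ := θ) hL hf hV hVanti hq.symm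
      (fun n x hx hxV => hbd n x _ hx hxV (by omega) le_rfl) N
    have h2 := mul_volume_lt_le_of_setIntegral_le (Q := Q) (a := θ ^ 2) (M := 2 ^ (2 * d + 2))
      (((constOnScale_stoppedSum hL hV N).pow 2).integrableOn Q) (fun x => sq_nonneg _)
      (sq_nonneg _) (by positivity) ((mul_le_mul_of_nonneg_left h1 (by positivity)).trans
        (le_of_eq (by rw [hθ, ← hq]; ring)))
    rw [ENNReal.ofReal_pow (by norm_num)] at h2
    have h3 : {x ∈ Q.toSet | θ ^ 2 < stoppedSum L q V θ N x ^ 2} =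
        {x ∈ Q.toSet | θ < |stoppedSum L q V θ N x|} := by
      ext x
      rw [mem_ofPred_eq, mem_ofPred_eq, sq_lt_sq, abs_of_nonneg hθ0]
    rwa [h3, ENNReal.ofReal_ofNat] at h2
  refine ⟨E1' ∪ E2, ?_, fun x hx m hm hnot => ?_⟩
  · have h3 : 2 * (2 ^ (2 * d + 1) * volume (E1' ∪ E2)) ≤ 2 * volume Q.toSet := by
      calc 2 * (2 ^ (2 * d + 1) * volume (E1' ∪ E2))
          = 2 ^ (2 * d + 2) * volume (E1' ∪ E2) := by ring
        _ ≤ 2 ^ (2 * d + 2) * (volume E1' + volume E2) := by gcongr; exact measure_union_le _ _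
        _ ≤ volume Q.toSet + volume Q.toSet := by rw [mul_add]; exact add_le_add hvE1' hvE2
        _ = 2 * volume Q.toSet := by ring
    exact (ENNReal.mul_le_mul_iff_right (by norm_num) (by norm_num)).1 h3
  · obtain ⟨n, rfl⟩ := Int.le.dest hm
    have hxV : ∀ i ≤ n, x ∈ V i := fun i hi hsub =>
      hnot (((containing_subset (by omega) x).trans hsub).trans subset_union_left)
    obtain ⟨y, hyx, hyE⟩ := not_subset.1 hnot
    have hyx' : containing (q + n) y = containing (q + n) x := containing_eq hyx
    have hyQ : y ∈ Q.toSet := containing_subset_of_mem (by omega) hx hyx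
    have hyV : ∀ i ≤ n, y ∈ V i := fun i hi =>
      (hV i y x (containing_congr (by omega) hyx')).2 (hxV i hi)
    have hyθ : ∀ i, |stoppedSum L q V θ i y| ≤ θ := fun i => by
      by_contra! h
      exact hyE (Or.inr (mem_iUnion.2 ⟨i, hyQ, h⟩))
    have hsmall : ∀ i ≤ n, |L (q + i) x| ≤ 2 * K * b := fun i hi =>
      hL.abs_le hK.le hb0 fun z hz => by
        have hzx := containing_eq hz
        rw [containing_scale] at hzx
        have hzV : z ∈ V i := (hV i z x hzx).2 (hxV i hi)
        have hzQ : z ∈ Q.toSet := containing_subset_of_mem (by omega) hx hz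
        exact ⟨hbd i z _ hzQ hzV (by omega) le_rfl, hbd i z _ hzQ hzV (by omega) (by omega)⟩
    have hfirst : |dyadicAvg f (q + n) x| ≤ b :=
      hbd n x _ hx (hxV n le_rfl) le_rfl (by omega)
    have hsecond : |∑ k ∈ Finset.Icc q (q + n), L k x| ≤ stepConst d s K * b := by
      have hIcc : ∑ k ∈ Finset.Icc q (q + n), L k x = ∑ i ∈ Finset.range (n + 1), L (q + i) x := by
        refine (Finset.sum_bij (fun (i : ℕ) _ => q + i) ?_ ?_ ?_ ?_).symm
        · intro i hi
          simp only [Finset.mem_range, Finset.mem_Icc] at hi ⊢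
          omega
        · intro i _ j _ h
          simpa using h
        · intro k hk
          rw [Finset.mem_Icc] at hk
          exact ⟨(k - q).toNat, by rw [Finset.mem_range]; omega, by omega⟩
        · intro i _
          rfl
      -- The last `s + 1` layers are not constant on the cube of generation `q + n`.
      have hsplit := Finset.sum_range_add_sum_Ico (fun i : ℕ => L (q + i) x)
        (show n - s ≤ n + 1 by omega)
      have hA : |∑ i ∈ Finset.range (n - s), L (q + i) x| ≤ θ := by
        rw [Finset.sum_congr rfl fun (i : ℕ) hi => hL.const (q + i) x y
          (containing_congr (by rw [Finset.mem_range] at hi; omega) hyx'.symm),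
          ← stoppedSum_eq (V := V) (θ := θ) (fun i hi => hyV i (by omega)) (fun i _ => hyθ i)]
        exact hyθ _
      have hB : |∑ i ∈ Finset.Ico (n - s) (n + 1), L (q + i) x| ≤ (s + 1) * (2 * K * b) := by
        refine (Finset.abs_sum_le_sum_abs _ _).trans ?_
        refine (Finset.sum_le_card_nsmul _ _ (2 * K * b) fun i hi =>
          hsmall i (by rw [Finset.mem_Ico] at hi; omega)).trans ?_
        rw [nsmul_eq_mul, Nat.card_Ico]
        refine mul_le_mul_of_nonneg_right ?_ (by positivity)
        exact_mod_cast (by omega : n + 1 - (n - s) ≤ s + 1)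
      rw [hIcc, ← hsplit]
      refine (abs_add_le _ _).trans ((add_le_add hA hB).trans (le_of_eq ?_))
      rw [hθ, stepConst]
      ring
    rw [hlb, ← ENNReal.ofReal_mul hC.le, ← ofReal_norm, ← ofReal_norm]
    exact ⟨ENNReal.ofReal_le_ofReal hfirst, ENNReal.ofReal_le_ofReal hsecond⟩

end CancellativeSparse

namespace CancellativeSparse

/-! ### The sparse family generated by exceptional sets -/

open DyadicCube

variable {d : ℕ}

/-- A cube is a base cube if one of its vertices is the origin and its side length is `4^n` with
`n ≥ 0`. In each of the `2^d` orthants these cubes form a chain that exhausts the orthant. -/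
def IsBaseCube (Q : DyadicCube d) : Prop :=
  (∃ n : ℕ, Q.scale = -(2 * n : ℤ)) ∧ ∀ i, Q.corner i = 0 ∨ Q.corner i = -1

/-- The cube with the corner index of `Q` and a quarter of its side length. For a base cube this is
the previous member of the chain. -/
def smallerBaseCube (Q : DyadicCube d) : DyadicCube d := ⟨Q.scale + 2, Q.corner⟩

theorem subset_of_corner_eq {Q R : DyadicCube d} (hQ : ∀ i, Q.corner i = 0 ∨ Q.corner i = -1)
    (hc : R.corner = Q.corner) (hs : Q.scale ≤ R.scale) : R.toSet ⊆ Q.toSet := by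
  have h2 : (2 : ℝ) ^ (-R.scale) ≤ 2 ^ (-Q.scale) :=
    zpow_le_zpow_right₀ (by norm_num) (by omega)
  intro x hx
  simp only [toSet, mem_univ_pi, mem_Ico, hc] at hx ⊢
  intro i
  have := hx i
  rcases hQ i with h | h <;> rw [h] at this ⊢ <;> push_cast at this ⊢ <;>
    constructor <;> linarith

theorem corner_eq_zero_iff {Q : DyadicCube d} (hQ : ∀ i, Q.corner i = 0 ∨ Q.corner i = -1)
    {x : Fin d → ℝ} (hx : x ∈ Q.toSet) (i : Fin d) : Q.corner i = 0 ↔ 0 ≤ x i := by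
  simp only [toSet, mem_univ_pi, mem_Ico] at hx
  have := hx i
  rcases hQ i with h | h <;> rw [h] at this ⊢ <;> push_cast at this
  · simpa using this.1
  · simpa using this.2

theorem IsBaseCube.corner_eq {Q R : DyadicCube d} (hQ : IsBaseCube Q) (hR : IsBaseCube R)
    {x : Fin d → ℝ} (hxQ : x ∈ Q.toSet) (hxR : x ∈ R.toSet) : R.corner = Q.corner := by
  funext i
  have h1 := corner_eq_zero_iff hQ.2 hxQ i
  have h2 := corner_eq_zero_iff hR.2 hxR i
  rcases hQ.2 i with h | h <;> rcases hR.2 i with h' | h' <;> simp_all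
  exact absurd h1 (not_lt.2 h2)

/-- A base cube strictly inside another one lies in the previous member of its chain. -/
theorem IsBaseCube.subset_smallerBaseCube (hd : 0 < d) {Q R : DyadicCube d} (hQ : IsBaseCube Q)
    (hR : IsBaseCube R) (h : R.toSet ⊆ Q.toSet) (hne : R ≠ Q) :
    Q.scale + 2 ≤ R.scale ∧ R.toSet ⊆ (smallerBaseCube Q).toSet := by
  obtain ⟨x, hx⟩ := R.toSet_nonempty
  have hc := hQ.corner_eq hR (h hx) hx
  have hs := scale_le_of_subset hd h
  have hs' : Q.scale ≠ R.scale := fun he => hne (eq_of_subset_of_scale h he).symm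
  obtain ⟨n, hn⟩ := hQ.1
  obtain ⟨m, hm⟩ := hR.1
  have h2 : Q.scale + 2 ≤ R.scale := by omega
  exact ⟨h2, subset_of_corner_eq hQ.2 hc h2⟩

theorem volume_smallerBaseCube (Q : DyadicCube d) :
    2 ^ (2 * d) * volume (smallerBaseCube Q).toSet = volume Q.toSet := by
  rw [volume_toSet, volume_toSet, ← vol_add d Q.scale 2, ENNReal.ofReal_mul (by positivity),
    ENNReal.ofReal_pow (by norm_num), mul_comm 2 d]
  simp [smallerBaseCube]

/-- Every point lies in arbitrarily large base cubes. -/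
theorem exists_isBaseCube_mem (x : Fin d → ℝ) (m : ℤ) :
    ∃ T : DyadicCube d, IsBaseCube T ∧ x ∈ T.toSet ∧ T.scale ≤ m := by
  classical
  set n : ℕ := max (⌈∑ i, |x i|⌉₊) m.natAbs with hn
  refine ⟨⟨-(2 * n : ℤ), fun i => if 0 ≤ x i then 0 else -1⟩, ⟨⟨n, rfl⟩, fun i => ?_⟩, ?_, ?_⟩
  · dsimp only
    split_ifs <;> simp
  · simp only [toSet, mem_univ_pi, mem_Ico, neg_neg]
    intro i
    have h1 : |x i| ≤ n := (Finset.single_le_sum (f := fun i => |x i|) (fun i _ => abs_nonneg _)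
      (Finset.mem_univ i)).trans ((Nat.le_ceil _).trans (by exact_mod_cast le_max_left _ _))
    have h2 : (n : ℝ) < 2 ^ (2 * n : ℤ) := by
      have : n < 2 ^ (2 * n) := Nat.lt_two_pow_self.trans_le (Nat.pow_le_pow_right (by norm_num)
        (by omega))
      exact_mod_cast this
    have h3 := abs_le.1 h1
    split_ifs with h <;> push_cast <;> constructor <;> linarith
  · have : m.natAbs ≤ n := le_max_right _ _
    dsimp only
    omega

/-- The stopping children of `Q`: the maximal cubes strictly inside `Q` that lie in the exceptional
set of `Q`, together with the previous base cube in case `Q` is a base cube. -/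
def stoppingChildren (E : DyadicCube d → Set (Fin d → ℝ)) (Q : DyadicCube d) :
    Set (DyadicCube d) :=
  maximalCubes {R | R.toSet ⊆ Q.toSet ∧ R ≠ Q ∧
    (R.toSet ⊆ E Q ∨ IsBaseCube R ∧ IsBaseCube Q)}

/-- `R` arises from `Q` by repeatedly passing to stopping children. -/
def IsStoppingDescendant (E : DyadicCube d → Set (Fin d → ℝ)) :
    DyadicCube d → DyadicCube d → Prop :=
  Relation.ReflTransGen fun Q R => R ∈ stoppingChildren E Q

/-- The stopping descendants of the base cubes. -/
def stoppingFamily (E : DyadicCube d → Set (Fin d → ℝ)) : Set (DyadicCube d) :=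
  {Q | ∃ T, IsBaseCube T ∧ IsStoppingDescendant E T Q}

variable {E : DyadicCube d → Set (Fin d → ℝ)}

theorem scale_lt_of_mem_stoppingChildren (hd : 0 < d) {Q R : DyadicCube d}
    (h : R ∈ stoppingChildren E Q) : Q.scale < R.scale :=
  lt_of_le_of_ne (scale_le_of_subset hd h.1.1) fun he =>
    h.1.2.1 (eq_of_subset_of_scale h.1.1 he).symm

theorem IsStoppingDescendant.subset {Q R : DyadicCube d} (h : IsStoppingDescendant E Q R) :
    R.toSet ⊆ Q.toSet := by
  induction h with
  | refl => exact Subset.rfl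
  | tail _ h ih => exact (h.1.1).trans ih

/-- The descendants of a cube form a tree. -/
theorem IsStoppingDescendant.disjoint_or {T Q R : DyadicCube d} (hQ : IsStoppingDescendant E T Q)
    (hR : IsStoppingDescendant E T R) :
    Disjoint Q.toSet R.toSet ∨ IsStoppingDescendant E Q R ∨ IsStoppingDescendant E R Q := by
  induction hQ using Relation.ReflTransGen.head_induction_on with
  | refl => exact Or.inr (Or.inl hR)
  | @head T Q₁ h hQ ih =>
    rcases Relation.ReflTransGen.cases_head hR with rfl | ⟨R₁, hR₁, hR'⟩
    · exact Or.inr (Or.inr (Relation.ReflTransGen.head h hQ))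
    · by_cases he : Q₁ = R₁
      · subst he
        exact ih hR'
      · exact Or.inl ((pairwiseDisjoint_maximalCubes _ h hR₁ he).mono
          (IsStoppingDescendant.subset hQ) (IsStoppingDescendant.subset hR'))

/-- The stopping children of `Q` cover at most half of `Q`: the exceptional set has at most `1 / 8`
of the volume, and the smaller base cube has `4⁻ᵈ ≤ 1 / 4` of it. -/
theorem two_mul_volume_stoppingChildren_le (hd : 0 < d)
    (hE : ∀ Q : DyadicCube d, 2 ^ (2 * d + 1) * volume (E Q) ≤ volume Q.toSet)
    (Q : DyadicCube d) :
    2 * volume (⋃ R ∈ stoppingChildren E Q, R.toSet) ≤ volume Q.toSet := by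
  have hsub : ⋃ R ∈ stoppingChildren E Q, R.toSet ⊆ E Q ∪ (smallerBaseCube Q).toSet := by
    refine iUnion₂_subset fun R hR => ?_
    rcases hR.1.2.2 with h | h
    · exact h.trans subset_union_left
    · exact (h.2.subset_smallerBaseCube hd h.1 hR.1.1 hR.1.2.1).2.trans subset_union_right
  have h8 : 8 * volume (E Q) ≤ volume Q.toSet := by
    refine le_trans ?_ (hE Q)
    gcongr
    calc (8 : ℝ≥0∞) = 2 ^ 3 := by norm_num
      _ ≤ _ := pow_le_pow_right₀ (by norm_num) (by omega)
  have h4 : 4 * volume (smallerBaseCube Q).toSet ≤ volume Q.toSet := by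
    refine le_trans ?_ (volume_smallerBaseCube Q).le
    gcongr
    calc (4 : ℝ≥0∞) = 2 ^ 2 := by norm_num
      _ ≤ _ := pow_le_pow_right₀ (by norm_num) (by omega)
  have h : 2 * (2 * volume (⋃ R ∈ stoppingChildren E Q, R.toSet)) ≤ 2 * volume Q.toSet := by
    calc 2 * (2 * volume (⋃ R ∈ stoppingChildren E Q, R.toSet))
        ≤ 2 * (2 * (volume (E Q) + volume (smallerBaseCube Q).toSet)) := by
          gcongr
          exact (measure_mono hsub).trans (measure_union_le _ _)
      _ = 4 * volume (E Q) + 4 * volume (smallerBaseCube Q).toSet := by ring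
      _ ≤ 8 * volume (E Q) + 4 * volume (smallerBaseCube Q).toSet := by
          gcongr
          norm_num
      _ ≤ volume Q.toSet + volume Q.toSet := add_le_add h8 h4
      _ = 2 * volume Q.toSet := by ring
  exact (ENNReal.mul_le_mul_iff_right (by norm_num) (by norm_num)).1 h

/-- The exceptional set of `Q` is too small to contain a cube with at least a quarter of the side
length of `Q`, in particular the previous base cube. -/
theorem not_subset_exceptional
    (hE : ∀ Q : DyadicCube d, 2 ^ (2 * d + 1) * volume (E Q) ≤ volume Q.toSet)
    {Q W : DyadicCube d}
    (h : volume Q.toSet ≤ 2 ^ (2 * d) * volume W.toSet) : ¬ W.toSet ⊆ E Q := by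
  intro hW
  have h1 : 2 * (2 ^ (2 * d) * volume W.toSet) ≤ 2 ^ (2 * d) * volume W.toSet := by
    calc 2 * (2 ^ (2 * d) * volume W.toSet) = 2 ^ (2 * d + 1) * volume W.toSet := by ring
      _ ≤ 2 ^ (2 * d + 1) * volume (E Q) := by gcongr
      _ ≤ _ := (hE Q).trans h
  have h0 : 2 ^ (2 * d) * volume W.toSet ≠ 0 := mul_ne_zero (by positivity) W.volume_toSet_ne_zero
  have ht : 2 ^ (2 * d) * volume W.toSet ≠ ∞ :=
    ENNReal.mul_ne_top (by finiteness) W.volume_toSet_ne_top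
  rw [two_mul] at h1
  exact absurd h1 (not_le.2 (ENNReal.lt_add_right ht h0))

/-- A base cube is a stopping descendant of the base cubes that contain it. -/
theorem IsBaseCube.isStoppingDescendant (hd : 0 < d)
    (hE : ∀ Q : DyadicCube d, 2 ^ (2 * d + 1) * volume (E Q) ≤ volume Q.toSet)
    {Q R : DyadicCube d} (hQ : IsBaseCube Q)
    (hR : IsBaseCube R) (h : R.toSet ⊆ Q.toSet) : IsStoppingDescendant E Q R := by
  obtain ⟨n, hn⟩ := hQ.1
  induction n generalizing Q with
  | zero =>
    have : R = Q := by
      by_contra hne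
      have := (hQ.subset_smallerBaseCube hd hR h hne).1
      obtain ⟨m, hm⟩ := hR.1
      omega
    rw [this]
    exact Relation.ReflTransGen.refl
  | succ n ih =>
    by_cases hne : R = Q
    · rw [hne]
      exact Relation.ReflTransGen.refl
    have hF : IsBaseCube (smallerBaseCube Q) :=
      ⟨⟨n, by simp only [smallerBaseCube]; push_cast at hn; omega⟩, hQ.2⟩
    have hFne : smallerBaseCube Q ≠ Q := fun he => by
      have := congrArg DyadicCube.scale he
      simp [smallerBaseCube] at this
    have hFs : (smallerBaseCube Q).toSet ⊆ Q.toSet :=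
      subset_of_corner_eq hQ.2 rfl (by simp [smallerBaseCube])
    refine Relation.ReflTransGen.head (b := smallerBaseCube Q) ⟨⟨hFs, hFne, Or.inr ⟨hF, hQ⟩⟩, ?_⟩
      (ih hF (hQ.subset_smallerBaseCube hd hR h hne).2
        (by simp only [smallerBaseCube]; push_cast at hn; omega))
    rintro W ⟨hWQ, hWne, hW⟩ hFW
    rcases hW with hW | hW
    · refine absurd hW (not_subset_exceptional hE ?_)
      rw [← volume_smallerBaseCube Q]
      gcongr
    · exact toSet_injective hd
        (Subset.antisymm (hQ.subset_smallerBaseCube hd hW.1 hWQ hWne).2 hFW)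

/-- The sets `Q ∖ ⋃ (stopping children of Q)` witness sparseness: two members of the family are
disjoint, or one of them descends from the other, since base cubes that meet belong to one chain. -/
theorem isSparseFamily_stoppingFamily (hd : 0 < d)
    (hE : ∀ Q : DyadicCube d, 2 ^ (2 * d + 1) * volume (E Q) ≤ volume Q.toSet) :
    IsSparseFamily (1 / 2) (stoppingFamily E) := by
  have key : ∀ Q R : DyadicCube d, Q ≠ R → IsStoppingDescendant E Q R →
      R.toSet ⊆ ⋃ W ∈ stoppingChildren E Q, W.toSet := by
    intro Q R hne h
    rcases Relation.ReflTransGen.cases_head h with rfl | ⟨W, hW, hWR⟩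
    · exact absurd rfl hne
    · exact (IsStoppingDescendant.subset hWR).trans (subset_biUnion_of_mem (u := toSet) hW)
  refine ⟨fun Q => Q.toSet \ ⋃ R ∈ stoppingChildren E Q, R.toSet, fun Q hQ => ⟨?_, sdiff_subset, ?_⟩,
    ?_⟩
  · exact Q.measurableSet_toSet.diff (MeasurableSet.biUnion (to_countable _)
      fun R _ => R.measurableSet_toSet)
  · have h1 := two_mul_volume_stoppingChildren_le hd hE Q
    have h2 : volume Q.toSet ≤ volume (Q.toSet \ ⋃ R ∈ stoppingChildren E Q, R.toSet) +
        volume (⋃ R ∈ stoppingChildren E Q, R.toSet) := by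
      refine (measure_mono ?_).trans (measure_union_le _ _)
      rw [sdiff_union_self]
      exact subset_union_left
    have hhalf : ENNReal.ofReal (1 / 2) = 2⁻¹ := by
      rw [one_div, ENNReal.ofReal_inv_of_pos (by norm_num)]
      norm_num
    have h3 : volume (⋃ R ∈ stoppingChildren E Q, R.toSet) ≤ 2⁻¹ * volume Q.toSet := by
      rw [← ENNReal.div_eq_inv_mul, ENNReal.le_div_iff_mul_le (by simp) (by simp), mul_comm]
      exact h1
    have h4 : 2⁻¹ * volume Q.toSet + 2⁻¹ * volume Q.toSet ≤
        volume (Q.toSet \ ⋃ R ∈ stoppingChildren E Q, R.toSet) + 2⁻¹ * volume Q.toSet := by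
      rw [← add_mul, ENNReal.inv_two_add_inv_two, one_mul]
      exact h2.trans (by gcongr)
    rw [hhalf]
    exact (ENNReal.add_le_add_iff_right
      (ENNReal.mul_ne_top (by simp) Q.volume_toSet_ne_top)).1 h4
  · rintro Q ⟨T, hT, hTQ⟩ R ⟨T', hT', hTR⟩ hne
    have H : Disjoint Q.toSet R.toSet ∨ IsStoppingDescendant E Q R ∨
        IsStoppingDescendant E R Q := by
      by_cases hdis : Disjoint T.toSet T'.toSet
      · exact Or.inl (hdis.mono hTQ.subset hTR.subset)
      obtain ⟨x, hx, hx'⟩ := not_disjoint_iff.1 hdis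
      rcases le_total T.scale T'.scale with hs | hs
      · exact hTQ.disjoint_or
          ((hT.isStoppingDescendant hd hE hT' (subset_of_mem hx hx' hs)).trans hTR)
      · exact IsStoppingDescendant.disjoint_or
          ((hT'.isStoppingDescendant hd hE hT (subset_of_mem hx' hx hs)).trans hTQ) hTR
    rcases H with h | h | h
    · exact h.mono sdiff_subset sdiff_subset
    · exact disjoint_sdiff_left.mono_right (sdiff_subset.trans (key Q R hne h))
    · exact (disjoint_sdiff_left.mono_right (sdiff_subset.trans (key R Q hne.symm h))).symm

/-- The descendants of a stopping child `R` of `T` are descendants of `T` other than `T`. -/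
theorem add_tsum_descendants_le (hd : 0 < d) {T R : DyadicCube d} (hR : R ∈ stoppingChildren E T)
    (w : DyadicCube d → ℝ≥0∞) :
    w T + ∑' Q : {Q | IsStoppingDescendant E R Q}, w Q ≤
      ∑' Q : {Q | IsStoppingDescendant E T Q}, w Q := by
  classical
  rw [tsum_subtype, tsum_subtype, ← tsum_ite_eq T w, ← ENNReal.tsum_add]
  refine ENNReal.tsum_le_tsum fun Q => ?_
  by_cases hQ : Q = T
  · subst hQ
    have h1 : Q ∉ {Q | IsStoppingDescendant E R Q} := fun h => by
      have := scale_le_of_subset hd (IsStoppingDescendant.subset h)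
      exact absurd (scale_lt_of_mem_stoppingChildren hd hR) (not_lt.2 this)
    have h2 : Q ∈ {R | IsStoppingDescendant E Q R} := Relation.ReflTransGen.refl
    rw [indicator_of_notMem h1, indicator_of_mem h2]
    simp
  · rw [if_neg hQ, zero_add]
    have hsub : {Q | IsStoppingDescendant E R Q} ⊆ {Q | IsStoppingDescendant E T Q} :=
      fun Q hQ => Relation.ReflTransGen.head hR hQ
    exact indicator_le_indicator_of_subset hsub (fun _ => zero_le) Q

/-- Iteration of the one-step estimate along the stopping descendants that contain a point. -/
theorem le_tsum_descendants (hd : 0 < d)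
    (hE : ∀ Q : DyadicCube d, 2 ^ (2 * d + 1) * volume (E Q) ≤ volume Q.toSet)
    {x : Fin d → ℝ} {w : DyadicCube d → ℝ≥0∞}
    {v : DyadicCube d → ℤ → ℝ≥0∞}
    (h1 : ∀ Q : DyadicCube d, x ∈ Q.toSet → ∀ m, Q.scale ≤ m →
      ¬ (containing m x).toSet ⊆ E Q → v Q m ≤ w Q)
    (h2 : ∀ (Q R : DyadicCube d) (m : ℤ), Q.scale < R.scale → R.scale ≤ m →
      v Q m ≤ v Q (R.scale - 1) + v R m)
    (n : ℕ) {T : DyadicCube d} (hT : x ∈ T.toSet) {m : ℤ} (hm : m = T.scale + n) :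
    v T m ≤ ∑' Q : {Q | IsStoppingDescendant E T Q},
      (Q : DyadicCube d).toSet.indicator (fun _ => w Q) x := by
  induction n using Nat.strong_induction_on generalizing T with
  | _ n ih =>
  -- A cube inside the exceptional set lies in a stopping child.
  have hchild : ∀ k, T.scale ≤ k → (containing k x).toSet ⊆ E T →
      ∃ R ∈ stoppingChildren E T, x ∈ R.toSet ∧ R.scale ≤ k := by
    intro k hk hsub
    have hkT := containing_subset_of_mem hk hT
    have hne : containing k x ≠ T := fun he => not_subset_exceptional hE (by
      rw [he]
      exact le_mul_of_one_le_left' (one_le_pow₀ (by norm_num))) hsub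
    obtain ⟨W, hW, hsubW⟩ := exists_maximalCubes hd (Q := T) (F := {R | R.toSet ⊆ T.toSet ∧ R ≠ T ∧
      (R.toSet ⊆ E T ∨ IsBaseCube R ∧ IsBaseCube T)}) (fun R hR => hR.1)
      (show containing k x ∈ _ from ⟨hkT, hne, Or.inl hsub⟩)
    exact ⟨W, hW, hsubW (mem_containing k x), scale_le_of_subset hd hsubW⟩
  have hTm : T.toSet.indicator (fun _ => w T) x = w T := indicator_of_mem hT _
  by_cases hR : ∃ R ∈ stoppingChildren E T, x ∈ R.toSet ∧ R.scale ≤ m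
  · obtain ⟨R, hR, hxR, hRm⟩ := hR
    have hlt := scale_lt_of_mem_stoppingChildren hd hR
    refine (h2 T R m hlt hRm).trans (le_trans ?_ (add_tsum_descendants_le hd hR
      (fun Q => Q.toSet.indicator (fun _ => w Q) x)))
    rw [hTm]
    refine add_le_add (h1 T hT _ (by omega) fun hsub => ?_)
      (ih (m - R.scale).toNat (by omega) hxR (by omega))
    obtain ⟨W, hW, hxW, hWs⟩ := hchild _ (by omega) hsub
    have hWR : W = R := by
      by_contra hne
      exact (disjoint_left.1 (pairwiseDisjoint_maximalCubes _ hW hR hne)) hxW hxR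
    rw [hWR] at hWs
    omega
  · refine (h1 T hT m (by omega) fun hsub => hR (hchild m (by omega) hsub)).trans ?_
    rw [← hTm]
    exact ENNReal.le_tsum (f := fun Q : {Q | IsStoppingDescendant E T Q} =>
      (Q : DyadicCube d).toSet.indicator (fun _ => w Q) x) ⟨T, Relation.ReflTransGen.refl⟩

/-- The estimate `le_tsum_descendants`, started from a base cube that contains `x` and has a side
length of at least `2^{-l}`. -/
theorem exists_le_tsum_stoppingFamily (hd : 0 < d)
    (hE : ∀ Q : DyadicCube d, 2 ^ (2 * d + 1) * volume (E Q) ≤ volume Q.toSet)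
    {x : Fin d → ℝ} {w : DyadicCube d → ℝ≥0∞}
    {v : DyadicCube d → ℤ → ℝ≥0∞}
    (h1 : ∀ Q : DyadicCube d, x ∈ Q.toSet → ∀ m, Q.scale ≤ m →
      ¬ (containing m x).toSet ⊆ E Q → v Q m ≤ w Q)
    (h2 : ∀ (Q R : DyadicCube d) (m : ℤ), Q.scale < R.scale → R.scale ≤ m →
      v Q m ≤ v Q (R.scale - 1) + v R m) (l : ℤ) :
    ∃ T : DyadicCube d, T.scale ≤ l ∧ ∀ m, T.scale ≤ m → v T m ≤
      ∑' Q : stoppingFamily E, (Q : DyadicCube d).toSet.indicator (fun _ => w Q) x := by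
  obtain ⟨T, hT, hxT, hs⟩ := exists_isBaseCube_mem x l
  refine ⟨T, hs, fun m hm => ?_⟩
  refine (le_tsum_descendants hd hE h1 h2 (m - T.scale).toNat hxT (by omega)).trans ?_
  exact ENNReal.tsum_mono_subtype (fun Q : DyadicCube d => Q.toSet.indicator (fun _ => w Q) x)
    fun Q hQ => ⟨T, hT, hQ⟩

end CancellativeSparse

namespace CancellativeSparse

/-! ### Sparse bounds for layers, Haar shifts and the dyadic maximal function -/

open DyadicCube

variable {d : ℕ} {f : (Fin d → ℝ) → ℝ} {t s : ℕ} {K : ℝ} {L : ℤ → (Fin d → ℝ) → ℝ}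

theorem sum_Icc_pred_add_sum_Icc (g : ℤ → ℝ) {a b m : ℤ} (hab : a ≤ b) (hbm : b ≤ m) :
    ∑ k ∈ Finset.Icc a (b - 1), g k + ∑ k ∈ Finset.Icc b m, g k = ∑ k ∈ Finset.Icc a m, g k := by
  rw [← Finset.sum_union]
  · refine Finset.sum_congr (Finset.ext fun k => ?_) fun _ _ => rfl
    simp only [Finset.mem_union, Finset.mem_Icc]
    omega
  · rw [Finset.disjoint_left]
    intro k hk hk'
    rw [Finset.mem_Icc] at hk hk'
    omega

/-- The sparse bound for sums of layers. A sum over the generations `l, …, m` is the difference of two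
sums that start at a large base cube; this accounts for the factor `2`. -/
theorem exists_sparse_of_isLayer (hd : 0 < d) (hL : IsLayer f t s K L) (hK : 0 < K)
    (hf : LocallyIntegrable f) :
    ∃ S : Set (DyadicCube d), IsSparseFamily (1 / 2) S ∧ ∀ x,
      (∀ m, ‖dyadicAvg f m x‖ₑ ≤ sparseSum (dyadicLevel d t) S f x) ∧
      ∀ l m, ‖∑ k ∈ Finset.Icc l m, L k x‖ₑ ≤
        2 * ENNReal.ofReal (stepConst d s K) * sparseSum (dyadicLevel d t) S f x := by
  choose E hE hEx using exists_exceptional_set hd hL hK hf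
  refine ⟨stoppingFamily E, isSparseFamily_stoppingFamily hd hE, fun x => ⟨fun m => ?_,
    fun l m => ?_⟩⟩
  · obtain ⟨T, hT, hTm⟩ := exists_le_tsum_stoppingFamily hd hE (x := x)
      (w := fun Q => percentile (dyadicLevel d t) Q.toSet (dyadicMaxLocal Q f))
      (v := fun _ m => ‖dyadicAvg f m x‖ₑ)
      (fun Q hxQ m hm hn => (hEx Q x hxQ m hm hn).1) (fun Q R m _ _ => le_add_self) m
    exact hTm m hT
  · obtain ⟨T, hT, hTm⟩ := exists_le_tsum_stoppingFamily hd hE (x := x)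
      (w := fun Q => ENNReal.ofReal (stepConst d s K) *
        percentile (dyadicLevel d t) Q.toSet (dyadicMaxLocal Q f))
      (v := fun Q m => ‖∑ k ∈ Finset.Icc Q.scale m, L k x‖ₑ)
      (fun Q hxQ m hm hn => (hEx Q x hxQ m hm hn).2) (fun Q R m h1 h2 => by
        rw [← sum_Icc_pred_add_sum_Icc _ h1.le h2]
        exact enorm_add_le _ _) (l - 1)
    have hs : ∑' Q : stoppingFamily E, (Q : DyadicCube d).toSet.indicator
        (fun _ => ENNReal.ofReal (stepConst d s K) *
          percentile (dyadicLevel d t) (Q : DyadicCube d).toSet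
            (dyadicMaxLocal (Q : DyadicCube d) f)) x =
        ENNReal.ofReal (stepConst d s K) * sparseSum (dyadicLevel d t) (stoppingFamily E) f x := by
      rw [sparseSum, ← ENNReal.tsum_mul_left]
      refine tsum_congr fun Q => ?_
      by_cases hx : x ∈ (Q : DyadicCube d).toSet
      · rw [indicator_of_mem hx, indicator_of_mem hx]
      · rw [indicator_of_notMem hx, indicator_of_notMem hx, mul_zero]
    rw [hs] at hTm
    rcases lt_or_ge m l with hlt | hle
    · rw [Finset.Icc_eq_empty (not_le.2 hlt), Finset.sum_empty, enorm_zero]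
      exact zero_le
    · have hsum : ∑ k ∈ Finset.Icc l m, L k x = ∑ k ∈ Finset.Icc T.scale m, L k x -
          ∑ k ∈ Finset.Icc T.scale (l - 1), L k x := by
        rw [← sum_Icc_pred_add_sum_Icc _ (by omega : T.scale ≤ l) hle]
        ring
      rw [hsum, mul_assoc, two_mul]
      exact (enorm_sub_le).trans (add_le_add (hTm m (by omega)) (hTm (l - 1) (by omega)))

/-- The sparse bound for the dyadic maximal function is that for layers which vanish. -/
theorem exists_sparse_dyadicMax (hd : 0 < d) (hf : LocallyIntegrable f) :
    ∃ S : Set (DyadicCube d), IsSparseFamily (1 / 2) S ∧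
      ∀ x, dyadicMax f x ≤ sparseSum (dyadicLevel d 0) S f x := by
  have hL : IsLayer f 0 0 1 (fun _ _ => 0) :=
    ⟨fun k => ConstOnScale.const 0, fun k P _ => by simp, fun k x => by
      rw [zero_pow two_ne_zero, mul_zero]
      exact mul_nonneg (by norm_num) (integral_nonneg fun _ => sq_nonneg _)⟩
  obtain ⟨S, hS, h⟩ := exists_sparse_of_isLayer hd hL one_pos hf
  refine ⟨S, hS, fun x => iSup₂_le fun R hx => ?_⟩
  have := (h x).1 R.scale
  rwa [dyadicAvg, containing_eq hx] at this

section Haar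

variable {h : DyadicCube d → Fin (2 ^ d - 1) → (Fin d → ℝ) → ℝ}

/-- The factor by which the coefficients of a Haar shift are multiplied in the bound of a layer. -/
noncomputable def layerConst (d t s : ℕ) : ℝ :=
  (2 ^ t) ^ d * ((2 ^ s) ^ d * (2 ^ d * (2 ^ d * 2 ^ (d * (s + 1)))))

namespace IsHaarBasis

theorem constOnScale (hh : IsHaarBasis h) (Q : DyadicCube d) (i : Fin (2 ^ d - 1)) :
    ConstOnScale (Q.scale + 1) (h Q i) := by
  intro x y hxy
  by_cases hx : x ∈ Q.toSet
  · refine hh.const_on_children Q i _ (containing_mem_descendants hx 1) x (mem_containing _ x) y ?_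
    rw [Nat.cast_one, hxy]
    exact mem_containing _ y
  · rw [hh.support Q i x hx, hh.support Q i y fun hy => hx ?_]
    rw [mem_toSet_iff] at hy ⊢
    rw [← hy]
    exact containing_congr (by simp) hxy

theorem setIntegral_mul (hh : IsHaarBasis h) (Q : DyadicCube d) (i : Fin (2 ^ d - 1))
    (g : (Fin d → ℝ) → ℝ) : ∫ x in Q.toSet, g x * h Q i x = ∫ x, g x * h Q i x :=
  setIntegral_eq_integral_of_forall_compl_eq_zero fun x hx => by
    rw [hh.support Q i x hx, mul_zero]

theorem setIntegral_eq_zero (hh : IsHaarBasis h) (Q : DyadicCube d) (i : Fin (2 ^ d - 1)) :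
    ∫ x in Q.toSet, h Q i x = 0 := by
  rw [setIntegral_eq_integral_of_forall_compl_eq_zero (hh.support Q i), hh.integral_eq_zero]

theorem setIntegral_sq (hh : IsHaarBasis h) (Q : DyadicCube d) (i : Fin (2 ^ d - 1)) :
    ∫ x in Q.toSet, h Q i x ^ 2 = 1 := by
  simp only [sq]
  rw [hh.setIntegral_mul, hh.orthonormal, if_pos rfl]

theorem vol_mul_sq_le (hh : IsHaarBasis h) (Q : DyadicCube d) (i : Fin (2 ^ d - 1))
    (x : Fin d → ℝ) : vol d (Q.scale + 1) * h Q i x ^ 2 ≤ 1 := by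
  by_cases hx : x ∈ Q.toSet
  · rw [← hh.setIntegral_sq Q i, ← containing_scale (Q.scale + 1) x,
      ← setIntegral_of_const (Q := containing (Q.scale + 1) x) (g := fun y => h Q i y ^ 2)]
    · exact setIntegral_mono_set (((hh.constOnScale Q i).pow 2).integrableOn Q)
        (ae_of_all _ fun _ => sq_nonneg _)
        (containing_subset_of_mem (by simp) hx).eventuallyLE
    · intro y hy
      rw [(hh.constOnScale Q i).eq_of_mem le_rfl hy (mem_containing _ x)]
  · rw [hh.support Q i x hx]
    norm_num

/-- A Haar coefficient only depends on the martingale difference of `f` on the cube. -/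
theorem integral_mul_eq (hh : IsHaarBasis h) (hf : LocallyIntegrable f) (Q : DyadicCube d)
    (i : Fin (2 ^ d - 1)) : ∫ x, f x * h Q i x =
      ∫ x in Q.toSet, (dyadicAvg f (Q.scale + 1) x - dyadicAvg f Q.scale x) * h Q i x := by
  have hc := hh.constOnScale Q i
  have he := constOnScale_dyadicAvg f (Q.scale + 1)
  have he' := constOnScale_dyadicAvg f Q.scale
  obtain ⟨z, hz⟩ := Q.toSet_nonempty
  have h0 : ∫ x in Q.toSet, dyadicAvg f Q.scale x * h Q i x = 0 := by
    rw [setIntegral_congr_fun Q.measurableSet_toSet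
      (g := fun x => dyadicAvg f Q.scale z * h Q i x) fun x hx => by
        simp only [he'.eq_of_mem le_rfl hx hz], integral_const_mul, hh.setIntegral_eq_zero,
      mul_zero]
  have hcongr : ∀ R ∈ Q.descendants 1, ∀ w ∈ R.toSet, ∀ g : (Fin d → ℝ) → ℝ,
      EqOn (fun x => g x * h Q i x) (fun x => g x * h Q i w) R.toSet := by
    intro R hR w hw g x hx
    simp only [hc.eq_of_mem (by rw [(mem_descendants_iff.1 hR).1]; simp) hx hw]
  have hint : IntegrableOn (fun x => f x * h Q i x) Q.toSet := by
    rw [← biUnion_descendants Q 1, integrableOn_finset_iUnion]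
    intro R hR
    obtain ⟨w, hw⟩ := R.toSet_nonempty
    have hw' : IntegrableOn (fun x => f x * h Q i w) R.toSet :=
      (integrableOn_toSet hf R).mul_const _
    exact hw'.congr_fun (hcongr R hR w hw f).symm R.measurableSet_toSet
  simp only [sub_mul]
  rw [integral_sub ((he.mul hc).integrableOn Q)
    (((he'.mono (by simp)).mul hc).integrableOn Q), h0, sub_zero, ← hh.setIntegral_mul,
    setIntegral_eq_sum_descendants Q 1 hint,
    setIntegral_eq_sum_descendants Q 1 ((he.mul hc).integrableOn Q)]
  refine Finset.sum_congr rfl fun R hR => ?_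
  obtain ⟨w, hw⟩ := R.toSet_nonempty
  rw [setIntegral_congr_fun R.measurableSet_toSet (hcongr R hR w hw f),
    setIntegral_congr_fun R.measurableSet_toSet (hcongr R hR w hw _), integral_mul_const,
    integral_mul_const, setIntegral_dyadicAvg hf (by rw [(mem_descendants_iff.1 hR).1]; simp)]

/-- Bessel's inequality for a single Haar function. -/
theorem sq_integral_mul_le (hh : IsHaarBasis h) (hf : LocallyIntegrable f) (Q : DyadicCube d)
    (i : Fin (2 ^ d - 1)) : (∫ x, f x * h Q i x) ^ 2 ≤
      ∫ x in Q.toSet, (dyadicAvg f (Q.scale + 1) x - dyadicAvg f Q.scale x) ^ 2 := by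
  have hc := hh.constOnScale Q i
  have hD : ConstOnScale (Q.scale + 1)
      (fun x => dyadicAvg f (Q.scale + 1) x - dyadicAvg f Q.scale x) :=
    (constOnScale_dyadicAvg f _).sub ((constOnScale_dyadicAvg f _).mono (by simp))
  have hI := hh.integral_mul_eq hf Q i
  generalize ∫ x, f x * h Q i x = c at hI ⊢
  have i1 := (hD.pow 2).integrableOn Q
  have i2 := (hD.mul hc).integrableOn Q
  have i3 := (hc.pow 2).integrableOn Q
  -- The square of the distance to the projection onto `h Q i` is nonnegative.
  have hnn : 0 ≤ ∫ x in Q.toSet,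
      ((dyadicAvg f (Q.scale + 1) x - dyadicAvg f Q.scale x) - c * h Q i x) ^ 2 :=
    integral_nonneg fun _ => sq_nonneg _
  have hexp : ∫ x in Q.toSet,
      ((dyadicAvg f (Q.scale + 1) x - dyadicAvg f Q.scale x) - c * h Q i x) ^ 2 =
      (∫ x in Q.toSet, (dyadicAvg f (Q.scale + 1) x - dyadicAvg f Q.scale x) ^ 2) -
        2 * c * c + c ^ 2 * 1 := by
    have i12 : IntegrableOn (fun x => (dyadicAvg f (Q.scale + 1) x - dyadicAvg f Q.scale x) ^ 2 -
        2 * c * ((dyadicAvg f (Q.scale + 1) x - dyadicAvg f Q.scale x) * h Q i x)) Q.toSet :=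
      i1.sub (i2.const_mul _)
    have hpt : ∀ x, ((dyadicAvg f (Q.scale + 1) x - dyadicAvg f Q.scale x) - c * h Q i x) ^ 2 =
        (dyadicAvg f (Q.scale + 1) x - dyadicAvg f Q.scale x) ^ 2 -
        2 * c * ((dyadicAvg f (Q.scale + 1) x - dyadicAvg f Q.scale x) * h Q i x) +
        c ^ 2 * h Q i x ^ 2 := fun x => by ring
    simp only [hpt]
    rw [integral_add i12 (i3.const_mul _), integral_sub i1 (i2.const_mul _), integral_const_mul,
      integral_const_mul, ← hI, hh.setIntegral_sq]
  nlinarith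

theorem isLayer (hh : IsHaarBasis h) (hf : LocallyIntegrable f) (t s : ℕ) {α : ShiftCoeff d}
    {A : ℝ} (hA : 0 ≤ A)
    (hα : ∀ Q, ∀ T ∈ Q.descendants t, ∀ S ∈ Q.descendants s, ∀ i j, |α Q T S i j| ≤ A) :
    IsLayer f t s (layerConst d t s * A) (haarShiftLayer h t s α f) := by
  refine ⟨fun k x y hxy => ?_, fun k P hP => ?_, fun k x => ?_⟩
  · have hR : containing k x = containing k y := containing_congr (by omega) hxy
    simp only [haarShiftLayer, hR]
    refine Finset.sum_congr rfl fun T _ => Finset.sum_congr rfl fun S hS =>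
      Finset.sum_congr rfl fun i _ => Finset.sum_congr rfl fun j _ => ?_
    rw [hh.constOnScale S j x y]
    rw [(mem_descendants_iff.1 hS).1, containing_scale]
    exact hxy
  · obtain ⟨z, hz⟩ := P.toSet_nonempty
    have hPz : ∀ x ∈ P.toSet, containing k x = containing k z := fun x hx =>
      containing_congr (by omega : k ≤ P.scale) (by rw [containing_eq hx, containing_eq hz])
    have hS : ∀ S ∈ (containing k z).descendants s, ∀ j, ∫ x in P.toSet, h S j x = 0 := by
      intro S hS j
      have hSs : S.scale = P.scale := by rw [(mem_descendants_iff.1 hS).1, containing_scale, hP]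
      by_cases hSP : S = P
      · rw [hSP, hh.setIntegral_eq_zero]
      · rw [setIntegral_of_const (c := 0), mul_zero]
        exact fun x hx => hh.support S j x fun hx' => hSP (eq_of_mem hx' hx hSs)
    rw [setIntegral_congr_fun P.measurableSet_toSet (g := fun x =>
      ∑ T ∈ (containing k z).descendants t, ∑ S ∈ (containing k z).descendants s, ∑ i, ∑ j,
        α (containing k z) T S i j * (∫ y, f y * h T i y) * h S j x)
      (fun x hx => by simp only [haarShiftLayer, hPz x hx])]
    have hi : ∀ (c : ℝ) S j, IntegrableOn (fun x => c * h S j x) P.toSet := fun c S j =>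
      ((hh.constOnScale S j).integrableOn P).const_mul c
    rw [integral_finsetSum _ fun T _ => integrable_finsetSum _ fun S _ =>
      integrable_finsetSum _ fun i _ => integrable_finsetSum _ fun j _ => hi _ S j]
    refine Finset.sum_eq_zero fun T _ => ?_
    rw [integral_finsetSum _ fun S _ =>
      integrable_finsetSum _ fun i _ => integrable_finsetSum _ fun j _ => hi _ S j]
    refine Finset.sum_eq_zero fun S hS' => ?_
    rw [integral_finsetSum _ fun i _ => integrable_finsetSum _ fun j _ => hi _ S j]
    refine Finset.sum_eq_zero fun i _ => ?_
    rw [integral_finsetSum _ fun j _ => hi _ S j]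
    refine Finset.sum_eq_zero fun j _ => ?_
    rw [integral_const_mul, hS S hS' j, mul_zero]
  · set R := containing k x with hR
    have hRk : R.scale = k := rfl
    set G := ∫ y in R.toSet, (dyadicAvg f (k + t + 1) y - dyadicAvg f (k + t) y) ^ 2 with hG
    have hG0 : 0 ≤ G := integral_nonneg fun _ => sq_nonneg _
    have hv := vol_pos d (k + s + 1)
    set b := A * √G * √(vol d (k + s + 1))⁻¹ with hb
    have hb0 : 0 ≤ b := by positivity
    have hT : ∀ T ∈ R.descendants t, ∀ i, |∫ y, f y * h T i y| ≤ √G := by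
      intro T hT i
      obtain ⟨hT1, hT2⟩ := mem_descendants_iff.1 hT
      refine Real.abs_le_sqrt ((hh.sq_integral_mul_le hf T i).trans ?_)
      rw [hT1, hRk]
      refine setIntegral_mono_set ?_ (ae_of_all _ fun _ => sq_nonneg _) hT2.eventuallyLE
      exact (((constOnScale_dyadicAvg f _).sub
        ((constOnScale_dyadicAvg f _).mono (by simp))).pow 2).integrableOn R
    have hS : ∀ S ∈ R.descendants s, ∀ j, |h S j x| ≤ √(vol d (k + s + 1))⁻¹ := by
      intro S hS j
      have hS1 := (mem_descendants_iff.1 hS).1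
      refine Real.abs_le_sqrt ?_
      have := hh.vol_mul_sq_le S j x
      rw [hS1, hRk] at this
      rw [← one_div, le_div_iff₀ hv, mul_comm]
      exact this
    have hfin : ((2 ^ d - 1 : ℕ) : ℝ) ≤ 2 ^ d := by
      exact_mod_cast Nat.sub_le _ _
    have hcard : ∀ n, ((R.descendants n).card : ℝ) ≤ (2 ^ n) ^ d := fun n => by
      exact_mod_cast card_descendants_le R n
    have hL : |haarShiftLayer h t s α f k x| ≤
        (2 ^ t) ^ d * ((2 ^ s) ^ d * (2 ^ d * (2 ^ d * b))) := by
      have hsum : ∀ {ι : Type} (F : Finset ι) (u : ι → ℝ) (c N : ℝ), 0 ≤ c → (F.card : ℝ) ≤ N →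
          (∀ i ∈ F, |u i| ≤ c) → |∑ i ∈ F, u i| ≤ N * c := by
        intro ι F u c N hc hN hu
        refine (Finset.abs_sum_le_sum_abs _ _).trans ((Finset.sum_le_card_nsmul _ _ c hu).trans ?_)
        rw [nsmul_eq_mul]
        exact mul_le_mul_of_nonneg_right hN hc
      refine hsum _ _ _ _ (by positivity) (hcard t) fun T hT' => ?_
      refine hsum _ _ _ _ (by positivity) (hcard s) fun S hS' => ?_
      refine hsum _ _ _ _ (by positivity) (by simp) fun i _ => ?_
      refine hsum _ _ _ _ (by positivity) (by simp) fun j _ => ?_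
      rw [abs_mul, abs_mul]
      exact mul_le_mul (mul_le_mul (hα R T hT' S hS' i j) (hT T hT' i) (abs_nonneg _) hA)
        (hS S hS' j) (abs_nonneg _) (by positivity)
    have hb2 : b ^ 2 = A ^ 2 * G * (vol d (k + s + 1))⁻¹ := by
      rw [hb, mul_pow, mul_pow, Real.sq_sqrt hG0, Real.sq_sqrt (by positivity)]
    have hvol : vol d k = 2 ^ (d * (s + 1)) * vol d (k + s + 1) := by
      rw [← vol_add d k (s + 1)]
      push_cast
      rw [add_assoc]
    have hone : (1 : ℝ) ≤ 2 ^ (d * (s + 1)) := one_le_pow₀ (by norm_num)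
    calc vol d k * haarShiftLayer h t s α f k x ^ 2
        ≤ vol d k * ((2 ^ t) ^ d * ((2 ^ s) ^ d * (2 ^ d * (2 ^ d * b)))) ^ 2 := by
          refine mul_le_mul_of_nonneg_left ?_ (vol_pos d k).le
          rw [← sq_abs]
          exact pow_le_pow_left₀ (abs_nonneg _) hL 2
      _ = (((2 ^ t) ^ d * ((2 ^ s) ^ d * (2 ^ d * 2 ^ d))) ^ 2 * (A ^ 2 * G)) *
          2 ^ (d * (s + 1)) := by
          rw [hvol]
          field_simp
          rw [hb2]
          field_simp
      _ ≤ (((2 ^ t) ^ d * ((2 ^ s) ^ d * (2 ^ d * 2 ^ d))) ^ 2 * (A ^ 2 * G)) *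
          (2 ^ (d * (s + 1))) ^ 2 := by
          refine mul_le_mul_of_nonneg_left ?_ (by positivity)
          nlinarith
      _ = (layerConst d t s * A) ^ 2 * G := by
          rw [layerConst]
          ring

end IsHaarBasis

/-- The sparse bound for Haar shifts. If `A = 0`, the shift vanishes and the empty family will do;
`exists_sparse_of_isLayer` needs a positive constant. -/
theorem exists_sparse_maxHaarShift (hd : 0 < d) (hh : IsHaarBasis h) (hf : LocallyIntegrable f)
    {α : ShiftCoeff d} {A : ℝ≥0}
    (hα : ∀ Q, ∀ T ∈ Q.descendants t, ∀ S ∈ Q.descendants s, ∀ i j, |α Q T S i j| ≤ A) :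
    ∃ S : Set (DyadicCube d), IsSparseFamily (1 / 2) S ∧
      ∀ x, maxHaarShift h t s α f x ≤ ((2 * stepConst d s (layerConst d t s)).toNNReal : ℝ≥0∞) *
        A * sparseSum (dyadicLevel d t) S f x := by
  rcases eq_or_ne A 0 with rfl | hA
  · refine ⟨∅, ⟨fun _ => ∅, fun Q hQ => absurd hQ (notMem_empty Q), pairwiseDisjoint_empty⟩,
      fun x => ?_⟩
    have h0 : ∀ k, haarShiftLayer h t s α f k x = 0 := fun k =>
      Finset.sum_eq_zero fun T hT => Finset.sum_eq_zero fun S hS => Finset.sum_eq_zero fun i _ =>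
        Finset.sum_eq_zero fun j _ => by
          rw [abs_nonpos_iff.1 (hα _ T hT S hS i j), zero_mul, zero_mul]
    simp [maxHaarShift, h0]
  · have hA' : (0 : ℝ) < A := by positivity
    have hl : 0 < layerConst d t s := by unfold layerConst; positivity
    obtain ⟨S, hS, h⟩ := exists_sparse_of_isLayer hd (hh.isLayer hf t s hA'.le hα)
      (by positivity) hf
    refine ⟨S, hS, fun x => iSup_le fun l => iSup_le fun m => iSup_le fun _ => ?_⟩
    refine ((h x).2 l m).trans (le_of_eq ?_)
    have hc : stepConst d s (layerConst d t s * A) = stepConst d s (layerConst d t s) * A := by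
      rw [stepConst, stepConst, mul_assoc]
    have hc0 : 0 ≤ stepConst d s (layerConst d t s) := by unfold stepConst; positivity
    congr 1
    rw [hc, ENNReal.ofReal_mul hc0, ENNReal.ofReal_coe_nnreal, ← mul_assoc]
    congr 1
    change _ = ENNReal.ofReal _
    rw [ENNReal.ofReal_mul (by norm_num), ENNReal.ofReal_ofNat]

end Haar

end CancellativeSparse

namespace CancellativeSparse

/-! ### Conditional percentiles -/

section Percentile

variable {Ω : Type u} {m mΩ : MeasurableSpace Ω} {μ : Measure Ω}

/-- The defining property of conditional probabilities. -/
theorem setIntegral_condExp_indicator [IsFiniteMeasure μ] (hm : m ≤ mΩ) {A E : Set Ω}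
    (hA : MeasurableSet[m] A) (hE : MeasurableSet E) :
    ∫ x in A, (μ[E.indicator (fun _ => (1 : ℝ)) | m]) x ∂μ = μ.real (A ∩ E) := by
  rw [setIntegral_condExp hm ((integrable_const _).indicator hE) hA, setIntegral_indicator hE]
  simp

theorem measurable_condPercentile (m : MeasurableSpace Ω) (r : ℝ) (g : Ω → ℝ≥0∞) :
    Measurable[m] (condPercentile μ m r g) := by
  classical
  refine Measurable.iInf fun q => ?_
  set u := μ[Set.indicator {y | ((q : ℝ≥0) : ℝ≥0∞) < g y} (fun _ => (1 : ℝ)) | m] with hu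
  have : (fun x => ⨅ _ : u x ≤ r, ((q : ℝ≥0) : ℝ≥0∞)) =
      fun x => if u x ≤ r then ((q : ℝ≥0) : ℝ≥0∞) else ∞ := by
    funext x
    by_cases h : u x ≤ r <;> simp [h]
  rw [this]
  exact Measurable.ite (measurableSet_le stronglyMeasurable_condExp.measurable measurable_const)
    measurable_const measurable_const

/-- Above a level that exceeds the conditional percentile, `g` has conditional probability at most
`r`. The strict inequality between percentile and level provides a rational below the level that
qualifies in the infimum. -/
theorem measure_inter_lt_le [IsFiniteMeasure μ] (hm : m ≤ mΩ) {g : Ω → ℝ≥0∞} (hg : Measurable g)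
    {r : ℝ} (hr : 0 ≤ r) {A : Set Ω} (hA : MeasurableSet[m] A) {c : ℝ≥0∞}
    (h : ∀ᵐ x ∂μ, x ∈ A → condPercentile μ m r g x < c) :
    μ (A ∩ {x | c < g x}) ≤ ENNReal.ofReal r * μ A := by
  have hset : ∀ c : ℝ≥0∞, MeasurableSet {x | c < g x} := fun c =>
    measurableSet_lt measurable_const hg
  have hmono : ∀ᵐ x ∂μ, ∀ q : ℚ≥0, ((q : ℝ≥0) : ℝ≥0∞) < c →
      (μ[Set.indicator {y | c < g y} (fun _ => (1 : ℝ)) | m]) x ≤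
        (μ[Set.indicator {y | ((q : ℝ≥0) : ℝ≥0∞) < g y} (fun _ => (1 : ℝ)) | m]) x := by
    rw [ae_all_iff]
    intro q
    by_cases hq : ((q : ℝ≥0) : ℝ≥0∞) < c
    · filter_upwards [condExp_mono (m := m) (μ := μ)
        ((integrable_const (1 : ℝ)).indicator (hset c))
        ((integrable_const (1 : ℝ)).indicator (hset q)) (ae_of_all _ fun x =>
          indicator_le_indicator_of_subset (fun y (hy : c < g y) => hq.trans hy)
            (fun _ => zero_le_one) x)] with x hx _ using hx
    · exact ae_of_all _ fun x hq' => absurd hq' hq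
  have hle : ∀ᵐ x ∂μ, x ∈ A →
      (μ[Set.indicator {y | c < g y} (fun _ => (1 : ℝ)) | m]) x ≤ r := by
    filter_upwards [h, hmono] with x hx hx' hxA
    have := hx hxA
    simp only [condPercentile, iInf_lt_iff] at this
    obtain ⟨q, hq, hqc⟩ := this
    exact (hx' q hqc).trans hq
  have hint := setIntegral_condExp_indicator (μ := μ) hm hA (hset c)
  have hub : ∫ x in A, (μ[Set.indicator {y | c < g y} (fun _ => (1 : ℝ)) | m]) x ∂μ ≤
      ∫ _ in A, r ∂μ :=
    setIntegral_mono_on_ae integrable_condExp.integrableOn (integrable_const _).integrableOn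
      (hm _ hA) hle
  rw [hint, setIntegral_const, smul_eq_mul, mul_comm] at hub
  rw [← ofReal_measureReal, ← ofReal_measureReal, ← ENNReal.ofReal_mul hr]
  exact ENNReal.ofReal_le_ofReal hub

/-- The case of percentile zero, in which the level zero is reached by continuity of the measure. -/
theorem measure_inter_pos_le [IsFiniteMeasure μ] (hm : m ≤ mΩ) {g : Ω → ℝ≥0∞} (hg : Measurable g)
    {r : ℝ} (hr : 0 ≤ r) {A : Set Ω} (hA : MeasurableSet[m] A)
    (h : ∀ᵐ x ∂μ, x ∈ A → condPercentile μ m r g x = 0) :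
    μ (A ∩ {x | 0 < g x}) ≤ ENNReal.ofReal r * μ A := by
  have hU : A ∩ {x | 0 < g x} = ⋃ n : ℕ, A ∩ {x | ((n : ℝ≥0∞) + 1)⁻¹ < g x} := by
    ext x
    simp only [mem_inter_iff, mem_ofPred_eq, mem_iUnion]
    constructor
    · rintro ⟨hx, hpos⟩
      obtain ⟨n, hn⟩ := ENNReal.exists_inv_nat_lt hpos.ne'
      exact ⟨n, hx, lt_of_le_of_lt (ENNReal.inv_le_inv.2 le_self_add) hn⟩
    · rintro ⟨n, hx, hn⟩
      exact ⟨hx, zero_le.trans_lt hn⟩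
  have hmono : Monotone fun n : ℕ => A ∩ {x | ((n : ℝ≥0∞) + 1)⁻¹ < g x} := by
    rintro n k hnk x ⟨hx, hlt⟩
    refine ⟨hx, lt_of_le_of_lt (ENNReal.inv_le_inv.2 ?_) hlt⟩
    gcongr
  rw [hU, hmono.measure_iUnion]
  refine iSup_le fun n => measure_inter_lt_le hm hg hr hA ?_
  filter_upwards [h] with x hx hxA
  rw [hx hxA, ENNReal.inv_pos]
  finiteness

theorem condPercentile_lt_top {g : Ω → ℝ≥0∞} {r : ℝ}
    (hr : 0 ≤ r) {M : ℝ≥0} (hM : ∀ᵐ x ∂μ, g x ≤ M) :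
    ∀ᵐ x ∂μ, condPercentile μ m r g x < ∞ := by
  obtain ⟨n, hn⟩ := exists_nat_ge M
  have h0 : Set.indicator {y | (((n : ℚ≥0) : ℝ≥0) : ℝ≥0∞) < g y} (fun _ => (1 : ℝ)) =ᵐ[μ] 0 := by
    filter_upwards [hM] with x hx
    refine indicator_of_notMem (fun hlt => ?_) _
    refine absurd (show (((n : ℚ≥0) : ℝ≥0) : ℝ≥0∞) < g x from hlt) (not_lt.2 (hx.trans ?_))
    rw [ENNReal.coe_le_coe]
    exact_mod_cast hn
  filter_upwards [condExp_congr_ae (m := m) h0] with x hx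
  refine lt_of_le_of_lt (iInf₂_le (n : ℚ≥0) ?_) ENNReal.coe_lt_top
  rw [hx, condExp_zero]
  exact hr

end Percentile

/-! ### Rounding up to powers of two -/

/-- The least power of two that exceeds `s > 0`, and zero if `s ≤ 0`. Rounding makes a threshold
locally constant up to null sets, at the price of a factor two. -/
noncomputable def roundUp (s : ℝ) : ℝ := if s ≤ 0 then 0 else 2 ^ (Int.log 2 s + 1)

theorem roundUp_nonneg (s : ℝ) : 0 ≤ roundUp s := by
  unfold roundUp
  split_ifs
  · exact le_rfl
  · positivity

theorem lt_roundUp {s : ℝ} (hs : 0 < s) : s < roundUp s := by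
  rw [roundUp, if_neg (not_le.2 hs)]
  exact_mod_cast Int.lt_zpow_succ_log_self (b := 2) (by norm_num) s

theorem roundUp_le {s : ℝ} (hs : 0 ≤ s) : roundUp s ≤ 2 * s := by
  unfold roundUp
  split_ifs with h
  · linarith
  · have := Int.zpow_log_le_self (b := 2) (by norm_num) (not_le.1 h)
    rw [zpow_add₀ (by norm_num), zpow_one, mul_comm]
    push_cast at this
    linarith

theorem monotone_roundUp : Monotone roundUp := by
  intro s s' h
  by_cases hs : s ≤ 0
  · rw [roundUp, if_pos hs]
    exact roundUp_nonneg s'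
  · have hs' : ¬ s' ≤ 0 := fun h' => hs (h.trans h')
    rw [roundUp, roundUp, if_neg hs, if_neg hs']
    refine zpow_le_zpow_right₀ (by norm_num) ?_
    have := Int.log_mono_right (b := 2) (not_le.1 hs) h
    omega

theorem countable_range_roundUp : (range roundUp).Countable := by
  refine ((countable_range fun i : ℤ => (2 : ℝ) ^ i).insert 0).mono ?_
  rintro _ ⟨s, rfl⟩
  unfold roundUp
  split_ifs
  · exact mem_insert _ _
  · exact mem_insert_of_mem _ ⟨_, rfl⟩

/-! ### First entrance times -/

section FirstTime

variable {Ω : Type u} {mΩ : MeasurableSpace Ω} {ℱ : Filtration ℕ mΩ} {P : ℕ → Set Ω} {x : Ω}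
  {n : ℕ}

open Classical in
/-- The first time `n` with `x ∈ P n`. -/
noncomputable def firstTime (P : ℕ → Set Ω) (x : Ω) : WithTop ℕ :=
  if h : ∃ n, x ∈ P n then ((Nat.find h : ℕ) : WithTop ℕ) else ⊤

theorem firstTime_le_iff : firstTime P x ≤ n ↔ ∃ k ≤ n, x ∈ P k := by
  classical
  unfold firstTime
  split_ifs with h
  · rw [Nat.cast_le, Nat.find_le_iff]
  · refine ⟨fun hn => absurd (top_le_iff.1 hn) (WithTop.natCast_ne_top n), fun ⟨k, _, hk⟩ => ?_⟩
    exact absurd ⟨k, hk⟩ h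

theorem notMem_of_lt_firstTime (h : (n : WithTop ℕ) < firstTime P x) : x ∉ P n := fun hx =>
  absurd (firstTime_le_iff.2 ⟨n, le_rfl, hx⟩) (not_le.2 h)

theorem mem_of_firstTime_eq (h : firstTime P x = n) : x ∈ P n := by
  obtain ⟨k, hk, hx⟩ := firstTime_le_iff.1 h.le
  have hnk : firstTime P x ≤ k := firstTime_le_iff.2 ⟨k, le_rfl, hx⟩
  rw [h, Nat.cast_le] at hnk
  rwa [le_antisymm hnk hk]

theorem isStoppingTime_firstTime (hP : ∀ n, MeasurableSet[ℱ n] (P n)) :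
    IsStoppingTime ℱ (firstTime P) := by
  intro n
  have : {x | firstTime P x ≤ (n : WithTop ℕ)} = ⋃ k ≤ n, P k := by
    ext x
    simp only [mem_ofPred_eq, firstTime_le_iff, mem_iUnion, exists_prop]
  change MeasurableSet[ℱ n] {x | firstTime P x ≤ (n : WithTop ℕ)}
  rw [this]
  exact MeasurableSet.iUnion fun k => MeasurableSet.iUnion fun hk => ℱ.mono hk _ (hP k)

end FirstTime

/-! ### The percentile at a stopping time -/

section Stopped

variable {Ω : Type u} {mΩ : MeasurableSpace Ω} {μ : Measure Ω} {ℱ : Filtration ℕ mΩ}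
  {ν : Ω → WithTop ℕ} {r : ℝ}

theorem exists_eq_of_ne_top {a : WithTop ℕ} (h : a ≠ ⊤) : ∃ n : ℕ, a = n :=
  (ENat.ne_top_iff_exists.1 h).imp fun _ hn => hn.symm

theorem stoppedPercentile_eq {g : Ω → ℝ≥0∞} {x : Ω} {k : ℕ} (h : ν x = k) :
    stoppedPercentile μ ℱ ν r g x = condPercentile μ (ℱ k) r g x := by
  rw [stoppedPercentile, tsum_eq_single k]
  · exact indicator_of_mem (show x ∈ {y | ν y = k} from h) _
  · intro j hj
    refine indicator_of_notMem (fun hx => hj ?_) _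
    exact Nat.cast_injective ((show ν x = j from hx).symm.trans h)

theorem measurable_doobMaxFrom (hν : IsStoppingTime ℱ ν) (f : Ω → ℝ) :
    Measurable (doobMaxFrom μ ℱ ν f) := by
  classical
  refine Measurable.iSup fun k => ?_
  have : (fun x => ⨆ _ : ν x ≤ k, ‖(μ[f | ℱ k]) x‖ₑ) =
      fun x => if ν x ≤ k then ‖(μ[f | ℱ k]) x‖ₑ else 0 := by
    funext x
    by_cases h : ν x ≤ k <;> simp [h]
  rw [this]
  exact Measurable.ite (ℱ.le k _ (hν k))
    ((stronglyMeasurable_condExp.mono (ℱ.le k)).measurable.enorm) measurable_const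

/-- The rounded percentile of the maximal function that starts at the stopping time `ν`. -/
noncomputable def threshold (μ : Measure Ω) (ℱ : Filtration ℕ mΩ) (ν : Ω → WithTop ℕ) (r : ℝ)
    (f : Ω → ℝ) (x : Ω) : ℝ :=
  roundUp (stoppedPercentile μ ℱ ν r (doobMaxFrom μ ℱ ν f) x).toReal

/-- The threshold is known at time `n` on the event `ν ≤ n`. -/
theorem measurable_indicator_threshold (hν : IsStoppingTime ℱ ν) (f : Ω → ℝ) (n : ℕ) :
    Measurable[ℱ n] ({x | ν x ≤ n}.indicator (threshold μ ℱ ν r f)) := by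
  have : {x | ν x ≤ n}.indicator (threshold μ ℱ ν r f) = fun x => ∑ k ∈ Finset.range (n + 1),
      {x | ν x = k}.indicator
        (fun x => roundUp (condPercentile μ (ℱ k) r (doobMaxFrom μ ℱ ν f) x).toReal) x := by
    funext x
    by_cases hx : ν x ≤ n
    · obtain ⟨k, hk⟩ := exists_eq_of_ne_top (ne_top_of_le_ne_top (WithTop.natCast_ne_top n) hx)
      have hkn : k ≤ n := by rwa [hk, Nat.cast_le] at hx
      rw [indicator_of_mem (show x ∈ {x | ν x ≤ n} from hx), Finset.sum_eq_single k]
      · rw [indicator_of_mem (show x ∈ {x | ν x = k} from hk), threshold,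
          stoppedPercentile_eq hk]
      · intro j _ hj
        have hx' : x ∉ {x | ν x = (j : WithTop ℕ)} := fun hx' =>
          hj (Nat.cast_injective ((show ν x = j from hx').symm.trans hk))
        exact indicator_of_notMem hx' _
      · intro hk'
        exact absurd (Finset.mem_range.2 (by omega)) hk'
    · rw [indicator_of_notMem (show x ∉ {x | ν x ≤ n} from hx)]
      refine (Finset.sum_eq_zero fun k hk => ?_).symm
      rw [Finset.mem_range] at hk
      refine indicator_of_notMem (s := {x | ν x = (k : WithTop ℕ)}) (fun hx' => hx ?_) _
      rw [show ν x = k from hx', Nat.cast_le]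
      omega
  rw [this]
  refine Finset.measurable_fun_sum _ fun k hk => ?_
  rw [Finset.mem_range] at hk
  refine Measurable.indicator ?_ (ℱ.mono (by omega : k ≤ n) _ (hν.measurableSet_eq k))
  exact monotone_roundUp.measurable.comp (((measurable_condPercentile (ℱ k) r _).mono
    (ℱ.mono (by omega)) le_rfl).ennreal_toReal)

end Stopped

end CancellativeSparse

namespace CancellativeSparse

/-! ### Energy estimates before a stopping time -/

section Energy

variable {Ω : Type u} {mΩ : MeasurableSpace Ω} {μ : Measure Ω} {ℱ : Filtration ℕ mΩ}

/-- Adapted processes `n ↦ Z k n`, one for each starting time `k`, whose energy is dominated by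
that of the martingale of `f`, and whose square roots have jumps dominated by those of the
martingale of `f`. Examples are the squares of the increments of a martingale transform after time
`k` and the sums of the squares of the martingale differences after time `k`. -/
structure IsControlled (μ : Measure Ω) (ℱ : Filtration ℕ mΩ) (f : Ω → ℝ) (Z : ℕ → ℕ → Ω → ℝ) :
    Prop where
  measurable : ∀ k n, Measurable[ℱ n] (Z k n)
  integrable : ∀ k n, Integrable (Z k n) μ
  nonneg : ∀ k n x, 0 ≤ Z k n x
  self : ∀ k x, Z k k x = 0
  sqrt_succ_le : ∀ k n, k ≤ n → ∀ᵐ x ∂μ,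
    √(Z k (n + 1) x) ≤ √(Z k n x) + |(μ[f | ℱ (n + 1)]) x - (μ[f | ℱ n]) x|
  energy : ∀ k n, k ≤ n → ∀ B, MeasurableSet[ℱ n] B → ∫ x in B, Z k (n + 1) x ∂μ ≤
    (∫ x in B, Z k n x ∂μ) + ∫ x in B, ((μ[f | ℱ (n + 1)]) x ^ 2 - (μ[f | ℱ n]) x ^ 2) ∂μ

variable {f : Ω → ℝ} {M : ℝ≥0}

theorem abs_condExp_le (hM : ∀ᵐ x ∂μ, |f x| ≤ M) (n : ℕ) :
    ∀ᵐ x ∂μ, |(μ[f | ℱ n]) x| ≤ M :=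
  ae_bdd_abs_condExp_of_ae_bdd_abs hM

theorem measurable_condExp_filtration (f : Ω → ℝ) {k n : ℕ} (hkn : k ≤ n) :
    Measurable[ℱ n] (μ[f | ℱ k]) :=
  (stronglyMeasurable_condExp.mono (ℱ.mono hkn)).measurable

theorem integrable_condExp_sq [IsFiniteMeasure μ] (hM : ∀ᵐ x ∂μ, |f x| ≤ M) (n : ℕ) :
    Integrable (fun x => (μ[f | ℱ n]) x ^ 2) μ := by
  refine Integrable.of_bound (C := (M : ℝ) ^ 2)
    (((measurable_condExp_filtration f le_rfl).mono (ℱ.le n) le_rfl).pow_const 2).aestronglyMeasurable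
    ?_
  filter_upwards [abs_condExp_le (ℱ := ℱ) hM n] with x hx
  rw [Real.norm_eq_abs, abs_pow]
  exact pow_le_pow_left₀ (abs_nonneg _) hx 2

/-- The energy collected until the sets `B i` are left is at most `c ^ 2` per unit of mass: it is
dominated by the telescoping energy of the martingale of `f`, which is bounded by `c` there. -/
theorem sum_setIntegral_le [IsFiniteMeasure μ] {Z : ℕ → ℕ → Ω → ℝ} (hZ : IsControlled μ ℱ f Z)
    (hM : ∀ᵐ x ∂μ, |f x| ≤ M) (k : ℕ) {B : ℕ → Set Ω}
    (hB : ∀ i, MeasurableSet[ℱ (k + i)] (B i)) (hanti : ∀ i, B (i + 1) ⊆ B i) {c : ℝ}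
    (hc : ∀ i, ∀ᵐ x ∂μ, x ∈ B i →
      |(μ[f | ℱ (k + i)]) x| ≤ c ∧ |(μ[f | ℱ (k + i + 1)]) x| ≤ c) (N : ℕ) :
    ∑ i ∈ Finset.range N, ∫ x in B i \ B (i + 1), Z k (k + i + 1) x ∂μ ≤ c ^ 2 * μ.real (B 0) := by
  have hB' : ∀ i, MeasurableSet (B i) := fun i => ℱ.le _ _ (hB i)
  have hsq : ∀ n, Integrable (fun x => (μ[f | ℱ n]) x ^ 2) μ := fun n => integrable_condExp_sq hM n
  have hle : ∀ {a : ℝ}, |a| ≤ c → a ^ 2 ≤ c ^ 2 := fun {a} h =>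
    sq_le_sq' (by linarith [neg_abs_le a]) ((le_abs_self a).trans h)
  have key : (∫ x in B N, Z k (k + N) x ∂μ) +
      (∑ i ∈ Finset.range N, ∫ x in B i \ B (i + 1), Z k (k + i + 1) x ∂μ) +
      c ^ 2 * μ.real (B N) ≤ (∫ x in B N, (μ[f | ℱ (k + N)]) x ^ 2 ∂μ) + c ^ 2 * μ.real (B 0) := by
    induction N with
    | zero =>
      simp only [add_zero, Finset.range_zero, Finset.sum_empty, hZ.self, integral_zero, zero_add]
      exact le_add_of_nonneg_left (integral_nonneg fun _ => sq_nonneg _)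
    | succ N ih =>
      have h1 := hZ.energy k (k + N) (by omega) (B N) (hB N)
      rw [integral_sub (hsq _).integrableOn (hsq _).integrableOn] at h1
      have h2 := setIntegral_sdiff (μ := μ) (hB' (N + 1)) (hZ.integrable k (k + N + 1)).integrableOn
        (hanti N)
      have h3 := setIntegral_sdiff (μ := μ) (hB' (N + 1)) (hsq (k + N + 1)).integrableOn (hanti N)
      have h4 := measureReal_sdiff (μ := μ) (hanti N) (hB' (N + 1))
      have h5 : ∫ x in B N \ B (N + 1), (μ[f | ℱ (k + N + 1)]) x ^ 2 ∂μ ≤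
          c ^ 2 * μ.real (B N \ B (N + 1)) := by
        calc _ ≤ ∫ x in B N \ B (N + 1), c ^ 2 ∂μ := by
              refine setIntegral_mono_on_ae (hsq _).integrableOn (integrable_const _).integrableOn
                ((hB' N).diff (hB' (N + 1))) ?_
              filter_upwards [hc N] with x hx hxB
              exact hle (hx hxB.1).2
          _ = _ := by rw [setIntegral_const, smul_eq_mul, mul_comm]
      rw [h4, mul_sub] at h5
      rw [Finset.sum_range_succ]
      simp only [← add_assoc]
      linarith
  have h0 : 0 ≤ ∫ x in B N, Z k (k + N) x ∂μ := integral_nonneg fun x => hZ.nonneg _ _ x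
  have h6 : ∫ x in B N, (μ[f | ℱ (k + N)]) x ^ 2 ∂μ ≤ c ^ 2 * μ.real (B N) := by
    calc _ ≤ ∫ x in B N, c ^ 2 ∂μ := by
          refine setIntegral_mono_on_ae (hsq _).integrableOn (integrable_const _).integrableOn
            (hB' N) ?_
          filter_upwards [hc N] with x hx hxB
          exact hle (hx hxB).1
      _ = _ := by rw [setIntegral_const, smul_eq_mul, mul_comm]
  linarith

/-- Chebyshev's inequality for the energy that is present at the time of leaving the sets `B i`. -/
theorem mul_measure_iUnion_le [IsFiniteMeasure μ] {Z : ℕ → ℕ → Ω → ℝ} (hZ : IsControlled μ ℱ f Z)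
    (hM : ∀ᵐ x ∂μ, |f x| ≤ M) (k : ℕ) {B : ℕ → Set Ω}
    (hB : ∀ i, MeasurableSet[ℱ (k + i)] (B i)) (hanti : ∀ i, B (i + 1) ⊆ B i) {c : ℝ}
    (hc : ∀ i, ∀ᵐ x ∂μ, x ∈ B i →
      |(μ[f | ℱ (k + i)]) x| ≤ c ∧ |(μ[f | ℱ (k + i + 1)]) x| ≤ c) {C : ℝ} (hC : 0 < C) :
    ENNReal.ofReal C * μ (⋃ i, {x ∈ B i \ B (i + 1) | C * c ^ 2 < Z k (k + i + 1) x}) ≤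
      μ (B 0) := by
  have hB' : ∀ i, MeasurableSet (B i \ B (i + 1)) := fun i =>
    (ℱ.le _ _ (hB i)).diff (ℱ.le _ _ (hB (i + 1)))
  set G : ℕ → Set Ω := fun i => {x ∈ B i \ B (i + 1) | C * c ^ 2 < Z k (k + i + 1) x} with hG
  have hZm : ∀ n, Measurable (Z k n) := fun n => (hZ.measurable k n).mono (ℱ.le n) le_rfl
  have hGm : ∀ i, MeasurableSet (G i) := fun i =>
    (hB' i).inter (measurableSet_lt measurable_const (hZm _))
  have hsum := sum_setIntegral_le hZ hM k hB hanti hc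
  have hnn : ∀ i, 0 ≤ ∫ x in B i \ B (i + 1), Z k (k + i + 1) x ∂μ := fun i =>
    integral_nonneg fun x => hZ.nonneg _ _ x
  by_cases hc0 : c ^ 2 = 0
  · have hG0 : ∀ i, μ (G i) = 0 := by
      intro i
      have h1 : ∫ x in B i \ B (i + 1), Z k (k + i + 1) x ∂μ = 0 := by
        refine le_antisymm ?_ (hnn i)
        have h2 := hsum (i + 1)
        rw [hc0, zero_mul, Finset.sum_range_succ] at h2
        have h3 : 0 ≤ ∑ i ∈ Finset.range i, ∫ x in B i \ B (i + 1), Z k (k + i + 1) x ∂μ :=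
          Finset.sum_nonneg fun i _ => hnn i
        linarith
      rw [setIntegral_eq_zero_iff_of_nonneg_ae (ae_of_all _ (hZ.nonneg _ _))
        (hZ.integrable _ _).integrableOn, EventuallyEq, ae_restrict_iff' (hB' i)] at h1
      have h4 : ∀ᵐ x ∂μ, x ∉ G i := by
        filter_upwards [h1] with x hx0 hx
        have := hx.2
        rw [hc0, mul_zero, hx0 hx.1] at this
        exact lt_irrefl _ this
      exact measure_eq_zero_iff_ae_notMem.2 h4
    rw [measure_iUnion_null hG0, mul_zero]
    exact zero_le
  · have hcpos : 0 < c ^ 2 := lt_of_le_of_ne (sq_nonneg c) (Ne.symm hc0)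
    have h1 : ∀ i, C * c ^ 2 * μ.real (G i) ≤
        ∫ x in B i \ B (i + 1), Z k (k + i + 1) x ∂μ := by
      intro i
      calc C * c ^ 2 * μ.real (G i) = ∫ x in G i, C * c ^ 2 ∂μ := by
            rw [setIntegral_const, smul_eq_mul, mul_comm]
        _ ≤ ∫ x in G i, Z k (k + i + 1) x ∂μ :=
            setIntegral_mono_on (integrable_const _).integrableOn (hZ.integrable _ _).integrableOn
              (hGm i) fun x hx => hx.2.le
        _ ≤ _ := setIntegral_mono_set (hZ.integrable _ _).integrableOn
              (ae_of_all _ (hZ.nonneg _ _))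
              (show G i ⊆ B i \ B (i + 1) from fun x hx => hx.1).eventuallyLE
    have h2 : ∀ N, ∑ i ∈ Finset.range N, ENNReal.ofReal C * μ (G i) ≤ μ (B 0) := by
      intro N
      have h3 : C * ∑ i ∈ Finset.range N, μ.real (G i) ≤ μ.real (B 0) := by
        have h4 : ∑ i ∈ Finset.range N, C * c ^ 2 * μ.real (G i) ≤ c ^ 2 * μ.real (B 0) :=
          (Finset.sum_le_sum fun i _ => h1 i).trans (hsum N)
        rw [← Finset.mul_sum] at h4
        have h5 : c ^ 2 * (C * ∑ i ∈ Finset.range N, μ.real (G i)) ≤ c ^ 2 * μ.real (B 0) := by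
          linarith
        exact le_of_mul_le_mul_left h5 hcpos
      rw [← Finset.mul_sum, ← ofReal_measureReal (s := B 0),
        Finset.sum_congr rfl fun i _ => (ofReal_measureReal (μ := μ) (s := G i)).symm,
        ← ENNReal.ofReal_sum_of_nonneg fun i _ => measureReal_nonneg, ← ENNReal.ofReal_mul hC.le]
      exact ENNReal.ofReal_le_ofReal h3
    calc ENNReal.ofReal C * μ (⋃ i, G i) ≤ ENNReal.ofReal C * ∑' i, μ (G i) := by
          gcongr
          exact measure_iUnion_le _
      _ = ∑' i, ENNReal.ofReal C * μ (G i) := ENNReal.tsum_mul_left.symm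
      _ ≤ μ (B 0) := ENNReal.tsum_le_of_sum_range_le h2

/-- The maximal inequality for the conditional probabilities of `E`, localized to `A`. -/
theorem measure_iUnion_le_of_le_condExp [IsFiniteMeasure μ] {R : ℝ} (hR : 0 < R) {A E : Set Ω}
    (hE : MeasurableSet E) {B : ℕ → Set Ω} (hB : ∀ n, MeasurableSet[ℱ n] (B n))
    (hBA : ∀ n, B n ⊆ A) (hdisj : Pairwise (Function.onFun Disjoint B))
    (h : ∀ n, ∀ x ∈ B n, 1 / R ≤ (μ[E.indicator (fun _ => (1 : ℝ)) | ℱ n]) x) :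
    μ (⋃ n, B n) ≤ ENNReal.ofReal R * μ (A ∩ E) := by
  have hB' : ∀ n, MeasurableSet (B n) := fun n => ℱ.le n _ (hB n)
  have h1 : ∀ n, μ (B n) ≤ ENNReal.ofReal R * μ.restrict E (B n) := by
    intro n
    have h2 : ∫ x in B n, 1 / R ∂μ ≤ μ.real (B n ∩ E) := by
      rw [← setIntegral_condExp_indicator (ℱ.le n) (hB n) hE]
      exact setIntegral_mono_on (integrable_const _).integrableOn integrable_condExp.integrableOn
        (hB' n) (h n)
    rw [setIntegral_const, smul_eq_mul, mul_one_div, div_le_iff₀ hR, mul_comm] at h2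
    rw [Measure.restrict_apply (hB' n), ← ofReal_measureReal, ← ofReal_measureReal (s := B n ∩ E),
      ← ENNReal.ofReal_mul hR.le]
    exact ENNReal.ofReal_le_ofReal h2
  calc μ (⋃ n, B n) ≤ ∑' n, μ (B n) := measure_iUnion_le _
    _ ≤ ∑' n, ENNReal.ofReal R * μ.restrict E (B n) := ENNReal.tsum_le_tsum h1
    _ = ENNReal.ofReal R * μ.restrict E (⋃ n, B n) := by
        rw [ENNReal.tsum_mul_left, measure_iUnion hdisj hB']
    _ ≤ _ := by
        rw [Measure.restrict_apply (MeasurableSet.iUnion hB')]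
        gcongr
        exact iUnion_subset hBA

/-- On an event that is known and lies in `E`, the conditional probability of `E` is one. -/
theorem one_le_condExp_indicator [IsFiniteMeasure μ] {m : MeasurableSpace Ω} (hm : m ≤ mΩ)
    {H E : Set Ω} (hH : MeasurableSet[m] H) (hE : MeasurableSet[mΩ] E) (hHE : H ⊆ E) :
    ∀ᵐ x ∂μ, x ∈ H → 1 ≤ (μ[E.indicator (fun _ => (1 : ℝ)) | m]) x := by
  have h1 := condExp_mono (m := m) (μ := μ) ((integrable_const (1 : ℝ)).indicator (hm _ hH))
    ((integrable_const (1 : ℝ)).indicator hE)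
    (ae_of_all _ fun x => indicator_le_indicator_of_subset hHE (fun _ => zero_le_one) x)
  rw [condExp_of_stronglyMeasurable hm (stronglyMeasurable_const.indicator hH)
    ((integrable_const (1 : ℝ)).indicator (hm _ hH))] at h1
  filter_upwards [h1] with x hx hxH
  rwa [indicator_of_mem hxH] at hx

/-- A proportional measure bound on each level set of a function with countably many values gives the
bound on the whole set. -/
theorem measure_inter_le_of_forall_level {A U : Set Ω} {lam : Ω → ℝ} {T : Set ℝ}
    (hT : T.Countable) (hlam : ∀ x, lam x ∈ T)
    (hA : ∀ c, MeasurableSet (A ∩ {x | lam x = c})) {b : ℝ≥0∞}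
    (h : ∀ c, μ ((A ∩ {x | lam x = c}) ∩ U) ≤ b * μ (A ∩ {x | lam x = c})) :
    μ (A ∩ U) ≤ b * μ A := by
  have hU : A = ⋃ c ∈ T, A ∩ {x | lam x = c} := by
    ext x
    simp only [mem_iUnion, mem_inter_iff, mem_ofPred_eq, exists_prop]
    exact ⟨fun hx => ⟨lam x, hlam x, hx, rfl⟩, fun ⟨_, _, hx, _⟩ => hx⟩
  have hd : T.PairwiseDisjoint fun c => A ∩ {x | lam x = c} := by
    intro c _ c' _ hne
    refine disjoint_left.2 fun x hx hx' => hne ?_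
    exact (show lam x = c from hx.2).symm.trans hx'.2
  calc μ (A ∩ U) ≤ μ (⋃ c ∈ T, (A ∩ {x | lam x = c}) ∩ U) := by
        refine measure_mono fun x hx => ?_
        exact mem_biUnion (hlam x) ⟨⟨hx.1, rfl⟩, hx.2⟩
    _ ≤ ∑' c : T, μ ((A ∩ {x | lam x = c}) ∩ U) := measure_biUnion_le _ hT _
    _ ≤ ∑' c : T, b * μ (A ∩ {x | lam x = c}) := ENNReal.tsum_le_tsum fun c => h c
    _ = b * μ A := by
        conv_rhs => rw [hU]
        rw [ENNReal.tsum_mul_left, measure_biUnion hT hd fun c _ => hA c]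

end Energy

end CancellativeSparse

namespace CancellativeSparse

/-! ### One step of the stopping procedure for regular filtrations -/

section Step

variable {Ω : Type u} {mΩ : MeasurableSpace Ω} {μ : Measure Ω} {ℱ : Filtration ℕ mΩ}
  {ν : Ω → WithTop ℕ} {r R : ℝ} {f : Ω → ℝ} {M : ℝ≥0} {Z : ℕ → ℕ → Ω → ℝ}

theorem measurable_threshold (hν : IsStoppingTime ℱ ν) :
    Measurable (threshold μ ℱ ν r f) := by
  refine monotone_roundUp.measurable.comp (Measurable.ennreal_toReal ?_)
  refine Measurable.tsum fun k => Measurable.indicator ?_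
    (ℱ.le k _ (hν.measurableSet_eq k))
  exact (measurable_condPercentile (ℱ k) r _).mono (ℱ.le k) le_rfl

/-- The set where the maximal function that starts at `ν` exceeds the threshold of `ν`. -/
def exceedSet (μ : Measure Ω) (ℱ : Filtration ℕ mΩ) (ν : Ω → WithTop ℕ) (r : ℝ) (f : Ω → ℝ) :
    Set Ω :=
  {x | ENNReal.ofReal (threshold μ ℱ ν r f x) < doobMaxFrom μ ℱ ν f x}

theorem measurableSet_exceedSet (hν : IsStoppingTime ℱ ν) :
    MeasurableSet (exceedSet μ ℱ ν r f) :=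
  measurableSet_lt (measurable_threshold hν).ennreal_ofReal (measurable_doobMaxFrom hν f)

theorem stoppedPercentile_lt_top [IsFiniteMeasure μ] (hr : 0 ≤ r) (hM : ∀ᵐ x ∂μ, |f x| ≤ M) :
    ∀ᵐ x ∂μ, ∀ k : ℕ, ν x = k →
      stoppedPercentile μ ℱ ν r (doobMaxFrom μ ℱ ν f) x < ∞ := by
  have h1 : ∀ᵐ x ∂μ, doobMaxFrom μ ℱ ν f x ≤ M := by
    filter_upwards [ae_all_iff.2 fun n => abs_condExp_le (ℱ := ℱ) hM n] with x hx
    refine iSup₂_le fun k _ => ?_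
    rw [← ofReal_norm, ← ENNReal.ofReal_coe_nnreal]
    exact ENNReal.ofReal_le_ofReal (hx k)
  filter_upwards [ae_all_iff.2 fun k => condPercentile_lt_top (m := ℱ k) hr h1] with x hx k hk
  rw [stoppedPercentile_eq hk]
  exact hx k

theorem measurableSet_inter_threshold_eq (hν : IsStoppingTime ℱ ν) {k : ℕ} {A : Set Ω}
    (hA : MeasurableSet[ℱ k] A) (hAν : ∀ x ∈ A, ν x = k) (c : ℝ) :
    MeasurableSet[ℱ k] (A ∩ {x | threshold μ ℱ ν r f x = c}) := by
  have : A ∩ {x | threshold μ ℱ ν r f x = c} =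
      A ∩ {x | {x | ν x ≤ k}.indicator (threshold μ ℱ ν r f) x = c} := by
    ext x
    refine and_congr_right fun hx => ?_
    rw [mem_ofPred_eq, mem_ofPred_eq,
      indicator_of_mem (show x ∈ {x | ν x ≤ k} from (hAν x hx).le)]
  rw [this]
  exact hA.inter (measurable_indicator_threshold hν f k (measurableSet_singleton c))

/-- The exceptional set has conditional probability at most `r` at time `ν`. On a piece of
`{ν = k}` where the threshold has a fixed value, this is the definition of the percentile. -/
theorem measure_inter_exceedSet_le [IsFiniteMeasure μ] (hν : IsStoppingTime ℱ ν) (hr : 0 ≤ r)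
    (hM : ∀ᵐ x ∂μ, |f x| ≤ M) {k : ℕ} {A : Set Ω} (hA : MeasurableSet[ℱ k] A)
    (hAν : ∀ x ∈ A, ν x = k) :
    μ (A ∩ exceedSet μ ℱ ν r f) ≤ ENNReal.ofReal r * μ A := by
  have hg := measurable_doobMaxFrom (μ := μ) hν f
  refine measure_inter_le_of_forall_level (lam := threshold μ ℱ ν r f) countable_range_roundUp
    (fun x => ⟨_, rfl⟩)
    (fun c => ℱ.le k _ (measurableSet_inter_threshold_eq (μ := μ) (r := r) (f := f) hν hA hAν c))
    fun c => ?_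
  have hAc := measurableSet_inter_threshold_eq (μ := μ) (r := r) (f := f) hν hA hAν c
  set Ac := A ∩ {x | threshold μ ℱ ν r f x = c} with hAcdef
  have hset : Ac ∩ exceedSet μ ℱ ν r f =
      Ac ∩ {x | ENNReal.ofReal c < doobMaxFrom μ ℱ ν f x} := by
    ext x
    refine and_congr_right fun hx => ?_
    rw [exceedSet, mem_ofPred_eq, mem_ofPred_eq, show threshold μ ℱ ν r f x = c from hx.2]
  rw [hset]
  rcases le_or_gt c 0 with hc | hc
  · rw [ENNReal.ofReal_of_nonpos hc]
    refine measure_inter_pos_le (ℱ.le k) hg hr hAc ?_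
    filter_upwards [stoppedPercentile_lt_top (ν := ν) (ℱ := ℱ) hr hM] with x hx hxA
    have hlt := hx k (hAν x hxA.1)
    rw [← stoppedPercentile_eq (hAν x hxA.1)]
    by_contra hne
    have h1 := lt_roundUp (ENNReal.toReal_pos hne hlt.ne)
    have h2 : threshold μ ℱ ν r f x = c := hxA.2
    rw [threshold] at h2
    have h3 := ENNReal.toReal_nonneg (a := stoppedPercentile μ ℱ ν r (doobMaxFrom μ ℱ ν f) x)
    linarith
  · refine measure_inter_lt_le (ℱ.le k) hg hr hAc ?_
    filter_upwards [stoppedPercentile_lt_top (ν := ν) (ℱ := ℱ) hr hM] with x hx hxA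
    have hlt := hx k (hAν x hxA.1)
    rw [← stoppedPercentile_eq (hAν x hxA.1), ← ENNReal.ofReal_toReal hlt.ne]
    refine (ENNReal.ofReal_lt_ofReal_iff hc).2 ?_
    have h2 : threshold μ ℱ ν r f x = c := hxA.2
    rw [threshold] at h2
    rcases ENNReal.toReal_nonneg.eq_or_lt with h0 | h0
    · rwa [← h0]
    · rw [← h2]
      exact lt_roundUp h0

theorem mem_exceedSet {x : Ω} {n : ℕ} (hx : ν x ≤ n)
    (h : threshold μ ℱ ν r f x < |(μ[f | ℱ n]) x|) : x ∈ exceedSet μ ℱ ν r f := by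
  refine lt_of_lt_of_le ?_
    (le_iSup₂ (f := fun (k : ℕ) (_ : ν x ≤ k) => ‖(μ[f | ℱ k]) x‖ₑ) n hx)
  rw [← ofReal_norm]
  exact (ENNReal.ofReal_lt_ofReal_iff ((roundUp_nonneg _).trans_lt h)).2 h

theorem measurableSet_lt_abs_condExp (hν : IsStoppingTime ℱ ν) (k n : ℕ) (hkn : k ≤ n) :
    MeasurableSet[ℱ n] {x | ν x ≤ k ∧ threshold μ ℱ ν r f x < |(μ[f | ℱ n]) x|} := by
  have : {x | ν x ≤ k ∧ threshold μ ℱ ν r f x < |(μ[f | ℱ n]) x|} = {x | ν x ≤ k} ∩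
      {x | {x | ν x ≤ k}.indicator (threshold μ ℱ ν r f) x < |(μ[f | ℱ n]) x|} := by
    ext x
    refine and_congr_right fun hx => ?_
    rw [mem_ofPred_eq, indicator_of_mem (show x ∈ {x | ν x ≤ k} from hx)]
  rw [this]
  refine (ℱ.mono hkn _ (hν k)).inter (measurableSet_lt
    ((measurable_indicator_threshold hν f k).mono (ℱ.mono hkn) le_rfl) ?_)
  exact (stronglyMeasurable_condExp (μ := μ) (f := f) (m := ℱ n)).norm.measurable

/-- By regularity, the martingale stays below the threshold for one more step as long as the
conditional probability of the set `exceedSet` is less than `1 / R`. -/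
theorem abs_condExp_succ_le [IsFiniteMeasure μ] (hν : IsStoppingTime ℱ ν) (hR : 0 < R)
    (hreg : IsRegularFiltration μ ℱ R) :
    ∀ᵐ x ∂μ, ∀ n : ℕ, ν x ≤ n →
      (μ[(exceedSet μ ℱ ν r f).indicator (fun _ => (1 : ℝ)) | ℱ n]) x < 1 / R →
      |(μ[f | ℱ (n + 1)]) x| ≤ threshold μ ℱ ν r f x := by
  have hE := measurableSet_exceedSet (μ := μ) (r := r) (f := f) hν
  rw [ae_all_iff]
  intro n
  have h1 := one_le_condExp_indicator (μ := μ) (ℱ.le (n + 1))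
    (measurableSet_lt_abs_condExp (μ := μ) (r := r) (f := f) hν n (n + 1) (by omega)) hE
    (fun x hx => mem_exceedSet (hx.1.trans (Nat.cast_le.2 (by omega))) hx.2)
  have h2 := hreg _ (fun x => indicator_nonneg (fun _ _ => zero_le_one) x)
    ((integrable_const (1 : ℝ)).indicator hE) n
  filter_upwards [h1, h2] with x h1 h2 hx hlt
  by_contra! hgt
  have h3 := (h1 ⟨hx, hgt⟩).trans h2
  rw [lt_div_iff₀ hR] at hlt
  linarith

/-- At time `ν` the martingale is below the threshold: otherwise `exceedSet` would have conditional
probability one, which is more than `r`. -/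
theorem abs_condExp_le_threshold [IsFiniteMeasure μ] (hν : IsStoppingTime ℱ ν) (hr : 0 ≤ r)
    (hr1 : r < 1) (hM : ∀ᵐ x ∂μ, |f x| ≤ M) :
    ∀ᵐ x ∂μ, ∀ k : ℕ, ν x = k → |(μ[f | ℱ k]) x| ≤ threshold μ ℱ ν r f x := by
  rw [ae_all_iff]
  intro k
  set H := {x | ν x ≤ k ∧ threshold μ ℱ ν r f x < |(μ[f | ℱ k]) x|} ∩ {x | ν x = k} with hH
  have hHm : MeasurableSet[ℱ k] H :=
    (measurableSet_lt_abs_condExp hν k k le_rfl).inter (hν.measurableSet_eq k)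
  have h1 := measure_inter_exceedSet_le hν hr hM hHm fun x hx => hx.2
  rw [inter_eq_left.2 fun x hx => mem_exceedSet hx.1.1 hx.1.2] at h1
  have h0 : μ H = 0 := by
    by_contra hne
    have h2 : ENNReal.ofReal r * μ H < 1 * μ H :=
      ENNReal.mul_lt_mul_left hne (measure_ne_top μ H) (by simpa using hr1)
    rw [one_mul] at h2
    exact absurd h1 (not_le.2 h2)
  filter_upwards [measure_eq_zero_iff_ae_notMem.1 h0] with x hx hk
  by_contra! hgt
  exact hx ⟨⟨hk.le, hgt⟩, hk⟩

/-- The event of stopping at time `n`, after `ν`: the conditional probability of the set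
`exceedSet` has become large, or the energy since `ν` has become large. -/
def stopEvent (μ : Measure Ω) (ℱ : Filtration ℕ mΩ) (f : Ω → ℝ) (Z : ℕ → ℕ → Ω → ℝ) (R r C : ℝ)
    (ν : Ω → WithTop ℕ) (n : ℕ) : Set Ω :=
  {x | ν x ≤ n ∧
    (1 / R ≤ (μ[(exceedSet μ ℱ ν r f).indicator (fun _ => (1 : ℝ)) | ℱ n]) x ∨
      ∃ k ≤ n, ν x = k ∧ C * threshold μ ℱ ν r f x ^ 2 < Z k n x)}

theorem measurableSet_stopEvent (hν : IsStoppingTime ℱ ν) (hZ : IsControlled μ ℱ f Z) (C : ℝ)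
    (n : ℕ) : MeasurableSet[ℱ n] (stopEvent μ ℱ f Z R r C ν n) := by
  have : stopEvent μ ℱ f Z R r C ν n = {x | ν x ≤ n} ∩
      ({x | 1 / R ≤ (μ[(exceedSet μ ℱ ν r f).indicator (fun _ => (1 : ℝ)) | ℱ n]) x} ∪
        ⋃ k ≤ n, {x | ν x = k} ∩
          {x | C * {x | ν x ≤ n}.indicator (threshold μ ℱ ν r f) x ^ 2 < Z k n x}) := by
    ext x
    refine and_congr_right fun hx => or_congr_right ?_
    simp only [mem_iUnion, mem_inter_iff, mem_ofPred_eq, exists_prop,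
      indicator_of_mem (show x ∈ {x | ν x ≤ n} from hx)]
  rw [this]
  refine (hν n).inter (MeasurableSet.union ?_ ?_)
  · exact measurableSet_le measurable_const stronglyMeasurable_condExp.measurable
  · refine MeasurableSet.iUnion fun k => MeasurableSet.iUnion fun hk =>
      (ℱ.mono hk _ (hν.measurableSet_eq k)).inter (measurableSet_lt ?_ (hZ.measurable k n))
    exact ((measurable_indicator_threshold hν f n).pow_const 2).const_mul C

/-- The probability of stopping is small. Stopping because of `exceedSet` is controlled by the maximal
inequality, and stopping because of the energy by `mul_measure_iUnion_le`; the latter applies since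
the martingale is below the threshold until the time of stopping and, by regularity, at that time
too. -/
theorem measure_inter_firstTime_lt_top_le [IsFiniteMeasure μ] (hν : IsStoppingTime ℱ ν)
    (hZ : IsControlled μ ℱ f Z) (hR : 0 < R) (hreg : IsRegularFiltration μ ℱ R) (hr : 0 ≤ r)
    (hr1 : r < 1) (hM : ∀ᵐ x ∂μ, |f x| ≤ M) {C : ℝ} (hC : 0 < C) {k : ℕ} {A : Set Ω}
    (hA : MeasurableSet[ℱ k] A) (hAν : ∀ x ∈ A, ν x = k) :
    μ (A ∩ {x | firstTime (stopEvent μ ℱ f Z R r C ν) x < ⊤}) ≤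
      ENNReal.ofReal (R * r + C⁻¹) * μ A := by
  refine measure_inter_le_of_forall_level (lam := threshold μ ℱ ν r f) countable_range_roundUp
    (fun x => ⟨_, rfl⟩)
    (fun c => ℱ.le k _ (measurableSet_inter_threshold_eq (μ := μ) (r := r) (f := f) hν hA hAν c))
    fun c => ?_
  have hAc := measurableSet_inter_threshold_eq (μ := μ) (r := r) (f := f) hν hA hAν c
  set Ac := A ∩ {x | threshold μ ℱ ν r f x = c} with hAcdef
  set P := stopEvent μ ℱ f Z R r C ν with hP
  set E := exceedSet μ ℱ ν r f with hE
  have hPm : ∀ n, MeasurableSet[ℱ n] (P n) := measurableSet_stopEvent hν hZ C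
  have hτ := isStoppingTime_firstTime hPm
  have hνk : ∀ x ∈ Ac, ν x = k := fun x hx => hAν x hx.1
  have hle : ∀ x ∈ Ac, ∀ n : ℕ, firstTime P x = n → k ≤ n := by
    intro x hx n hn
    have h1 : ν x ≤ n := (mem_of_firstTime_eq hn).1
    rwa [hνk x hx, Nat.cast_le] at h1
  -- Stopping because the conditional probability of `E` is large.
  set B₁ : ℕ → Set Ω := fun n => Ac ∩ {x | firstTime P x = n} ∩
    {x | 1 / R ≤ (μ[E.indicator (fun _ => (1 : ℝ)) | ℱ n]) x} with hB₁
  have hB₁m : ∀ n, MeasurableSet[ℱ n] (B₁ n) := by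
    intro n
    have h1 : MeasurableSet[ℱ n] (Ac ∩ {x | firstTime P x = n}) := by
      by_cases hkn : k ≤ n
      · exact (ℱ.mono hkn _ hAc).inter (hτ.measurableSet_eq n)
      · have : Ac ∩ {x | firstTime P x = n} = ∅ :=
          eq_empty_of_forall_notMem fun x hx => hkn (hle x hx.1 n hx.2)
        rw [this]
        exact @MeasurableSet.empty Ω (ℱ n)
    exact h1.inter (measurableSet_le measurable_const stronglyMeasurable_condExp.measurable)
  have hU₁ : μ (⋃ n, B₁ n) ≤ ENNReal.ofReal (R * r) * μ Ac := by
    refine (measure_iUnion_le_of_le_condExp hR (measurableSet_exceedSet (μ := μ) hν) hB₁m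
      (fun n x hx => hx.1.1) ?_ fun n x hx => hx.2).trans ?_
    · intro n m hne
      refine disjoint_left.2 fun x hx hx' => hne ?_
      exact Nat.cast_injective ((show firstTime P x = n from hx.1.2).symm.trans hx'.1.2)
    · rw [ENNReal.ofReal_mul hR.le, mul_assoc]
      exact mul_le_mul_right (measure_inter_exceedSet_le hν hr hM hAc hνk) _
  -- Stopping because the energy is large.
  set B₂ : ℕ → Set Ω := fun i => Ac ∩ {x | firstTime P x ≤ (k + i : ℕ)}ᶜ with hB₂
  have hB₂m : ∀ i, MeasurableSet[ℱ (k + i)] (B₂ i) := fun i =>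
    (ℱ.mono (by omega) _ hAc).inter (hτ (k + i)).compl
  have hanti : ∀ i, B₂ (i + 1) ⊆ B₂ i := fun i x hx =>
    ⟨hx.1, fun h => hx.2 (le_trans (show firstTime P x ≤ (k + i : ℕ) from h)
      (Nat.cast_le.2 (by omega)))⟩
  have hnot : ∀ x ∈ Ac, ∀ n : ℕ, k ≤ n → ¬ firstTime P x ≤ n →
      (μ[E.indicator (fun _ => (1 : ℝ)) | ℱ n]) x < 1 / R := by
    intro x hx n hkn hn
    have h1 := notMem_of_lt_firstTime (not_le.1 hn)
    by_contra! h2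
    refine h1 ⟨?_, Or.inl h2⟩
    rw [hνk x hx, Nat.cast_le]
    exact hkn
  have hc : ∀ i, ∀ᵐ x ∂μ, x ∈ B₂ i →
      |(μ[f | ℱ (k + i)]) x| ≤ c ∧ |(μ[f | ℱ (k + i + 1)]) x| ≤ c := by
    intro i
    filter_upwards [abs_condExp_succ_le (r := r) (f := f) hν hR hreg,
      abs_condExp_le_threshold hν hr hr1 hM] with x h1 h2 hx
    have hxc : threshold μ ℱ ν r f x = c := hx.1.2
    have hxk := hνk x hx.1
    have hstep : ∀ j ≤ i, |(μ[f | ℱ (k + j + 1)]) x| ≤ c := by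
      intro j hj
      rw [← hxc]
      refine h1 (k + j) (by rw [hxk, Nat.cast_le]; omega) (hnot x hx.1 _ (by omega) fun h => ?_)
      exact hx.2 (h.trans (Nat.cast_le.2 (by omega)))
    refine ⟨?_, hstep i le_rfl⟩
    cases i with
    | zero =>
      rw [← hxc]
      exact h2 k hxk
    | succ i => exact hstep i (by omega)
  have hU₂ := mul_measure_iUnion_le hZ hM k hB₂m hanti hc hC
  set G := ⋃ i, {x ∈ B₂ i \ B₂ (i + 1) | C * c ^ 2 < Z k (k + i + 1) x} with hG
  have hU₂' : μ G ≤ ENNReal.ofReal C⁻¹ * μ Ac := by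
    rw [ENNReal.ofReal_inv_of_pos hC, ← ENNReal.div_eq_inv_mul,
      ENNReal.le_div_iff_mul_le (by simp [hC]) (by simp), mul_comm]
    exact hU₂.trans (measure_mono inter_subset_left)
  have hsub : Ac ∩ {x | firstTime P x < ⊤} ⊆ (⋃ n, B₁ n) ∪ G := by
    rintro x ⟨hx, hfin⟩
    obtain ⟨n, hn⟩ := exists_eq_of_ne_top (show firstTime P x < ⊤ from hfin).ne
    have hkn := hle x hx n hn
    rcases (mem_of_firstTime_eq hn).2 with h | ⟨k', hk', hνk', h⟩
    · exact Or.inl (mem_iUnion.2 ⟨n, ⟨hx, hn⟩, h⟩)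
    · have hkk : k' = k := Nat.cast_injective (hνk'.symm.trans (hνk x hx))
      subst hkk
      rw [show threshold μ ℱ ν r f x = c from hx.2] at h
      have hne : k' ≠ n := by
        rintro rfl
        rw [hZ.self] at h
        have := mul_nonneg hC.le (sq_nonneg c)
        linarith
      obtain ⟨i, rfl⟩ : ∃ i, n = k' + i + 1 := ⟨n - k' - 1, by omega⟩
      refine Or.inr (mem_iUnion.2 ⟨i, ⟨⟨hx, fun h' => ?_⟩, fun h' => h'.2 ?_⟩, h⟩)
      · have h'' : firstTime P x ≤ (k' + i : ℕ) := h'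
        rw [hn, Nat.cast_le] at h''
        omega
      · exact hn.le
  calc μ (Ac ∩ {x | firstTime P x < ⊤}) ≤ μ (⋃ n, B₁ n) + μ G :=
        (measure_mono hsub).trans (measure_union_le _ _)
    _ ≤ ENNReal.ofReal (R * r) * μ Ac + ENNReal.ofReal C⁻¹ * μ Ac := add_le_add hU₁ hU₂'
    _ = _ := by rw [← add_mul, ← ENNReal.ofReal_add (by positivity) (by positivity)]

/-- Up to and including the time of stopping, the process is controlled by the threshold: before that
time by definition, and the last jump is at most twice the threshold by regularity. -/
theorem sqrt_le_threshold [IsFiniteMeasure μ] (hν : IsStoppingTime ℱ ν)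
    (hZ : IsControlled μ ℱ f Z) (hR : 0 < R) (hreg : IsRegularFiltration μ ℱ R) (hr : 0 ≤ r)
    (hr1 : r < 1) (hM : ∀ᵐ x ∂μ, |f x| ≤ M) {C : ℝ} (hC : 0 ≤ C) :
    ∀ᵐ x ∂μ, ∀ k n : ℕ, ν x = k → k ≤ n → n ≤ firstTime (stopEvent μ ℱ f Z R r C ν) x →
      √(Z k n x) ≤ (√C + 2) * threshold μ ℱ ν r f x := by
  have hsq : ∀ᵐ x ∂μ, ∀ k n, k ≤ n →
      √(Z k (n + 1) x) ≤ √(Z k n x) + |(μ[f | ℱ (n + 1)]) x - (μ[f | ℱ n]) x| := by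
    simp only [ae_all_iff]
    exact hZ.sqrt_succ_le
  filter_upwards [abs_condExp_succ_le (r := r) (f := f) hν hR hreg,
    abs_condExp_le_threshold hν hr hr1 hM, hsq] with x h1 h2 h3 k n hk hkn hn
  set c := threshold μ ℱ ν r f x with hc
  have hc0 : 0 ≤ c := roundUp_nonneg _
  rcases hkn.eq_or_lt with rfl | hlt
  · rw [hZ.self, Real.sqrt_zero]
    positivity
  obtain ⟨j, rfl⟩ : ∃ j, n = j + 1 := ⟨n - 1, by omega⟩
  have hnot : ∀ i ≤ j, x ∉ stopEvent μ ℱ f Z R r C ν i := fun i hi =>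
    notMem_of_lt_firstTime (lt_of_lt_of_le (Nat.cast_lt.2 (by omega)) hn)
  have hstep : ∀ i, k ≤ i → i ≤ j → |(μ[f | ℱ (i + 1)]) x| ≤ c := by
    intro i hki hij
    have hki' : ν x ≤ i := by rw [hk, Nat.cast_le]; exact hki
    refine h1 i hki' ?_
    by_contra! h
    exact hnot i hij ⟨hki', Or.inl h⟩
  have hj : |(μ[f | ℱ j]) x| ≤ c := by
    rcases (show k ≤ j by omega).eq_or_lt with rfl | hlt'
    · exact h2 _ hk
    · obtain ⟨i, rfl⟩ : ∃ i, j = i + 1 := ⟨j - 1, by omega⟩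
      exact hstep i (by omega) (by omega)
  have hZj : Z k j x ≤ C * c ^ 2 := by
    by_contra! h
    exact hnot j le_rfl ⟨by rw [hk, Nat.cast_le]; omega, Or.inr ⟨k, by omega, hk, h⟩⟩
  have h4 : √(Z k j x) ≤ √C * c := by
    refine (Real.sqrt_le_sqrt hZj).trans (le_of_eq ?_)
    rw [Real.sqrt_mul hC, Real.sqrt_sq hc0]
  calc √(Z k (j + 1) x) ≤ √(Z k j x) + |(μ[f | ℱ (j + 1)]) x - (μ[f | ℱ j]) x| :=
        h3 k j (by omega)
    _ ≤ √C * c + (|(μ[f | ℱ (j + 1)]) x| + |(μ[f | ℱ j]) x|) := add_le_add h4 (abs_sub _ _)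
    _ ≤ √C * c + (c + c) := by
        gcongr
        exact hstep j (by omega) le_rfl
    _ = (√C + 2) * c := by ring

/-- The constant in the pointwise bound of one step of the stopping procedure. -/
noncomputable def martConst (R : ℝ) : ℝ := (√(2 * (R + 3) / 3) + 2) * 2

/-- One step of the stopping procedure, from `ν` to `ν'`. The energy level is a multiple
`2 (R + 3) / 3` of the squared threshold, so that the probability of stopping is at most
`R r + 3 / (2 (R + 3)) = 1 / 2`. -/
theorem exists_next_stoppingTime [IsFiniteMeasure μ] (hν : IsStoppingTime ℱ ν)
    (hZ : IsControlled μ ℱ f Z) (hR : 0 < R) (hreg : IsRegularFiltration μ ℱ R)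
    (hM : ∀ᵐ x ∂μ, |f x| ≤ M) (hr : r = 1 / (2 * (R + 3))) :
    ∃ ν' : Ω → WithTop ℕ, IsStoppingTime ℱ ν' ∧ (∀ x, ν x ≤ ν' x) ∧
      (∀ A : Set Ω, MeasurableSet[hν.measurableSpace] A → A ⊆ {x | ν x < ⊤} →
        μ (A ∩ {x | ν' x < ⊤}) ≤ 2⁻¹ * μ A) ∧
      ∀ᵐ x ∂μ, ∀ k : ℕ, ν x = k →
        ‖(μ[f | ℱ k]) x‖ₑ ≤ ENNReal.ofReal (martConst R) *
          stoppedPercentile μ ℱ ν r (doobMaxFrom μ ℱ ν f) x ∧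
        ∀ n : ℕ, k ≤ n → n ≤ ν' x → ENNReal.ofReal √(Z k n x) ≤ ENNReal.ofReal (martConst R) *
          stoppedPercentile μ ℱ ν r (doobMaxFrom μ ℱ ν f) x := by
  have hr0 : 0 ≤ r := by rw [hr]; positivity
  have hr1 : r < 1 := by rw [hr, div_lt_one (by positivity)]; linarith
  set C := 2 * (R + 3) / 3 with hC
  have hC0 : 0 < C := by positivity
  have hhalf : R * r + C⁻¹ = 2⁻¹ := by
    rw [hr, hC]
    field_simp
  refine ⟨firstTime (stopEvent μ ℱ f Z R r C ν),
    isStoppingTime_firstTime (measurableSet_stopEvent hν hZ C), fun x => ?_, fun A hA hAfin => ?_, ?_⟩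
  · by_cases hx : firstTime (stopEvent μ ℱ f Z R r C ν) x = ⊤
    · rw [hx]
      exact le_top
    · obtain ⟨n, hn⟩ := exists_eq_of_ne_top hx
      rw [hn]
      exact (mem_of_firstTime_eq hn).1
  · set N := {x | firstTime (stopEvent μ ℱ f Z R r C ν) x < ⊤}
    have hAk : ∀ k : ℕ, MeasurableSet[ℱ k] (A ∩ {x | ν x = k}) := fun k =>
      (hν.measurableSet_inter_eq_iff A k).1
        (MeasurableSet.inter hA (hν.measurableSet_eq' k))
    have hU : A = ⋃ k : ℕ, A ∩ {x | ν x = k} := by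
      ext x
      simp only [mem_iUnion, mem_inter_iff, mem_ofPred_eq]
      refine ⟨fun hx => ?_, fun ⟨_, hx, _⟩ => hx⟩
      obtain ⟨k, hk⟩ := exists_eq_of_ne_top (show ν x < ⊤ from hAfin hx).ne
      exact ⟨k, hx, hk⟩
    have hd : Pairwise (Function.onFun Disjoint fun k : ℕ => A ∩ {x | ν x = k}) := by
      intro k k' hne
      refine disjoint_left.2 fun x hx hx' => hne ?_
      exact Nat.cast_injective ((show ν x = k from hx.2).symm.trans hx'.2)
    have hinv : ENNReal.ofReal 2⁻¹ = 2⁻¹ := by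
      rw [ENNReal.ofReal_inv_of_pos (by norm_num), ENNReal.ofReal_ofNat]
    calc μ (A ∩ N) = μ (⋃ k : ℕ, (A ∩ {x | ν x = k}) ∩ N) := by
          rw [← iUnion_inter, ← hU]
      _ ≤ ∑' k : ℕ, μ ((A ∩ {x | ν x = k}) ∩ N) := measure_iUnion_le _
      _ ≤ ∑' k : ℕ, 2⁻¹ * μ (A ∩ {x | ν x = k}) := by
          refine ENNReal.tsum_le_tsum fun k => ?_
          have := measure_inter_firstTime_lt_top_le hν hZ hR hreg hr0 hr1 hM hC0 (hAk k)
            fun x hx => hx.2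
          rwa [hhalf, hinv] at this
      _ = 2⁻¹ * μ A := by
          rw [ENNReal.tsum_mul_left, ← measure_iUnion hd fun k => ℱ.le k _ (hAk k), ← hU]
  · filter_upwards [sqrt_le_threshold hν hZ hR hreg hr0 hr1 hM hC0.le,
      abs_condExp_le_threshold hν hr0 hr1 hM] with x h1 h2 k hk
    set t := stoppedPercentile μ ℱ ν r (doobMaxFrom μ ℱ ν f) x with ht
    have hs : 1 ≤ √C + 2 := by linarith [Real.sqrt_nonneg C]
    have hc0 : 0 ≤ threshold μ ℱ ν r f x := roundUp_nonneg _
    have hbound : ENNReal.ofReal ((√C + 2) * threshold μ ℱ ν r f x) ≤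
        ENNReal.ofReal (martConst R) * t := by
      have h3 : (√C + 2) * threshold μ ℱ ν r f x ≤ martConst R * t.toReal := by
        have h4 : threshold μ ℱ ν r f x ≤ 2 * t.toReal := roundUp_le ENNReal.toReal_nonneg
        calc _ ≤ (√C + 2) * (2 * t.toReal) := by gcongr
          _ = _ := by rw [martConst]; ring
      refine (ENNReal.ofReal_le_ofReal h3).trans ?_
      rw [ENNReal.ofReal_mul (by unfold martConst; positivity)]
      gcongr
      exact ENNReal.ofReal_toReal_le
    refine ⟨le_trans ?_ hbound, fun n hkn hn => (ENNReal.ofReal_le_ofReal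
      (h1 k n hk hkn hn)).trans hbound⟩
    rw [← ofReal_norm]
    refine ENNReal.ofReal_le_ofReal ((h2 k hk).trans ?_)
    exact le_mul_of_one_le_left hc0 hs

end Step

end CancellativeSparse

namespace CancellativeSparse

/-! ### Sparse domination for regular filtrations -/

section Iteration

/-- Summation of one-step bounds along an increasing sequence of times that reaches infinity. -/
theorem le_two_mul_tsum_of_steps {q b : ℕ → ℝ≥0∞} {N : ℕ → WithTop ℕ} (hN0 : N 0 = 0)
    (h0 : q 0 ≤ b 0)
    (hstep : ∀ j k l : ℕ, N j = k → k ≤ l → l ≤ N (j + 1) → q l ≤ q k + b j)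
    (htop : ∃ J, N J = ⊤) (l : ℕ) : q l ≤ 2 * ∑' j, b j := by
  have key : ∀ j (l : ℕ), l ≤ N j → q l ≤ b 0 + ∑ i ∈ Finset.range j, b i := by
    intro j
    induction j with
    | zero =>
      intro l hl
      rw [hN0, ← Nat.cast_zero, Nat.cast_le, Nat.le_zero] at hl
      simpa [hl] using h0
    | succ j ih =>
      intro l hl
      by_cases hlj : (l : WithTop ℕ) ≤ N j
      · refine (ih l hlj).trans ?_
        gcongr
        simp
      · obtain ⟨k, hk⟩ := exists_eq_of_ne_top (not_le.1 hlj).ne_top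
        have hkl : k ≤ l := by
          rw [hk, not_le, Nat.cast_lt] at hlj
          exact hlj.le
        calc q l ≤ q k + b j := hstep j k l hk hkl hl
          _ ≤ (b 0 + ∑ i ∈ Finset.range j, b i) + b j := by
              gcongr
              exact ih k hk.ge
          _ = b 0 + ∑ i ∈ Finset.range (j + 1), b i := by rw [Finset.sum_range_succ, add_assoc]
  obtain ⟨J, hJ⟩ := htop
  calc q l ≤ b 0 + ∑ i ∈ Finset.range J, b i := key J l (by rw [hJ]; exact le_top)
    _ ≤ ∑' j, b j + ∑' j, b j := add_le_add (ENNReal.le_tsum 0) (ENNReal.sum_le_tsum _)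
    _ = 2 * ∑' j, b j := (two_mul _).symm

variable {Ω : Type u} {mΩ : MeasurableSpace Ω} {μ : Measure Ω} {ℱ : Filtration ℕ mΩ}
  {r R : ℝ} {f : Ω → ℝ} {M : ℝ≥0} {Z : ℕ → ℕ → Ω → ℝ}

/-- Along a sparse sequence, the sets `{ν_j < ∞}` have geometrically decaying measure. -/
theorem IsSparseStoppingSeq.ae_exists_eq_top [IsFiniteMeasure μ] {ν : ℕ → Ω → WithTop ℕ}
    (h : IsSparseStoppingSeq μ ℱ ν) : ∀ᵐ x ∂μ, ∃ J, ν J x = ⊤ := by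
  have hle : ∀ j, μ {x | ν j x < ⊤} ≤ 2⁻¹ ^ j * μ univ := by
    intro j
    induction j with
    | zero => simpa using measure_mono (subset_univ _)
    | succ j ih =>
      have hm : MeasurableSet[(h.isStoppingTime j).measurableSpace] {x | ν j x < ⊤} :=
        measurableSet_lt (h.isStoppingTime j).measurable measurable_const
      have h1 := h.sparse j _ hm subset_rfl
      have h2 : {x | ν (j + 1) x < ⊤} ⊆ {x | ν j x < ⊤} := fun x hx =>
        (h.increasing j x).trans_lt (show ν (j + 1) x < ⊤ from hx)
      rw [inter_eq_right.2 h2] at h1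
      calc _ ≤ 2⁻¹ * μ {x | ν j x < ⊤} := h1
        _ ≤ 2⁻¹ * (2⁻¹ ^ j * μ univ) := by gcongr
        _ = _ := by rw [pow_succ', mul_assoc]
  have hlim : Tendsto (fun j : ℕ => (2⁻¹ : ℝ≥0∞) ^ j * μ univ) atTop (nhds 0) := by
    have := ENNReal.Tendsto.mul_const (b := μ univ)
      (ENNReal.tendsto_pow_atTop_nhds_zero_of_lt_one (r := 2⁻¹) (by simp))
      (Or.inr (measure_ne_top μ univ))
    rwa [zero_mul] at this
  have h0 : μ {x | ∀ J, ν J x < ⊤} = 0 := le_antisymm (ge_of_tendsto' hlim fun j =>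
    (measure_mono fun x (hx : ∀ J, ν J x < ⊤) => hx j).trans (hle j)) zero_le
  filter_upwards [measure_eq_zero_iff_ae_notMem.1 h0] with x hx
  by_contra! hne
  exact hx fun J => lt_top_iff_ne_top.2 (hne J)

/-- The iteration of `exists_next_stoppingTime`, from the stopping time `0` on. -/
theorem exists_sparseStoppingSeq [IsFiniteMeasure μ] (hZ : IsControlled μ ℱ f Z) (hR : 0 < R)
    (hreg : IsRegularFiltration μ ℱ R) (hM : ∀ᵐ x ∂μ, |f x| ≤ M)
    (hr : r = 1 / (2 * (R + 3))) :
    ∃ ν : ℕ → Ω → WithTop ℕ, IsSparseStoppingSeq μ ℱ ν ∧ (∀ x, ν 0 x = 0) ∧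
      ∀ᵐ x ∂μ, ∀ j k : ℕ, ν j x = k →
        ‖(μ[f | ℱ k]) x‖ₑ ≤ ENNReal.ofReal (martConst R) *
          stoppedPercentile μ ℱ (ν j) r (doobMaxFrom μ ℱ (ν j) f) x ∧
        ∀ n : ℕ, k ≤ n → n ≤ ν (j + 1) x →
          ENNReal.ofReal √(Z k n x) ≤ ENNReal.ofReal (martConst R) *
            stoppedPercentile μ ℱ (ν j) r (doobMaxFrom μ ℱ (ν j) f) x := by
  choose next h1 h2 h3 h4 using fun ν : {ν : Ω → WithTop ℕ // IsStoppingTime ℱ ν} =>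
    exists_next_stoppingTime ν.2 hZ hR hreg hM hr
  let seq : ℕ → {ν : Ω → WithTop ℕ // IsStoppingTime ℱ ν} := fun j =>
    Nat.rec ⟨fun _ => ((0 : ℕ) : WithTop ℕ), isStoppingTime_const ℱ 0⟩
      (fun _ ν => ⟨next ν, h1 ν⟩) j
  exact ⟨fun j => (seq j).1, ⟨fun j => (seq j).2, fun j => h2 (seq j), fun j => h3 (seq j)⟩,
    fun _ => rfl, ae_all_iff.2 fun j => h4 (seq j)⟩

end Iteration

section Examples

variable {Ω : Type u} {mΩ : MeasurableSpace Ω} {μ : Measure Ω} {ℱ : Filtration ℕ mΩ}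
  {f : Ω → ℝ} {M : ℝ≥0} {σ : ℕ → Ω → ℝ}

theorem measurable_martDiff (f : Ω → ℝ) {m n : ℕ} (hmn : m ≤ n) :
    Measurable[ℱ n] (martDiff μ ℱ f m) := by
  cases m with
  | zero => exact measurable_condExp_filtration f hmn
  | succ m =>
    exact (measurable_condExp_filtration f hmn).sub
      (measurable_condExp_filtration f ((Nat.le_succ m).trans hmn))

theorem abs_martDiff_le (hM : ∀ᵐ x ∂μ, |f x| ≤ M) (m : ℕ) :
    ∀ᵐ x ∂μ, |martDiff μ ℱ f m x| ≤ 2 * M := by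
  have hM0 : (0 : ℝ) ≤ M := M.2
  cases m with
  | zero =>
    filter_upwards [abs_condExp_le (ℱ := ℱ) hM 0] with x hx
    exact hx.trans (by linarith)
  | succ m =>
    filter_upwards [abs_condExp_le (ℱ := ℱ) hM m, abs_condExp_le (ℱ := ℱ) hM (m + 1)] with x h1 h2
    calc |(μ[f | ℱ (m + 1)]) x - (μ[f | ℱ m]) x| ≤ _ := abs_sub _ _
      _ ≤ 2 * M := by linarith

/-- Martingale differences are orthogonal to the past. -/
theorem setIntegral_mul_martDiff_eq_zero [IsFiniteMeasure μ] {n : ℕ} {Y : Ω → ℝ} (hY : Measurable[ℱ n] Y) {K : ℝ}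
    (hK : ∀ᵐ x ∂μ, |Y x| ≤ K) {B : Set Ω} (hB : MeasurableSet[ℱ n] B) :
    ∫ x in B, Y x * martDiff μ ℱ f (n + 1) x ∂μ = 0 := by
  have hd : Integrable (martDiff μ ℱ f (n + 1)) μ := integrable_condExp.sub integrable_condExp
  have hYs : StronglyMeasurable[ℱ n] Y := hY.stronglyMeasurable
  have hi : Integrable (Y * martDiff μ ℱ f (n + 1)) μ :=
    hd.bdd_mul (hYs.mono (ℱ.le n)).aestronglyMeasurable hK
  have h0 : μ[martDiff μ ℱ f (n + 1) | ℱ n] =ᵐ[μ] 0 := by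
    have h1 := condExp_sub (μ := μ) (integrable_condExp (f := f) (m := ℱ (n + 1)))
      (integrable_condExp (f := f) (m := ℱ n)) (ℱ n)
    have h2 := condExp_condExp_of_le (μ := μ) (f := f) (ℱ.mono (Nat.le_succ n)) (ℱ.le (n + 1))
    have h3 := condExp_condExp_of_le (μ := μ) (f := f) (le_refl (ℱ n)) (ℱ.le n)
    refine h1.trans ?_
    filter_upwards [h2, h3] with x h2 h3
    rw [Pi.sub_apply, Pi.zero_apply, h3]
    exact sub_eq_zero.2 h2
  have h1 := condExp_mul_of_stronglyMeasurable_left hYs hi hd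
  have h2 := setIntegral_condExp (ℱ.le n) hi hB
  calc _ = ∫ x in B, (Y * martDiff μ ℱ f (n + 1)) x ∂μ := rfl
    _ = ∫ x in B, (μ[Y * martDiff μ ℱ f (n + 1) | ℱ n]) x ∂μ := h2.symm
    _ = ∫ x in B, (0 : ℝ) ∂μ := by
        refine setIntegral_congr_ae (ℱ.le n _ hB) ?_
        filter_upwards [h1, h0] with x h1 h0 _
        rw [h1, Pi.mul_apply, h0, Pi.zero_apply, mul_zero]
    _ = 0 := integral_zero _ _

theorem integrable_martDiff_sq [IsFiniteMeasure μ] (hM : ∀ᵐ x ∂μ, |f x| ≤ M) (m : ℕ) :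
    Integrable (fun x => martDiff μ ℱ f m x ^ 2) μ := by
  refine Integrable.of_bound (C := (2 * M : ℝ) ^ 2)
    (((measurable_martDiff f le_rfl).mono (ℱ.le m) le_rfl).pow_const 2).aestronglyMeasurable ?_
  filter_upwards [abs_martDiff_le (ℱ := ℱ) hM m] with x hx
  rw [Real.norm_eq_abs, abs_pow]
  exact pow_le_pow_left₀ (abs_nonneg _) hx 2

/-- The energy of a martingale difference is the gain of energy of the martingale. -/
theorem setIntegral_martDiff_sq [IsFiniteMeasure μ]
    (hM : ∀ᵐ x ∂μ, |f x| ≤ M) {n : ℕ} {B : Set Ω} (hB : MeasurableSet[ℱ n] B) :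
    ∫ x in B, martDiff μ ℱ f (n + 1) x ^ 2 ∂μ =
      ∫ x in B, ((μ[f | ℱ (n + 1)]) x ^ 2 - (μ[f | ℱ n]) x ^ 2) ∂μ := by
  have h0 := setIntegral_mul_martDiff_eq_zero (f := f)
    ((measurable_condExp_filtration (μ := μ) f (le_refl n)).const_mul 2) (K := 2 * M) (by
      filter_upwards [abs_condExp_le (ℱ := ℱ) hM n] with x hx
      rw [abs_mul, abs_two]
      linarith) hB
  have hi1 := (integrable_martDiff_sq (ℱ := ℱ) hM (n + 1)).integrableOn (s := B)
  have hi2 : IntegrableOn (fun x => (μ[f | ℱ (n + 1)]) x ^ 2 - (μ[f | ℱ n]) x ^ 2) B μ :=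
    ((integrable_condExp_sq hM (n + 1)).sub (integrable_condExp_sq hM n)).integrableOn
  rw [← sub_eq_zero, ← integral_sub hi1 hi2, ← neg_eq_zero, ← integral_neg, ← h0]
  refine integral_congr_ae (ae_of_all _ fun x => ?_)
  simp only [martDiff, Pi.sub_apply]
  ring

/-- The part of a martingale transform between the times `k` and `n`. -/
noncomputable def transformIncrement (μ : Measure Ω) (ℱ : Filtration ℕ mΩ) (σ : ℕ → Ω → ℝ) (f : Ω → ℝ)
    (k n : ℕ) (x : Ω) : ℝ :=
  ∑ m ∈ Finset.Ioc k n, σ m x * martDiff μ ℱ f m x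

theorem measurable_transformIncrement (hσ : IsTransformMultiplier μ ℱ σ) (f : Ω → ℝ) (k n : ℕ) :
    Measurable[ℱ n] (transformIncrement μ ℱ σ f k n) := by
  refine Finset.measurable_sum _ fun m hm => ?_
  have hmn := (Finset.mem_Ioc.1 hm).2
  exact ((hσ m).1.mono (ℱ.mono (by omega)) le_rfl).mul (measurable_martDiff f hmn)

theorem abs_transformIncrement_le (hσ : IsTransformMultiplier μ ℱ σ)
    (hM : ∀ᵐ x ∂μ, |f x| ≤ M) (k n : ℕ) :
    ∀ᵐ x ∂μ, |transformIncrement μ ℱ σ f k n x| ≤ (Finset.Ioc k n).card * (2 * M) := by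
  filter_upwards [ae_all_iff.2 fun m => (hσ m).2,
    ae_all_iff.2 fun m => abs_martDiff_le (ℱ := ℱ) hM m] with x h1 h2
  calc _ ≤ ∑ m ∈ Finset.Ioc k n, |σ m x * martDiff μ ℱ f m x| := Finset.abs_sum_le_sum_abs _ _
    _ ≤ ∑ _m ∈ Finset.Ioc k n, 2 * (M : ℝ) := by
        refine Finset.sum_le_sum fun m _ => ?_
        rw [abs_mul]
        exact (mul_le_of_le_one_left (abs_nonneg _) (h1 m)).trans (h2 m)
    _ = _ := by rw [Finset.sum_const, nsmul_eq_mul]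

theorem transformIncrement_succ {k n : ℕ} (hkn : k ≤ n) (x : Ω) :
    transformIncrement μ ℱ σ f k (n + 1) x =
      transformIncrement μ ℱ σ f k n x + σ (n + 1) x * martDiff μ ℱ f (n + 1) x := by
  rw [transformIncrement, Finset.sum_Ioc_succ_top (by omega), transformIncrement]

/-- By orthogonality, the squared increments of a martingale transform have no more energy than the
martingale. -/
theorem isControlled_transformIncrement_sq [IsFiniteMeasure μ]
    (hσ : IsTransformMultiplier μ ℱ σ) (hM : ∀ᵐ x ∂μ, |f x| ≤ M) :
    IsControlled μ ℱ f fun k n x => transformIncrement μ ℱ σ f k n x ^ 2 := by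
  have hint : ∀ k n, Integrable (fun x => transformIncrement μ ℱ σ f k n x ^ 2) μ := by
    intro k n
    refine Integrable.of_bound (C := ((Finset.Ioc k n).card * (2 * M : ℝ)) ^ 2)
      (((measurable_transformIncrement hσ f k n).mono (ℱ.le n) le_rfl).pow_const
        2).aestronglyMeasurable ?_
    filter_upwards [abs_transformIncrement_le hσ hM k n] with x hx
    rw [Real.norm_eq_abs, abs_pow]
    exact pow_le_pow_left₀ (abs_nonneg _) hx 2
  refine ⟨fun k n => (measurable_transformIncrement hσ f k n).pow_const 2, hint,
    fun _ _ _ => sq_nonneg _, fun k x => by simp [transformIncrement], fun k n hkn => ?_,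
    fun k n hkn B hB => ?_⟩
  · filter_upwards [(hσ (n + 1)).2] with x hx
    rw [Real.sqrt_sq_eq_abs, Real.sqrt_sq_eq_abs, transformIncrement_succ hkn]
    refine (abs_add_le _ _).trans (add_le_add_right ?_ _)
    rw [abs_mul]
    exact mul_le_of_le_one_left (abs_nonneg _) hx
  · rw [← setIntegral_martDiff_sq hM hB]
    have h0 := setIntegral_mul_martDiff_eq_zero (f := f) (n := n)
      (Y := fun x => 2 * transformIncrement μ ℱ σ f k n x * σ (n + 1) x)
      (((measurable_transformIncrement hσ f k n).const_mul 2).mul (hσ (n + 1)).1)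
      (K := 2 * ((Finset.Ioc k n).card * (2 * M))) (by
        filter_upwards [abs_transformIncrement_le hσ hM k n, (hσ (n + 1)).2] with x h1 h2
        rw [abs_mul, abs_mul, abs_two]
        refine (mul_le_of_le_one_right (by positivity) h2).trans ?_
        linarith) hB
    have hi0 := (hint k (n + 1)).integrableOn (s := B)
    have hi1 := (hint k n).integrableOn (s := B)
    have hi2 := (integrable_martDiff_sq (ℱ := ℱ) hM (n + 1)).integrableOn (s := B)
    have hi3 : IntegrableOn (fun x => 2 * transformIncrement μ ℱ σ f k n x * σ (n + 1) x *
        martDiff μ ℱ f (n + 1) x) B μ := by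
      refine (Integrable.bdd_mul (c := 2 * ((Finset.Ioc k n).card * (2 * M)))
        (integrable_condExp.sub integrable_condExp) ?_ ?_).integrableOn
      · exact (((((measurable_transformIncrement hσ f k n).const_mul 2).mul
          (hσ (n + 1)).1)).mono (ℱ.le n) le_rfl).aestronglyMeasurable
      · filter_upwards [abs_transformIncrement_le hσ hM k n, (hσ (n + 1)).2] with x h1 h2
        rw [Real.norm_eq_abs, abs_mul, abs_mul, abs_two]
        refine (mul_le_of_le_one_right (by positivity) h2).trans ?_
        linarith
    have hi4 : IntegrableOn (fun x => transformIncrement μ ℱ σ f k n x ^ 2 +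
        martDiff μ ℱ f (n + 1) x ^ 2) B μ := hi1.add hi2
    rw [← add_zero ((∫ x in B, transformIncrement μ ℱ σ f k n x ^ 2 ∂μ) + _), ← h0,
      ← integral_add hi1 hi2, ← integral_add hi4 hi3]
    refine integral_mono_ae hi0 (hi4.add hi3) (ae_restrict_of_ae ?_)
    filter_upwards [(hσ (n + 1)).2] with x hx
    have hσ2 : σ (n + 1) x ^ 2 ≤ 1 := (sq_le_one_iff_abs_le_one _).2 hx
    simp only [transformIncrement_succ hkn]
    nlinarith [mul_le_mul_of_nonneg_right hσ2 (sq_nonneg (martDiff μ ℱ f (n + 1) x))]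

/-- The energy of the martingale differences between the times `k` and `n`. -/
noncomputable def squareIncrement (μ : Measure Ω) (ℱ : Filtration ℕ mΩ) (f : Ω → ℝ) (k n : ℕ) (x : Ω) : ℝ :=
  ∑ m ∈ Finset.Ioc k n, martDiff μ ℱ f m x ^ 2

theorem squareIncrement_succ {k n : ℕ} (hkn : k ≤ n) (x : Ω) :
    squareIncrement μ ℱ f k (n + 1) x =
      squareIncrement μ ℱ f k n x + martDiff μ ℱ f (n + 1) x ^ 2 := by
  rw [squareIncrement, Finset.sum_Ioc_succ_top (by omega), squareIncrement]

/-- The sums of squares of martingale differences have exactly the energy of the martingale. -/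
theorem isControlled_squareIncrement [IsFiniteMeasure μ]
    (hM : ∀ᵐ x ∂μ, |f x| ≤ M) : IsControlled μ ℱ f (squareIncrement μ ℱ f) := by
  have hint : ∀ k n, Integrable (squareIncrement μ ℱ f k n) μ := fun k n =>
    integrable_finsetSum _ fun m _ => integrable_martDiff_sq hM m
  have hnn : ∀ k n x, 0 ≤ squareIncrement μ ℱ f k n x := fun k n x =>
    Finset.sum_nonneg fun _ _ => sq_nonneg _
  refine ⟨fun k n => Finset.measurable_sum _ fun m hm =>
      (measurable_martDiff f (Finset.mem_Ioc.1 hm).2).pow_const 2, hint, hnn,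
    fun k x => by simp [squareIncrement], fun k n hkn => ae_of_all _ fun x => ?_,
    fun k n hkn B hB => ?_⟩
  · rw [squareIncrement_succ hkn]
    refine Real.sqrt_le_iff.2 ⟨by positivity, ?_⟩
    change _ ≤ (√(squareIncrement μ ℱ f k n x) + |martDiff μ ℱ f (n + 1) x|) ^ 2
    rw [add_sq, Real.sq_sqrt (hnn k n x), sq_abs]
    have := mul_nonneg (Real.sqrt_nonneg (squareIncrement μ ℱ f k n x))
      (abs_nonneg (martDiff μ ℱ f (n + 1) x))
    linarith
  · rw [← setIntegral_martDiff_sq hM hB, ← integral_add (hint k n).integrableOn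
      (integrable_martDiff_sq (ℱ := ℱ) hM (n + 1)).integrableOn]
    simp only [squareIncrement_succ hkn]
    exact le_rfl

end Examples

section Domination

variable {Ω : Type u} {mΩ : MeasurableSpace Ω} {μ : Measure Ω} {ℱ : Filtration ℕ mΩ}
  {f : Ω → ℝ} {M : ℝ≥0} {r R : ℝ}

/-- The sparse bound for martingale transforms, from the increments of the transform. -/
theorem exists_sparse_maxTransform [IsFiniteMeasure μ] (hR : 0 < R)
    (hreg : IsRegularFiltration μ ℱ R) (hM : ∀ᵐ x ∂μ, |f x| ≤ M)
    (hr : r = 1 / (2 * (R + 3))) {σ : ℕ → Ω → ℝ} (hσ : IsTransformMultiplier μ ℱ σ) :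
    ∃ ν : ℕ → Ω → WithTop ℕ, IsSparseStoppingSeq μ ℱ ν ∧
      ∀ᵐ x ∂μ, maxTransform μ ℱ σ f x ≤
        (2 * (martConst R).toNNReal : ℝ≥0) * ∑' j : ℕ, Set.indicator {y | ν j y < ⊤}
          (stoppedPercentile μ ℱ (ν j) r (doobMaxFrom μ ℱ (ν j) f)) x := by
  obtain ⟨ν, hν, hν0, hbound⟩ := exists_sparseStoppingSeq
    (isControlled_transformIncrement_sq hσ hM) hR hreg hM hr
  refine ⟨ν, hν, ?_⟩
  filter_upwards [hbound, hν.ae_exists_eq_top, (hσ 0).2] with x hx hJ hσ0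
  refine iSup_le fun l => ?_
  have hb : ∀ j (k : ℕ), ν j x = k → Set.indicator {y | ν j y < ⊤}
      (stoppedPercentile μ ℱ (ν j) r (doobMaxFrom μ ℱ (ν j) f)) x =
      stoppedPercentile μ ℱ (ν j) r (doobMaxFrom μ ℱ (ν j) f) x := fun j k hk =>
    indicator_of_mem (show x ∈ {y | ν j y < ⊤} from hk.trans_lt (WithTop.coe_lt_top k)) _
  have := le_two_mul_tsum_of_steps (N := fun j => ν j x)
    (q := fun l => ‖∑ k ∈ Finset.range (l + 1), σ k x * martDiff μ ℱ f k x‖ₑ)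
    (b := fun j => ENNReal.ofReal (martConst R) * Set.indicator {y | ν j y < ⊤}
      (stoppedPercentile μ ℱ (ν j) r (doobMaxFrom μ ℱ (ν j) f)) x)
    (hν0 x) ?_ ?_ hJ l
  · rw [ENNReal.tsum_mul_left, ← mul_assoc] at this
    rwa [ENNReal.coe_mul]
  · rw [hb 0 0 (hν0 x)]
    refine le_trans ?_ (hx 0 0 (hν0 x)).1
    rw [zero_add, Finset.sum_range_one, ← ofReal_norm, ← ofReal_norm]
    refine ENNReal.ofReal_le_ofReal ?_
    rw [norm_mul]
    exact mul_le_of_le_one_left (norm_nonneg _) hσ0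
  · intro j k l hk hkl hl
    rw [hb j k hk]
    have hsum : ∑ m ∈ Finset.range (l + 1), σ m x * martDiff μ ℱ f m x =
        ∑ m ∈ Finset.range (k + 1), σ m x * martDiff μ ℱ f m x +
          transformIncrement μ ℱ σ f k l x := by
      rw [transformIncrement, ← Finset.Ico_add_one_add_one_eq_Ioc,
        Finset.sum_range_add_sum_Ico _ (by omega)]
    simp only [hsum]
    refine (enorm_add_le _ _).trans ?_
    gcongr
    have h1 := (hx j k hk).2 l hkl hl
    rwa [Real.sqrt_sq_eq_abs, ← Real.norm_eq_abs, ofReal_norm] at h1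

/-- The sparse bound for the square function. The chain of stopping times is summed for the squares,
so the square root is taken only at the end. -/
theorem exists_sparse_squareFunction [IsFiniteMeasure μ] (hR : 0 < R)
    (hreg : IsRegularFiltration μ ℱ R) (hM : ∀ᵐ x ∂μ, |f x| ≤ M)
    (hr : r = 1 / (2 * (R + 3))) :
    ∃ ν : ℕ → Ω → WithTop ℕ, IsSparseStoppingSeq μ ℱ ν ∧
      ∀ᵐ x ∂μ, squareFunction μ ℱ f x ≤
        (2 * (martConst R).toNNReal : ℝ≥0) * (∑' j : ℕ, Set.indicator {y | ν j y < ⊤}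
          (fun y => (stoppedPercentile μ ℱ (ν j) r (doobMaxFrom μ ℱ (ν j) f) y) ^ 2) x) ^
            (1 / 2 : ℝ) := by
  obtain ⟨ν, hν, hν0, hbound⟩ := exists_sparseStoppingSeq
    (isControlled_squareIncrement hM) hR hreg hM hr
  refine ⟨ν, hν, ?_⟩
  filter_upwards [hbound, hν.ae_exists_eq_top] with x hx hJ
  have hb : ∀ j (k : ℕ), ν j x = k → Set.indicator {y | ν j y < ⊤}
      (fun y => (stoppedPercentile μ ℱ (ν j) r (doobMaxFrom μ ℱ (ν j) f) y) ^ 2) x =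
      stoppedPercentile μ ℱ (ν j) r (doobMaxFrom μ ℱ (ν j) f) x ^ 2 := fun j k hk =>
    indicator_of_mem (show x ∈ {y | ν j y < ⊤} from hk.trans_lt (WithTop.coe_lt_top k)) _
  set X := ∑' j : ℕ, Set.indicator {y | ν j y < ⊤}
    (fun y => (stoppedPercentile μ ℱ (ν j) r (doobMaxFrom μ ℱ (ν j) f) y) ^ 2) x with hX
  set D := ENNReal.ofReal (martConst R) with hD
  have key : ∀ l, ∑ m ∈ Finset.range (l + 1), ‖martDiff μ ℱ f m x‖ₑ ^ 2 ≤ 2 * (D ^ 2 * X) := by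
    intro l
    have := le_two_mul_tsum_of_steps (N := fun j => ν j x)
      (q := fun l => ∑ m ∈ Finset.range (l + 1), ‖martDiff μ ℱ f m x‖ₑ ^ 2)
      (b := fun j => D ^ 2 * Set.indicator {y | ν j y < ⊤}
        (fun y => (stoppedPercentile μ ℱ (ν j) r (doobMaxFrom μ ℱ (ν j) f) y) ^ 2) x)
      (hν0 x) ?_ ?_ hJ l
    · rwa [ENNReal.tsum_mul_left] at this
    · rw [hb 0 0 (hν0 x), ← mul_pow, zero_add, Finset.sum_range_one]
      exact pow_le_pow_left₀ zero_le (hx 0 0 (hν0 x)).1 2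
    · intro j k l hk hkl hl
      rw [hb j k hk, ← mul_pow]
      have hsum : ∑ m ∈ Finset.range (l + 1), ‖martDiff μ ℱ f m x‖ₑ ^ 2 =
          ∑ m ∈ Finset.range (k + 1), ‖martDiff μ ℱ f m x‖ₑ ^ 2 +
            ENNReal.ofReal (squareIncrement μ ℱ f k l x) := by
        rw [squareIncrement, ENNReal.ofReal_sum_of_nonneg fun _ _ => sq_nonneg _,
          ← Finset.sum_range_add_sum_Ico _ (show k + 1 ≤ l + 1 by omega),
          Finset.Ico_add_one_add_one_eq_Ioc]
        congr 1
        refine Finset.sum_congr rfl fun m _ => ?_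
        rw [← ofReal_norm, ← ENNReal.ofReal_pow (norm_nonneg _), Real.norm_eq_abs, sq_abs]
      simp only [hsum]
      gcongr
      have h1 := pow_le_pow_left₀ zero_le ((hx j k hk).2 l hkl hl) 2
      rwa [← ENNReal.ofReal_pow (Real.sqrt_nonneg _), Real.sq_sqrt (show 0 ≤ squareIncrement μ ℱ f k l x
        from Finset.sum_nonneg fun _ _ => sq_nonneg _)] at h1
  have hS : ∑' m, ‖martDiff μ ℱ f m x‖ₑ ^ 2 ≤ (2 * D) ^ 2 * X := by
    refine (ENNReal.tsum_le_of_sum_range_le fun n => ?_).trans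
      (show 2 * (D ^ 2 * X) ≤ _ by
        rw [mul_pow, mul_assoc]
        gcongr
        norm_num)
    refine le_trans (Finset.sum_le_sum_of_subset ?_) (key n)
    exact Finset.range_subset_range.2 (Nat.le_succ n)
  calc squareFunction μ ℱ f x ≤ ((2 * D) ^ 2 * X) ^ (1 / 2 : ℝ) := by
        unfold squareFunction
        gcongr
    _ = 2 * D * X ^ (1 / 2 : ℝ) := by
        rw [ENNReal.mul_rpow_of_nonneg _ _ (by norm_num), ← ENNReal.rpow_natCast,
          ← ENNReal.rpow_mul]
        norm_num
    _ = _ := by rw [ENNReal.coe_mul]; rfl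

end Domination

end CancellativeSparse

open CancellativeSparse in
theorem theoremA :
    -- Regular filtrations: martingale transforms and the square function
    (∀ R : ℝ, 0 < R → ∃ C : ℝ≥0, ∀ (Ω : Type u) (mΩ : MeasurableSpace Ω) (μ : Measure Ω),
      IsProbabilityMeasure μ → ∀ ℱ : Filtration ℕ mΩ, IsRegularFiltration μ ℱ R →
        ∀ f : Ω → ℝ, MemLp f ∞ μ →
          (∀ σ : ℕ → Ω → ℝ, IsTransformMultiplier μ ℱ σ →
            ∃ ν : ℕ → Ω → WithTop ℕ, IsSparseStoppingSeq μ ℱ ν ∧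
              ∀ᵐ x ∂μ, maxTransform μ ℱ σ f x ≤
                C * ∑' j : ℕ, Set.indicator {y | ν j y < ⊤}
                  (stoppedPercentile μ ℱ (ν j) (1 / (2 * (R + 3))) (doobMaxFrom μ ℱ (ν j) f)) x) ∧
          (∃ ν : ℕ → Ω → WithTop ℕ, IsSparseStoppingSeq μ ℱ ν ∧
            ∀ᵐ x ∂μ, squareFunction μ ℱ f x ≤
              C * (∑' j : ℕ, Set.indicator {y | ν j y < ⊤}
                (fun y => (stoppedPercentile μ ℱ (ν j) (1 / (2 * (R + 3)))
                  (doobMaxFrom μ ℱ (ν j) f) y) ^ 2) x) ^ (1 / 2 : ℝ))) ∧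
    -- Haar shifts
    (∀ d : ℕ, 0 < d → ∀ t s : ℕ, ∃ r ∈ Set.Ioo (0 : ℝ) 1, ∃ C : ℝ≥0,
      ∀ h : DyadicCube d → Fin (2 ^ d - 1) → (Fin d → ℝ) → ℝ, IsHaarBasis h →
        ∀ (α : ShiftCoeff d) (A : ℝ≥0),
          (∀ Q, ∀ T ∈ Q.descendants t, ∀ S ∈ Q.descendants s, ∀ i j, |α Q T S i j| ≤ A) →
            ∀ f : (Fin d → ℝ) → ℝ, LocallyIntegrable f →
              ∃ S : Set (DyadicCube d), IsSparseFamily (1 / 2) S ∧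
                ∀ x, maxHaarShift h t s α f x ≤ C * A * sparseSum r S f x) ∧
    -- The dyadic maximal function
    (∀ d : ℕ, 0 < d → ∃ r ∈ Set.Ioo (0 : ℝ) 1, ∃ C : ℝ≥0,
      ∀ f : (Fin d → ℝ) → ℝ, LocallyIntegrable f →
        ∃ S : Set (DyadicCube d), IsSparseFamily (1 / 2) S ∧
          ∀ x, dyadicMax f x ≤ C * sparseSum r S f x) := by
  refine ⟨fun R hR => ⟨2 * (martConst R).toNNReal, fun Ω mΩ μ hμ ℱ hreg f hf => ?_⟩,
    fun d hd t s => ⟨dyadicLevel d t, dyadicLevel_mem_Ioo d t,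
      (2 * stepConst d s (layerConst d t s)).toNNReal, fun h hh α A hα f hf =>
        exists_sparse_maxHaarShift hd hh hf hα⟩,
    fun d hd => ⟨dyadicLevel d 0, dyadicLevel_mem_Ioo d 0, 1, fun f hf => ?_⟩⟩
  · have hM : ∀ᵐ x ∂μ, |f x| ≤ ((eLpNorm f ∞ μ).toNNReal : ℝ) := by
      have hfin : eLpNormEssSup f μ < ∞ := by simpa using hf.eLpNorm_lt_top
      filter_upwards [ae_le_eLpNormEssSup (f := f) (μ := μ)] with x hx
      rw [eLpNorm_exponent_top, ← Real.norm_eq_abs, ← coe_nnnorm, NNReal.coe_le_coe]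
      exact ENNReal.le_toNNReal_of_coe_le hx hfin.ne
    exact ⟨fun σ hσ => exists_sparse_maxTransform hR hreg hM rfl hσ,
      exists_sparse_squareFunction hR hreg hM rfl⟩
  · obtain ⟨S, hS, h⟩ := exists_sparse_dyadicMax hd hf
    exact ⟨S, hS, fun x => by simpa using h x⟩
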